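/- Let $n,k\ge 1$ be integers and let $\Delta_n$ be a knot sequence $0=x_0<x_1<\dots<x_n=1$, extended by $x_j=0$ for $j<0$ and $x_j=1$ for $j>n$. Put $|\Delta_n|_{\min}=\min_{0\le j<n}(x_{j+1}-x_j)$. For $m\ge 1$ let $\xi_{j,m}=\frac{x_{j+1}+\dots+x_{j+m}}{m}$ be the Greville nodes, and let $N_{j,m}$ be the normalized B-spline of degree $m$ with knots $x_j,\dots,x_{j+m+1}$ (so that $\sum_{j=-m}^{n-1}N_{j,m}=1$ on $[0,1]$). Let $X_p=L^p([0,1])$ for $1\le p<\infty$ and $X_\infty=C([0,1])$ with the sup norm (complex-valued functions). The Schoenberg operator on $C([0,1])$ is $S_{\Delta_n,k}f=\sum_{j=-k}^{n-1}f(\xi_{j,k})N_{j,k}$, and the integral Schoenberg operator on $X_p$ is $$V_{\Delta_n,k}f=\sum_{j=-k}^{n-1}\int_{\xi_{j-1,k+1}}^{\xi_{j,k+1}}f(t)\,dt\;\frac{N_{j,k}}{\xi_{j,k+1}-\xi_{j-1,k+1}} .$$ Let $d_m$ be the sup-norm condition number of the B-spline bases of degree $m$, i.e. the smallest constant, depending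 only on $m$, such that $\max_j|c_j|\le d_m\sup_{x\in[0,1]}\bigl|\sum_{j=-m}^{n'-1}c_jN_{j,m}(x)\bigr|$ for all knot sequences (with any number $n'\ge1$ of intervals) and all real coefficients. For a bounded operator $T$ write $\gamma(T)=\sup\{|\lambda|:\lambda\in\sigma(T),\ \lambda\ne 1\}$. For $f \in X_p$ and $t>0$ let $$\omega_{1,p}(f,t)=\sup_{0<|h|\le t}\bigl\|\chi_{\Omega(h)}\,(f(\cdot+h)-f)\bigr\|_p,\qquad \Omega(h)=\{x\in[0,1]: x+sh\in[0,1]\text{ for }0\le s\le 1\}.$$ Then for every $1\le p\le\infty$, every $f\in X_p$, and for $\gamma_{\Delta_n,k}$ equal to either of the two numbers $\gamma(V_{\Delta_n,k})$ (with $V_{\Delta_n,k}$ acting on $X_p$) and $\gamma(S_{\Delta_n,k})$, $$\frac16\,\omega_{1,p}\bigl(f,t(\Delta_n,k)\bigr)\le\|V_{\Delta_n,k}f-f\|_p,\qquad\text{where}\quad t(\Delta_n,k)=\frac{|\Delta_n|_{\min}^2}{(k+1)^2}\cdot\frac{1-\gamma_{\Delta_n,k}}{d_{k+1}} .$$ 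-/

import Mathlib

open MeasureTheory
open scoped ENNReal

namespace SplineLower

/-! ### Knots and B-splines on `[0, 1]` -/

/-- A knot sequence `0 = x_0 < x_1 < ⋯ < x_n = 1`, extended by `x_j = 0` for `j ≤ 0` and by
`x_j = 1` for `j ≥ n`, so that the same sequence serves splines of every degree. -/
structure KnotSeq (n : ℕ) where
  x : ℤ → ℝ
  eq_zero : ∀ j : ℤ, j ≤ 0 → x j = 0
  eq_one : ∀ j : ℤ, (n : ℤ) ≤ j → x j = 1
  strictMonoOn : StrictMonoOn x (Set.Icc (0 : ℤ) n)

/-- The minimal mesh gauge `min {x_{j+1} - x_j : 0 ≤ j < n}`. -/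
noncomputable def KnotSeq.meshMin {n : ℕ} (Δ : KnotSeq n) : ℝ :=
  ⨅ j : Fin n, (Δ.x ((j : ℤ) + 1) - Δ.x (j : ℤ))

/-- The Greville nodes `ξ_{j,k} = (x_{j+1} + ⋯ + x_{j+k}) / k`. -/
noncomputable def KnotSeq.greville {n : ℕ} (Δ : KnotSeq n) (k : ℕ) (j : ℤ) : ℝ :=
  (∑ i ∈ Finset.range k, Δ.x (j + (i : ℤ) + 1)) / k

/-- The normalized B-splines `N_{j,d}` of degree `d`, with knots `x_j, …, x_{j+d+1}`, through the
Cox–de Boor recursion. The indicator functions of degree `0` belong to the intervals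
`[x_j, x_{j+1})`, except that the last interval is closed at the right end point `1`; a quotient
with denominator `0` counts as `0`, as usual. -/
noncomputable def bspline (x : ℤ → ℝ) : ℕ → ℤ → ℝ → ℝ
  | 0, j, t =>
      open Classical in
      if x j ≤ t ∧ x j < x (j + 1) ∧ (t < x (j + 1) ∨ (t = x (j + 1) ∧ x (j + 1) = 1))
      then 1 else 0
  | d + 1, j, t =>
      (t - x j) / (x (j + d + 1) - x j) * bspline x d j t
        + (x (j + d + 2) - t) / (x (j + d + 2) - x (j + 1)) * bspline x d (j + 1) t

/-- The condition number `d_k` of the B-spline bases of degree `k` in the sup norm: the smallest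
constant `d` with `max_j |c_j| ≤ d * ‖∑_j c_j N_{j,k}‖_∞` for all knot sequences and all
coefficients. -/
noncomputable def bsplineCond (k : ℕ) : ℝ :=
  sInf {d : ℝ | ∀ (n : ℕ) (Δ : KnotSeq n) (c : ℤ → ℝ) (M : ℝ),
    (∀ t ∈ Set.Icc (0 : ℝ) 1, |∑ j ∈ Finset.Ico (-(k : ℤ)) n, c j * bspline Δ.x k j t| ≤ M) →
    ∀ j ∈ Finset.Ico (-(k : ℤ)) n, |c j| ≤ d * M}

/-! ### Facts needed to see that the operators below are well defined -/

theorem KnotSeq.mem_Icc {n : ℕ} (Δ : KnotSeq n) (j : ℤ) : Δ.x j ∈ Set.Icc (0 : ℝ) 1 := by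
  rcases le_total j 0 with h | h
  · simp [Δ.eq_zero j h]
  rcases le_total (n : ℤ) j with h' | h'
  · simp [Δ.eq_one j h']
  have h0 := Δ.strictMonoOn.monotoneOn (a := 0) (b := j) ⟨le_rfl, by omega⟩ ⟨h, h'⟩ h
  have h1 := Δ.strictMonoOn.monotoneOn (a := j) (b := n) ⟨h, h'⟩ ⟨by omega, le_rfl⟩ h'
  rw [Δ.eq_zero 0 le_rfl] at h0
  rw [Δ.eq_one n le_rfl] at h1
  exact ⟨h0, h1⟩

theorem KnotSeq.step {n : ℕ} (Δ : KnotSeq n) (j : ℤ) :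
    Δ.x j < Δ.x (j + 1) ∨ (Δ.x j = 0 ∧ Δ.x (j + 1) = 0) ∨ (Δ.x j = 1 ∧ Δ.x (j + 1) = 1) := by
  rcases lt_or_ge j 0 with h | h
  · exact Or.inr (Or.inl ⟨Δ.eq_zero _ h.le, Δ.eq_zero _ (by omega)⟩)
  rcases le_or_gt (n : ℤ) j with h' | h'
  · exact Or.inr (Or.inr ⟨Δ.eq_one _ h', Δ.eq_one _ (by omega)⟩)
  · exact Or.inl (Δ.strictMonoOn ⟨h, h'.le⟩ ⟨by omega, by omega⟩ (by omega))

theorem KnotSeq.greville_mem {n : ℕ} (Δ : KnotSeq n) (k : ℕ) (j : ℤ) :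
    Δ.greville k j ∈ Set.Icc (0 : ℝ) 1 := by
  unfold KnotSeq.greville
  constructor
  · exact div_nonneg (Finset.sum_nonneg fun i _ => (Δ.mem_Icc _).1) (Nat.cast_nonneg k)
  · refine div_le_one_of_le₀ ?_ (Nat.cast_nonneg k)
    calc _ ≤ ∑ i ∈ Finset.range k, (1 : ℝ) := Finset.sum_le_sum fun i _ => (Δ.mem_Icc _).2
      _ = k := by simp

theorem bspline_one_continuousOn {n : ℕ} (Δ : KnotSeq n) (j : ℤ) :
    ContinuousOn (bspline Δ.x 1 j) (Set.Icc 0 1) := by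
  have e1 : j + 1 + 1 = j + 2 := by ring
  have hb := Δ.step (j + 1)
  have ha := Δ.step j
  have hm0 := Δ.mem_Icc j
  have hm2 := Δ.mem_Icc (j + 2)
  rw [e1] at hb
  set a := Δ.x j with ha'
  set b := Δ.x (j + 1) with hb'
  set c := Δ.x (j + 2) with hc'
  have key : ∀ t, bspline Δ.x 1 j t =
      (t - a) / (b - a) * (open Classical in
        if a ≤ t ∧ a < b ∧ (t < b ∨ (t = b ∧ b = 1)) then 1 else 0)
      + (c - t) / (c - b) * (open Classical in
        if b ≤ t ∧ b < c ∧ (t < c ∨ (t = c ∧ c = 1)) then 1 else 0) := by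
    intro t
    simp [bspline, e1, ha', hb', hc']
  by_cases h1 : a < b
  · by_cases h2 : b < c
    · have : ContinuousOn (fun t => max 0 (min ((t - a) / (b - a)) ((c - t) / (c - b))))
          (Set.Icc 0 1) := by fun_prop
      refine this.congr fun t ht => ?_
      rw [key]
      have p1 : 0 < b - a := by linarith
      have p2 : 0 < c - b := by linarith
      have hc1 := hm2.2
      beta_reduce
      rcases lt_or_ge t a with h | h
      · rw [if_neg (by intro h'; linarith [h'.1]), if_neg (by intro h'; linarith [h'.1])]
        rw [max_eq_left]; · simp
        exact (min_le_left _ _).trans (div_nonpos_of_nonpos_of_nonneg (by linarith) p1.le)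
      rcases lt_or_ge t b with hb1 | hb1
      · rw [if_pos ⟨h, h1, Or.inl hb1⟩, if_neg (by intro h'; linarith [h'.1])]
        have q1 : (t - a) / (b - a) ≤ 1 := by rw [div_le_one p1]; linarith
        have q2 : 1 ≤ (c - t) / (c - b) := by rw [one_le_div p2]; linarith
        have q3 : 0 ≤ (t - a) / (b - a) := div_nonneg (by linarith) p1.le
        rw [min_eq_left (q1.trans q2), max_eq_right q3]; ring
      rw [if_neg (by
        rintro ⟨-, -, h' | h'⟩
        · linarith
        · linarith [h'.2])]
      have q1 : 1 ≤ (t - a) / (b - a) := by rw [one_le_div p1]; linarith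
      have q2 : (c - t) / (c - b) ≤ 1 := by rw [div_le_one p2]; linarith
      rw [min_eq_right (q2.trans q1)]
      rcases lt_or_ge t c with hc1 | hc1
      · rw [if_pos ⟨hb1, h2, Or.inl hc1⟩,
          max_eq_right (div_nonneg (by linarith) p2.le)]; ring
      · rw [max_eq_left (div_nonpos_of_nonpos_of_nonneg (by linarith) p2.le)]
        split_ifs with h'
        · rcases h'.2.2 with h'' | h''
          · linarith
          · simp [h''.1]
        · ring
    · have hbc : b = 1 ∧ c = 1 := by
        rcases hb with h | h | h
        · exact absurd h h2
        · linarith [hm0.1, h.1]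
        · exact h
      have : ContinuousOn (fun t => max 0 ((t - a) / (b - a))) (Set.Icc 0 1) := by fun_prop
      refine this.congr fun t ht => ?_
      rw [key]
      have p1 : 0 < b - a := by linarith
      have z : ¬(b ≤ t ∧ b < c ∧ (t < c ∨ (t = c ∧ c = 1))) := fun h' => h2 h'.2.1
      beta_reduce
      rw [if_neg z]
      rcases lt_or_ge t a with h | h
      · rw [if_neg (by intro h'; linarith [h'.1]),
          max_eq_left (div_nonpos_of_nonpos_of_nonneg (by linarith) p1.le)]; ring
      · have : t < b ∨ (t = b ∧ b = 1) := by
          rcases lt_or_eq_of_le ht.2 with h' | h'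
          · left; linarith [hbc.1]
          · right; exact ⟨by rw [h', hbc.1], hbc.1⟩
        rw [if_pos ⟨h, h1, this⟩, max_eq_right (div_nonneg (by linarith) p1.le)]; ring
  · by_cases h2 : b < c
    · have hab : a = 0 ∧ b = 0 := by
        rcases ha with h | h | h
        · exact absurd h h1
        · exact h
        · linarith [hm2.2, h.2]
      have : ContinuousOn (fun t => max 0 ((c - t) / (c - b))) (Set.Icc 0 1) := by fun_prop
      refine this.congr fun t ht => ?_
      rw [key]
      have p2 : 0 < c - b := by linarith
      have ht0 := ht.1
      beta_reduce
      rw [if_neg (fun h' => h1 h'.2.1)]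
      rcases lt_or_ge t c with h | h
      · rw [if_pos ⟨by linarith [hab.2], h2, Or.inl h⟩,
          max_eq_right (div_nonneg (by linarith) p2.le)]; ring
      · rw [max_eq_left (div_nonpos_of_nonpos_of_nonneg (by linarith) p2.le)]
        split_ifs with h'
        · rcases h'.2.2 with h'' | h''
          · linarith
          · simp [h''.1]
        · ring
    · refine (continuousOn_const (c := (0 : ℝ))).congr fun t _ => ?_
      rw [key, if_neg (fun h' => h1 h'.2.1), if_neg (fun h' => h2 h'.2.1)]
      ring

theorem bspline_continuousOn {n : ℕ} (Δ : KnotSeq n) {k : ℕ} (hk : 1 ≤ k) :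
    ∀ j : ℤ, ContinuousOn (bspline Δ.x k j) (Set.Icc 0 1) := by
  induction k, hk using Nat.le_induction with
  | base => exact bspline_one_continuousOn Δ
  | succ d _ ih =>
    intro j
    have h1 := ih j
    have h2 := ih (j + 1)
    have : bspline Δ.x (d + 1) j = fun t =>
        (t - Δ.x j) / (Δ.x (j + d + 1) - Δ.x j) * bspline Δ.x d j t
        + (Δ.x (j + d + 2) - t) / (Δ.x (j + d + 2) - Δ.x (j + 1)) * bspline Δ.x d (j + 1) t := by
      funext t; simp [bspline]
    rw [this]
    exact ((by fun_prop : ContinuousOn (fun t => (t - Δ.x j) / (Δ.x (j + d + 1) - Δ.x j))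
      (Set.Icc 0 1)).mul h1).add ((by fun_prop : ContinuousOn (fun t =>
        (Δ.x (j + d + 2) - t) / (Δ.x (j + d + 2) - Δ.x (j + 1))) (Set.Icc 0 1)).mul h2)

/-! ### The operators -/

/-- Lebesgue measure on `[0, 1]`. -/
noncomputable abbrev unitMeasure : Measure ℝ := volume.restrict (Set.Icc (0 : ℝ) 1)

instance : IsProbabilityMeasure unitMeasure := ⟨by simp⟩

/-- The B-spline `N_{j,k}`, `k ≥ 1`, as an element of `C([0, 1])`. -/
noncomputable def bsplineC {n : ℕ} (Δ : KnotSeq n) (k : ℕ) (hk : 1 ≤ k) (j : ℤ) :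
    C(Set.Icc (0 : ℝ) 1, ℂ) where
  toFun t := (bspline Δ.x k j t : ℂ)
  continuous_toFun := Complex.continuous_ofReal.comp
    (continuousOn_iff_continuous_domRestrict.1 (bspline_continuousOn Δ hk j))

theorem bspline_memLp {n : ℕ} (Δ : KnotSeq n) {k : ℕ} (hk : 1 ≤ k) (j : ℤ) (p : ℝ≥0∞) :
    MemLp (fun t => (bspline Δ.x k j t : ℂ)) p unitMeasure := by
  have h : ContinuousOn (fun t => (bspline Δ.x k j t : ℂ)) (Set.Icc 0 1) :=
    Complex.continuous_ofReal.comp_continuousOn (bspline_continuousOn Δ hk j)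
  obtain ⟨C, hC⟩ := isCompact_Icc.exists_bound_of_continuousOn h
  exact MemLp.of_bound (h.aestronglyMeasurable measurableSet_Icc) C
    ((ae_restrict_iff' measurableSet_Icc).2 (ae_of_all _ hC))

/-- The B-spline `N_{j,k}`, `k ≥ 1`, as an element of `L^p([0, 1])`. -/
noncomputable def bsplineLp {n : ℕ} (Δ : KnotSeq n) (k : ℕ) (hk : 1 ≤ k) (p : ℝ≥0∞) (j : ℤ) :
    Lp ℂ p unitMeasure :=
  (bspline_memLp Δ hk j p).toLp _

/-- The functional `f ↦ ∫_a^b f(t) dt` on `L^p([0, 1])`; it is used for `0 ≤ a ≤ b ≤ 1`. -/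
noncomputable def integralLp (p : ℝ≥0∞) [hp : Fact (1 ≤ p)] (a b : ℝ) :
    Lp ℂ p unitMeasure →L[ℂ] ℂ :=
  LinearMap.mkContinuous
    { toFun := fun f => ∫ t in a..b, f t ∂unitMeasure
      map_add' := fun f g => by
        rw [← intervalIntegral.integral_add
          (((Lp.memLp f).integrable hp.out).intervalIntegrable)
          (((Lp.memLp g).integrable hp.out).intervalIntegrable)]
        refine intervalIntegral.integral_congr_ae ?_
        filter_upwards [Lp.coeFn_add f g] with t ht _ using ht
      map_smul' := fun c f => by
        simp only [RingHom.id_apply]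
        rw [← intervalIntegral.integral_smul]
        refine intervalIntegral.integral_congr_ae ?_
        filter_upwards [Lp.coeFn_smul c f] with t ht _ using ht }
    1 fun f => by
      have hi := (Lp.memLp f).integrable hp.out
      have h1 : ‖∫ t in a..b, f t ∂unitMeasure‖ ≤ ∫ t, ‖f t‖ ∂unitMeasure :=
        (intervalIntegral.norm_integral_le_integral_norm_uIoc).trans
          (setIntegral_le_integral hi.norm (ae_of_all _ fun _ => norm_nonneg _))
      have h2 : ∫ t, ‖f t‖ ∂unitMeasure ≤ ‖f‖ := by
        rw [Lp.norm_def, integral_norm_eq_lintegral_enorm hi.aestronglyMeasurable,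
          ← eLpNorm_one_eq_lintegral_enorm]
        exact ENNReal.toReal_mono (Lp.eLpNorm_ne_top f)
          (eLpNorm_le_eLpNorm_of_exponent_le hp.out (Lp.aestronglyMeasurable f))
      simpa using h1.trans h2

/-- The functional `f ↦ ∫_a^b f(t) dt` on `C([0, 1])`; it is used for `0 ≤ a ≤ b ≤ 1`. -/
noncomputable def integralC (a b : ℝ) : C(Set.Icc (0 : ℝ) 1, ℂ) →L[ℂ] ℂ :=
  LinearMap.mkContinuous
    { toFun := fun f => ∫ t in a..b, Set.IccExtend zero_le_one f t
      map_add' := fun f g => by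
        rw [← intervalIntegral.integral_add
          ((f.continuous.Icc_extend').intervalIntegrable a b)
          ((g.continuous.Icc_extend').intervalIntegrable a b)]
        rfl
      map_smul' := fun c f => by
        simp only [RingHom.id_apply]
        rw [← intervalIntegral.integral_smul]
        rfl }
    |b - a| fun f => by
      have := intervalIntegral.norm_integral_le_of_norm_le_const (a := a) (b := b) (C := ‖f‖)
        (f := Set.IccExtend zero_le_one f) fun t _ => f.norm_coe_le_norm _
      simpa [mul_comm] using this

/-- The Schoenberg operator `S_{Δ,k} f = ∑_{j=-k}^{n-1} f(ξ_{j,k}) N_{j,k}` on `C([0, 1])`. -/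
noncomputable def schoenberg {n : ℕ} (Δ : KnotSeq n) (k : ℕ) (hk : 1 ≤ k) :
    C(Set.Icc (0 : ℝ) 1, ℂ) →L[ℂ] C(Set.Icc (0 : ℝ) 1, ℂ) :=
  ∑ j ∈ Finset.Ico (-(k : ℤ)) n,
    (ContinuousMap.evalCLM ℂ
      (⟨Δ.greville k j, Δ.greville_mem k j⟩ : Set.Icc (0 : ℝ) 1)).smulRight (bsplineC Δ k hk j)

/-- The integral Schoenberg operator on `L^p([0, 1])`,
`V_{Δ,k} f = ∑_{j=-k}^{n-1} (∫_{ξ_{j-1,k+1}}^{ξ_{j,k+1}} f(t) dt) N_{j,k} / (ξ_{j,k+1} - ξ_{j-1,k+1})`. -/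
noncomputable def intSchoenbergLp {n : ℕ} (Δ : KnotSeq n) (k : ℕ) (hk : 1 ≤ k)
    (p : ℝ≥0∞) [Fact (1 ≤ p)] : Lp ℂ p unitMeasure →L[ℂ] Lp ℂ p unitMeasure :=
  ∑ j ∈ Finset.Ico (-(k : ℤ)) n,
    (integralLp p (Δ.greville (k + 1) (j - 1)) (Δ.greville (k + 1) j)).smulRight
      (((Δ.greville (k + 1) j - Δ.greville (k + 1) (j - 1) : ℝ) : ℂ)⁻¹ • bsplineLp Δ k hk p j)

/-- The integral Schoenberg operator on `C([0, 1])`, by the same formula. -/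
noncomputable def intSchoenbergC {n : ℕ} (Δ : KnotSeq n) (k : ℕ) (hk : 1 ≤ k) :
    C(Set.Icc (0 : ℝ) 1, ℂ) →L[ℂ] C(Set.Icc (0 : ℝ) 1, ℂ) :=
  ∑ j ∈ Finset.Ico (-(k : ℤ)) n,
    (integralC (Δ.greville (k + 1) (j - 1)) (Δ.greville (k + 1) j)).smulRight
      (((Δ.greville (k + 1) j - Δ.greville (k + 1) (j - 1) : ℝ) : ℂ)⁻¹ • bsplineC Δ k hk j)

/-- `sup {|z| : z ∈ σ(T), z ≠ 1}`. -/
noncomputable def spectralSup {E : Type*} [NormedAddCommGroup E] [NormedSpace ℂ E]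
    (T : E →L[ℂ] E) : ℝ :=
  sSup {r : ℝ | ∃ z ∈ spectrum ℂ T, z ≠ 1 ∧ r = ‖z‖}

/-! ### Moduli of smoothness -/

/-- `Ω(h)` for `Ω = [0, 1]`. -/
def shiftDomain (h : ℝ) : Set ℝ :=
  {x | x ∈ Set.Icc (0 : ℝ) 1 ∧ ∀ s ∈ Set.Icc (0 : ℝ) 1, x + s * h ∈ Set.Icc (0 : ℝ) 1}

/-- The modulus of smoothness `ω_{r,p}(f, t)`, `r ≥ 1`, for the norm of `L^p([0, 1])`. -/
noncomputable def modulusLp (r : ℕ) (p : ℝ≥0∞) (f : ℝ → ℂ) (t : ℝ) : ℝ≥0∞ :=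
  ⨆ h ∈ {h : ℝ | 0 < |h| ∧ |h| ≤ t},
    eLpNorm ((shiftDomain (r * h)).indicator ((fwdDiff h)^[r] f)) p unitMeasure

/-- The modulus of smoothness `ω_{r,∞}(f, t)`, `r ≥ 1`, for the sup norm on `[0, 1]`. -/
noncomputable def modulusSup (r : ℕ) (f : ℝ → ℂ) (t : ℝ) : ℝ≥0∞ :=
  ⨆ h ∈ {h : ℝ | 0 < |h| ∧ |h| ≤ t}, ⨆ x ∈ shiftDomain (r * h), ‖(fwdDiff h)^[r] f x‖ₑ

/-- `t(Δ, k) = |Δ|_min² / (k + 1)² * ((1 - γ) / d_{k+1})`. -/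
noncomputable def stepSize {n : ℕ} (Δ : KnotSeq n) (k : ℕ) (γ : ℝ) : ℝ :=
  Δ.meshMin ^ 2 / ((k : ℝ) + 1) ^ 2 * ((1 - γ) / bsplineCond (k + 1))

end SplineLower

namespace SplineLower

/-! ### Elementary properties of knots and B-splines -/

/-! Put e = f - Vf, and let a_j be the mean of f over the j-th Greville cell of degree k+1, so that
Vf = ∑ a_j N_{j,k}. It suffices that ‖Vf(·+h) - Vf‖_p ≤ 4‖e‖_p for 0 < h ≤ t(Δ,k): the two
translates of e add at most 2‖e‖_p, and 4 + 2 = 6.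

To control the increments of Vf by e, integrate. With F_j = ∫_0^{ξ_j} f at the nodes of degree k+1,
the spline ∑ F_j N_{j,k+1} is the primitive of Vf. Hence F_j - (SF)(ξ_j) = ∫_0^{ξ_j} e with S the
Schoenberg operator of degree k+1, and a_j - a_{j-1} is a jump of the slope of the polygon F.
Solving this discrete boundary value problem writes the increments of a as a matrix applied to the
cell means of e (`KnotSeq.KernelBound.exists_repr`). If its row and column sums are at most C times
the cell widths (`KnotSeq.KernelBound`), Schur's test gives the bound C h ‖e‖_p, and t(Δ,k) is the
step for which C h ≤ 4.

The sums are bounded by a maximum principle: solutions are dominated by any z ≥ 0 with z - Sz ≥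
ξ(1-ξ) (`KnotSeq.norm_le_of_supersolution`). Since S preserves concavity, solutions whose data are
Green functions have decreasing slopes, so their jumps telescope (`KnotSeq.exists_green`,
`KnotSeq.exists_kernel`). Rows follow by duality.

A supersolution of size d_{k+1}/(1-γ) comes from the spectrum: a truncated Neumann series and
Gelfand's formula give a concave w with Sw ≤ l w for any l > γ
(`KnotSeq.exists_concave_supersolution`), and w/(1-l) is the supersolution. For γ(V) the degree
fits, since derivatives of eigensplines of degree k+1 are eigenfunctions of V. For γ(S) it is one
too low; `KnotSeq.schoen_sub_le` compares the two degrees on convex functions and loses the factor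
2(k+1)²/k. This is absorbed by d_{k+1}, which a Chebyshev polynomial bounds from below
(`le_bsplineCond`). That works for k ≥ 3; for k = 1, 2 the jumps are estimated directly without the
spectrum, and n = 1 has an explicit supersolution. -/

theorem KnotSeq.monotone {n : ℕ} (Δ : KnotSeq n) : Monotone Δ.x := by
  refine monotone_int_of_le_succ fun j => ?_
  rcases Δ.step j with h | h | h
  · exact h.le
  · rw [h.1, h.2]
  · rw [h.1, h.2]

theorem KnotSeq.one_le {n : ℕ} (Δ : KnotSeq n) : 1 ≤ n := by
  by_contra h
  have h0 := Δ.eq_zero 0 le_rfl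
  have h1 := Δ.eq_one 0 (by omega)
  rw [h0] at h1
  exact zero_ne_one h1

theorem KnotSeq.lt_of_lt {n : ℕ} (Δ : KnotSeq n) {i j : ℤ} (hij : i < j) (hi : i < n) (hj : 0 < j) :
    Δ.x i < Δ.x j := by
  have hn := Δ.one_le
  have h1 : Δ.x i ≤ Δ.x (max i 0) := Δ.monotone (le_max_left _ _)
  have h2 : Δ.x (min j n) ≤ Δ.x j := Δ.monotone (min_le_left _ _)
  refine h1.trans_lt (lt_of_lt_of_le (Δ.strictMonoOn ⟨?_, ?_⟩ ⟨?_, ?_⟩ ?_) h2) <;> omega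

theorem bspline_succ (x : ℤ → ℝ) (d : ℕ) (j : ℤ) (t : ℝ) :
    bspline x (d + 1) j t = (t - x j) / (x (j + d + 1) - x j) * bspline x d j t
      + (x (j + d + 2) - t) / (x (j + d + 2) - x (j + 1)) * bspline x d (j + 1) t := by
  simp [bspline]

/-- Positivity and support must be proved together: the quotients in the recursion have the right
sign only on the support of the B-spline they multiply. The strict inequality of knots records that
the denominator is nonzero wherever the B-spline is. -/
theorem bspline_nonneg_support {x : ℤ → ℝ} (hx : Monotone x) (d : ℕ) : ∀ (j : ℤ) (t : ℝ),
    0 ≤ bspline x d j t ∧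
      (bspline x d j t ≠ 0 → x j ≤ t ∧ t ≤ x (j + d + 1) ∧ x j < x (j + d + 1)) := by
  induction d with
  | zero =>
    intro j t
    simp only [bspline]
    split_ifs with h
    · refine ⟨zero_le_one, fun _ => ⟨h.1, ?_, by simpa using h.2.1⟩⟩
      rcases h.2.2 with h' | h'
      · simpa using h'.le
      · simpa using h'.1.le
    · simp
  | succ d ih =>
    intro j t
    have i1 := ih j t
    have i2 := ih (j + 1) t
    have e1 : j + 1 + (d : ℤ) + 1 = j + d + 2 := by ring
    have e2 : j + ((d + 1 : ℕ) : ℤ) + 1 = j + d + 2 := by push_cast; ring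
    rw [e1] at i2
    rw [e2, bspline_succ]
    have m1 : x j ≤ x (j + 1) := hx (by omega)
    have m2 : x (j + d + 1) ≤ x (j + d + 2) := hx (by omega)
    have n1 : 0 ≤ (t - x j) / (x (j + d + 1) - x j) * bspline x d j t := by
      rcases eq_or_ne (bspline x d j t) 0 with h | h
      · simp [h]
      · obtain ⟨a, b, c⟩ := i1.2 h
        exact mul_nonneg (div_nonneg (by linarith) (by linarith)) i1.1
    have n2 : 0 ≤ (x (j + d + 2) - t) / (x (j + d + 2) - x (j + 1)) * bspline x d (j + 1) t := by
      rcases eq_or_ne (bspline x d (j + 1) t) 0 with h | h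
      · simp [h]
      · obtain ⟨a, b, c⟩ := i2.2 h
        exact mul_nonneg (div_nonneg (by linarith) (by linarith)) i2.1
    refine ⟨add_nonneg n1 n2, fun h => ?_⟩
    rcases eq_or_ne (bspline x d j t) 0 with h1 | h1
    · rcases eq_or_ne (bspline x d (j + 1) t) 0 with h2 | h2
      · simp [h1, h2] at h
      · obtain ⟨a, b, c⟩ := i2.2 h2
        exact ⟨by linarith, by linarith, by linarith⟩
    · obtain ⟨a, b, c⟩ := i1.2 h1
      exact ⟨by linarith, by linarith, by linarith⟩

variable {n : ℕ} (Δ : KnotSeq n)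

theorem KnotSeq.bspline_nonneg (d : ℕ) (j : ℤ) (t : ℝ) : 0 ≤ bspline Δ.x d j t :=
  (bspline_nonneg_support Δ.monotone d j t).1

theorem KnotSeq.bspline_support {d : ℕ} {j : ℤ} {t : ℝ} (h : bspline Δ.x d j t ≠ 0) :
    Δ.x j ≤ t ∧ t ≤ Δ.x (j + d + 1) ∧ Δ.x j < Δ.x (j + d + 1) :=
  (bspline_nonneg_support Δ.monotone d j t).2 h

theorem KnotSeq.bspline_eq_zero {d : ℕ} {j : ℤ} (t : ℝ) (h : Δ.x j = Δ.x (j + d + 1)) :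
    bspline Δ.x d j t = 0 := by
  by_contra h'
  exact (Δ.bspline_support h').2.2.ne h

/-- Together with its mirror image, this removes the boundary terms when a sum over the index range
of one degree is rewritten over that of the next. -/
theorem KnotSeq.bspline_eq_zero_left {d : ℕ} {j : ℤ} (t : ℝ) (h : j + d + 1 ≤ 0) :
    bspline Δ.x d j t = 0 :=
  Δ.bspline_eq_zero t (by rw [Δ.eq_zero _ h, Δ.eq_zero j (by omega)])

theorem KnotSeq.bspline_eq_zero_right {d : ℕ} {j : ℤ} (t : ℝ) (h : (n : ℤ) ≤ j) :
    bspline Δ.x d j t = 0 :=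
  Δ.bspline_eq_zero t (by rw [Δ.eq_one _ h, Δ.eq_one _ (by omega)])

theorem measurable_bspline (x : ℤ → ℝ) (d : ℕ) : ∀ j : ℤ, Measurable (bspline x d j) := by
  induction d with
  | zero =>
    intro j
    have : bspline x 0 j = fun t => open Classical in
        if x j ≤ t ∧ x j < x (j + 1) ∧ (t < x (j + 1) ∨ (t = x (j + 1) ∧ x (j + 1) = 1))
        then 1 else 0 := by funext t; simp only [bspline]
    rw [this]
    refine Measurable.ite ?_ measurable_const measurable_const
    refine (measurableSet_le measurable_const measurable_id).inter
      ((MeasurableSet.const _).inter ((measurableSet_lt measurable_id measurable_const).union ?_))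
    exact (measurableSet_eq_fun measurable_id measurable_const).inter (MeasurableSet.const _)
  | succ d ih =>
    intro j
    have : bspline x (d + 1) j = fun t => (t - x j) / (x (j + d + 1) - x j) * bspline x d j t
      + (x (j + d + 2) - t) / (x (j + d + 2) - x (j + 1)) * bspline x d (j + 1) t :=
      funext fun t => bspline_succ x d j t
    rw [this]
    have h1 := ih j
    have h2 := ih (j + 1)
    fun_prop

/-! ### Splines -/

section Spline

variable {E : Type*} [AddCommGroup E] [Module ℝ E]

/-- The spline `∑_j N_{j,d}(t) c_j` of degree `d`. -/
noncomputable def KnotSeq.spline (d : ℕ) (c : ℤ → E) (t : ℝ) : E :=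
  ∑ j ∈ Finset.Ico (-(d : ℤ)) n, bspline Δ.x d j t • c j

/-- Summation by parts without boundary terms. It serves both the de Boor step and the derivative
formula. -/
theorem sum_Ico_shift {R : Type*} [Ring R] {E : Type*} [AddCommGroup E] [Module R E]
    {a b : ℤ} (hab : a ≤ b) (p q : ℤ → R) (c : ℤ → E)
    (hp : p (a - 1) = 0) (hq : q b = 0) :
    ∑ j ∈ Finset.Ico (a - 1) b, (p j • c j + q (j + 1) • c j)
      = ∑ j ∈ Finset.Ico a b, (p j • c j + q j • c (j - 1)) := by
  rw [Finset.sum_add_distrib, Finset.sum_add_distrib]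
  congr 1
  · rw [← Finset.insert_Ico_left_eq_Ico_sub_one, Finset.sum_insert (by simp)]
    · simp [hp]
    all_goals omega
  · have : Finset.Ico (a - 1) b = (Finset.Ico a (b + 1)).map (addRightEmbedding (-1)) := by
      ext i; simp only [Finset.mem_Ico, Finset.mem_map, addRightEmbedding_apply]
      constructor
      · intro h; exact ⟨i + 1, by omega, by omega⟩
      · rintro ⟨j, h, rfl⟩; omega
    rw [this, Finset.sum_map]
    have h2 : Finset.Ico a (b + 1) = insert b (Finset.Ico a b) := by
      ext i; simp only [Finset.mem_Ico, Finset.mem_insert]; omega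
    rw [h2, Finset.sum_insert (by simp)]
    simp [hq, sub_eq_add_neg]

/-- The ratio `(t - x_j) / (x_{j+d+1} - x_j)` in the Cox–de Boor recursion. -/
noncomputable def KnotSeq.ratio (d : ℕ) (j : ℤ) (t : ℝ) : ℝ :=
  (t - Δ.x j) / (Δ.x (j + d + 1) - Δ.x j)

/-- One step of the de Boor algorithm. -/
theorem KnotSeq.spline_succ (d : ℕ) (c : ℤ → E) (t : ℝ) :
    Δ.spline (d + 1) c t
      = Δ.spline d (fun j => (1 - Δ.ratio d j t) • c (j - 1) + Δ.ratio d j t • c j) t := by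
  unfold KnotSeq.spline
  have e : (-((d + 1 : ℕ) : ℤ)) = -(d : ℤ) - 1 := by push_cast; ring
  have hn := Δ.one_le
  have key := sum_Ico_shift (R := ℝ) (a := -(d : ℤ)) (b := n) (by omega)
    (fun j => Δ.ratio d j t * bspline Δ.x d j t)
    (fun j => (1 - Δ.ratio d j t) * bspline Δ.x d j t) c
    (by simp [Δ.bspline_eq_zero_left (d := d) (j := -(d : ℤ) - 1) t (by omega)])
    (by simp [Δ.bspline_eq_zero_right (d := d) (j := n) t le_rfl])
  rw [e]
  calc _ = ∑ j ∈ Finset.Ico (-(d : ℤ) - 1) n, ((Δ.ratio d j t * bspline Δ.x d j t) • c j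
        + ((1 - Δ.ratio d (j + 1) t) * bspline Δ.x d (j + 1) t) • c j) := by
        refine Finset.sum_congr rfl fun j _ => ?_
        rw [← add_smul, bspline_succ]
        congr 2
        -- The second quotient of the recursion is 1 minus the ratio only for a nonzero denominator,
        -- which is guaranteed where the B-spline does not vanish.
        rcases eq_or_ne (bspline Δ.x d (j + 1) t) 0 with h | h
        · simp [h]
        · have h3 := (Δ.bspline_support h).2.2
          have e1 : j + 1 + (d : ℤ) + 1 = j + d + 2 := by ring
          unfold KnotSeq.ratio
          rw [e1] at h3 ⊢
          have : Δ.x (j + d + 2) - Δ.x (j + 1) ≠ 0 := by linarith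
          congr 1
          field_simp
          ring
    _ = _ := key
    _ = _ := by
        refine Finset.sum_congr rfl fun j _ => ?_
        simp only [smul_add, smul_smul]
        rw [add_comm, mul_comm, mul_comm (Δ.ratio d j t)]

theorem KnotSeq.spline_congr {d : ℕ} {c c' : ℤ → E} {t : ℝ}
    (h : ∀ j ∈ Finset.Ico (-(d : ℤ)) n, bspline Δ.x d j t ≠ 0 → c j = c' j) :
    Δ.spline d c t = Δ.spline d c' t := by
  refine Finset.sum_congr rfl fun j hj => ?_
  rcases eq_or_ne (bspline Δ.x d j t) 0 with h' | h'
  · simp [h']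
  · rw [h j hj h']

theorem KnotSeq.spline_add (d : ℕ) (c c' : ℤ → E) (t : ℝ) :
    Δ.spline d (fun j => c j + c' j) t = Δ.spline d c t + Δ.spline d c' t := by
  simp [KnotSeq.spline, smul_add, Finset.sum_add_distrib]

theorem KnotSeq.spline_sub (d : ℕ) (c c' : ℤ → E) (t : ℝ) :
    Δ.spline d (fun j => c j - c' j) t = Δ.spline d c t - Δ.spline d c' t := by
  simp [KnotSeq.spline, smul_sub, Finset.sum_sub_distrib]

theorem KnotSeq.spline_smul {R : Type*} [Ring R] [Module R E] [SMulCommClass ℝ R E]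
    (d : ℕ) (r : R) (c : ℤ → E) (t : ℝ) :
    Δ.spline d (fun j => r • c j) t = r • Δ.spline d c t := by
  simp only [KnotSeq.spline, Finset.smul_sum]
  exact Finset.sum_congr rfl fun j _ => smul_comm _ _ _

theorem KnotSeq.ratio_mem {d : ℕ} {j : ℤ} {t : ℝ} (h : bspline Δ.x d j t ≠ 0) :
    Δ.ratio d j t ∈ Set.Icc (0 : ℝ) 1 := by
  obtain ⟨h1, h2, h3⟩ := Δ.bspline_support h
  exact ⟨div_nonneg (by linarith) (by linarith), (div_le_one (by linarith)).2 (by linarith)⟩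

/-- The index of the knot interval of a point of `[0, 1]`. -/
theorem KnotSeq.exists_interval {t : ℝ} (ht : t ∈ Set.Icc (0 : ℝ) 1) :
    ∃ i ∈ Finset.Ico (0 : ℤ) n, Δ.x i ≤ t ∧ Δ.x i < Δ.x (i + 1) ∧
      (t < Δ.x (i + 1) ∨ (t = Δ.x (i + 1) ∧ Δ.x (i + 1) = 1)) := by
  have hn := Δ.one_le
  rcases eq_or_lt_of_le ht.2 with h1 | h1
  · refine ⟨n - 1, by simp; omega, ?_, Δ.lt_of_lt (by omega) (by omega) (by omega), Or.inr ?_⟩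
    · rw [h1]; exact (Δ.mem_Icc _).2
    · rw [sub_add_cancel, Δ.eq_one n le_rfl]; exact ⟨h1, rfl⟩
  · have key : ∀ m : ℕ, t < Δ.x m → ∃ i : ℤ, 0 ≤ i ∧ i < m ∧ Δ.x i ≤ t ∧ t < Δ.x (i + 1) := by
      intro m
      induction m with
      | zero => intro h; simp [Δ.eq_zero 0 le_rfl] at h; linarith [ht.1]
      | succ m ih =>
        intro h
        rcases lt_or_ge t (Δ.x m) with h' | h'
        · obtain ⟨i, a, b, c⟩ := ih h'
          exact ⟨i, a, by push_cast; omega, c⟩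
        · exact ⟨m, by omega, by push_cast; omega, h', by exact_mod_cast h⟩
    obtain ⟨i, a, b, c, e⟩ := key n (by rw [Δ.eq_one n le_rfl]; exact h1)
    exact ⟨i, by simp; omega, c, by linarith, Or.inl e⟩

theorem KnotSeq.bspline_zero_eq {t : ℝ} {i : ℤ} (h1 : Δ.x i ≤ t) (h2 : Δ.x i < Δ.x (i + 1))
    (h3 : t < Δ.x (i + 1) ∨ (t = Δ.x (i + 1) ∧ Δ.x (i + 1) = 1)) (j : ℤ) :
    bspline Δ.x 0 j t = if j = i then 1 else 0 := by
  split_ifs with hj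
  · subst hj; simp [bspline, h1, h2, h3]
  · simp only [bspline]
    rw [if_neg]
    rintro ⟨a, b, c⟩
    rcases lt_or_gt_of_ne hj with h | h
    · have := Δ.monotone (show j + 1 ≤ i by omega)
      rcases c with c | c
      · linarith
      · have := (Δ.mem_Icc (i + 1)).2
        linarith [c.2]
    · have := Δ.monotone (show i + 1 ≤ j by omega)
      rcases h3 with c | c
      · linarith
      · have := (Δ.mem_Icc (j + 1)).2
        linarith [c.2]

theorem KnotSeq.spline_zero_eq (c : ℤ → E) {t : ℝ} {i : ℤ} (hi : i ∈ Finset.Ico (0 : ℤ) n)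
    (h1 : Δ.x i ≤ t) (h2 : Δ.x i < Δ.x (i + 1))
    (h3 : t < Δ.x (i + 1) ∨ (t = Δ.x (i + 1) ∧ Δ.x (i + 1) = 1)) :
    Δ.spline 0 c t = c i := by
  unfold KnotSeq.spline
  simp_rw [Δ.bspline_zero_eq h1 h2 h3]
  simp only [ite_smul, one_smul, zero_smul, Finset.sum_ite_eq']
  simp at hi
  simp [hi]

/-- The B-splines form a partition of unity. -/
theorem KnotSeq.spline_const (d : ℕ) (c : E) {t : ℝ} (ht : t ∈ Set.Icc (0 : ℝ) 1) :
    Δ.spline d (fun _ => c) t = c := by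
  induction d with
  | zero =>
    obtain ⟨i, hi, h1, h2, h3⟩ := Δ.exists_interval ht
    exact Δ.spline_zero_eq _ hi h1 h2 h3
  | succ d ih =>
    rw [Δ.spline_succ]
    simp only [← add_smul, sub_add_cancel, one_smul]
    exact ih

theorem KnotSeq.sum_bspline (d : ℕ) {t : ℝ} (ht : t ∈ Set.Icc (0 : ℝ) 1) :
    ∑ j ∈ Finset.Ico (-(d : ℤ)) n, bspline Δ.x d j t = 1 := by
  simpa [KnotSeq.spline] using Δ.spline_const d (1 : ℝ) ht

end Spline

/-! ### Greville nodes -/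

theorem KnotSeq.greville_mul (d : ℕ) (j : ℤ) :
    (d : ℝ) * Δ.greville d j = ∑ i ∈ Finset.range d, Δ.x (j + (i : ℤ) + 1) := by
  unfold KnotSeq.greville
  rcases eq_or_ne d 0 with rfl | h
  · simp
  · field_simp

theorem KnotSeq.greville_succ_right (d : ℕ) (j : ℤ) :
    ((d : ℝ) + 1) * Δ.greville (d + 1) j = d * Δ.greville d j + Δ.x (j + d + 1) := by
  have := Δ.greville_mul (d + 1) j
  push_cast at this
  rw [this, Δ.greville_mul, Finset.sum_range_succ]

theorem KnotSeq.greville_succ_left (d : ℕ) (j : ℤ) :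
    ((d : ℝ) + 1) * Δ.greville (d + 1) (j - 1) = d * Δ.greville d j + Δ.x j := by
  have := Δ.greville_mul (d + 1) (j - 1)
  push_cast at this
  rw [this, Δ.greville_mul, Finset.sum_range_succ']
  congr 1
  · refine Finset.sum_congr rfl fun i _ => ?_
    congr 1; push_cast; ring
  · simp

theorem KnotSeq.greville_sub {d : ℕ} (hd : 1 ≤ d) (j : ℤ) :
    Δ.greville d j - Δ.greville d (j - 1) = (Δ.x (j + d) - Δ.x j) / d := by
  obtain ⟨d, rfl⟩ : ∃ e, d = e + 1 := ⟨d - 1, by omega⟩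
  have h1 := Δ.greville_succ_right d j
  have h2 := Δ.greville_succ_left d j
  have : (0 : ℝ) < d + 1 := by positivity
  push_cast
  rw [eq_div_iff this.ne', ← add_assoc]
  linarith

theorem KnotSeq.greville_mono (d : ℕ) : Monotone (Δ.greville d) := by
  intro i j hij
  unfold KnotSeq.greville
  gcongr
  exact Δ.monotone (by omega)

theorem KnotSeq.greville_lt {d : ℕ} (hd : 1 ≤ d) {j : ℤ} (h1 : -(d : ℤ) < j) (h2 : j < n) :
    Δ.greville d (j - 1) < Δ.greville d j := by
  have := Δ.greville_sub hd j
  have h3 := Δ.lt_of_lt (i := j) (j := j + d) (by omega) h2 (by omega)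
  have : 0 < (Δ.x (j + d) - Δ.x j) / d := div_pos (by linarith) (by positivity)
  linarith

theorem KnotSeq.greville_left (d : ℕ) {j : ℤ} (h : j ≤ -(d : ℤ)) : Δ.greville d j = 0 := by
  unfold KnotSeq.greville
  rw [Finset.sum_eq_zero, zero_div]
  intro i hi
  have := Finset.mem_range.1 hi
  exact Δ.eq_zero _ (by omega)

theorem KnotSeq.greville_right {d : ℕ} (hd : 1 ≤ d) {j : ℤ} (h : (n : ℤ) - 1 ≤ j) :
    Δ.greville d j = 1 := by
  unfold KnotSeq.greville
  rw [Finset.sum_congr rfl (g := fun _ => (1 : ℝ))]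
  · have : (d : ℝ) ≠ 0 := by positivity
    simp [this]
  · intro i _
    exact Δ.eq_one _ (by omega)

/-- Both neighbouring nodes of degree d+1 contain the knots x_{j+1}, …, x_{j+d}; the ratio is
exactly the weight that combines the remaining knots x_j and x_{j+d+1} into t. -/
theorem KnotSeq.ratio_greville {d : ℕ} {j : ℤ} {t : ℝ} (h : bspline Δ.x d j t ≠ 0) :
    ((d : ℝ) + 1) * ((1 - Δ.ratio d j t) * Δ.greville (d + 1) (j - 1)
      + Δ.ratio d j t * Δ.greville (d + 1) j) = d * Δ.greville d j + t := by
  have h1 := Δ.greville_succ_left d j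
  have h2 := Δ.greville_succ_right d j
  have h3 := (Δ.bspline_support h).2.2
  have h4 : Δ.ratio d j t * (Δ.x (j + d + 1) - Δ.x j) = t - Δ.x j := by
    unfold KnotSeq.ratio; field_simp [(sub_pos.2 h3).ne']
  linear_combination (1 - Δ.ratio d j t) * h1 + Δ.ratio d j t * h2 + h4

/-- Linear precision. -/
theorem KnotSeq.spline_greville {d : ℕ} (hd : 1 ≤ d) {t : ℝ} (ht : t ∈ Set.Icc (0 : ℝ) 1) :
    Δ.spline d (Δ.greville d) t = t := by
  -- Multiplication by d lets the induction start in degree 0, where both sides vanish.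
  have key : ∀ d : ℕ, Δ.spline d (fun j => (d : ℝ) * Δ.greville d j) t = d * t := by
    intro d
    induction d with
    | zero => simp [KnotSeq.spline]
    | succ d ih =>
      rw [Δ.spline_succ]
      have : Δ.spline d (fun j => (1 - Δ.ratio d j t) • (((d + 1 : ℕ) : ℝ) * Δ.greville (d + 1) (j - 1))
          + Δ.ratio d j t • (((d + 1 : ℕ) : ℝ) * Δ.greville (d + 1) j)) t
          = Δ.spline d (fun j => (d : ℝ) * Δ.greville d j + t) t := by
        refine Δ.spline_congr fun j _ h => ?_
        have := Δ.ratio_greville h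
        simp only [smul_eq_mul]
        push_cast
        linear_combination this
      rw [this, Δ.spline_add, ih, Δ.spline_const d t ht]
      push_cast; ring
  have h := key d
  have h2 := Δ.spline_smul d (d : ℝ) (Δ.greville d) t
  simp only [smul_eq_mul] at h2
  rw [h2] at h
  exact mul_left_cancel₀ (by positivity) h

end SplineLower

namespace SplineLower

variable {n : ℕ} (Δ : KnotSeq n)

/-! ### Derivatives and integrals of splines -/

theorem hasDerivAt_bspline_zero (x : ℤ → ℝ) (j : ℤ) {t : ℝ} (ht : ∀ i, t ≠ x i) :
    HasDerivAt (bspline x 0 j) 0 t := by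
  have h : bspline x 0 j =ᶠ[nhds t] fun _ => bspline x 0 j t := by
    have e1 : ∀ᶠ s in nhds t, (s < x j ↔ t < x j) ∧ (x j < s ↔ x j < t) := by
      rcases lt_or_gt_of_ne (ht j) with h | h
      · filter_upwards [eventually_lt_nhds h] with s hs
        exact ⟨by tauto, by constructor <;> intro <;> linarith⟩
      · filter_upwards [eventually_gt_nhds h] with s hs
        exact ⟨by constructor <;> intro <;> linarith, by tauto⟩
    have e2 : ∀ᶠ s in nhds t, (s < x (j + 1) ↔ t < x (j + 1)) ∧ (s = x (j + 1) ↔ t = x (j + 1)) := by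
      rcases lt_or_gt_of_ne (ht (j + 1)) with h | h
      · filter_upwards [eventually_lt_nhds h] with s hs
        exact ⟨by tauto, by constructor <;> intro <;> linarith⟩
      · filter_upwards [eventually_gt_nhds h] with s hs
        exact ⟨by constructor <;> intro <;> linarith, by constructor <;> intro <;> linarith⟩
    filter_upwards [e1, e2] with s h1 h2
    have h3 : x j ≤ s ↔ x j ≤ t := by rw [← not_lt, ← not_lt, h1.1]
    simp only [bspline, h3, h2.1, h2.2]
  exact (hasDerivAt_const t _).congr_of_eventuallyEq h

/-- Differentiating the recursion and inserting the formula of lower degree leaves a surplus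
multiple of N_{j+1,d}. Its coefficient vanishes, since it is the difference of two pairs of ratios
that each add up to 1 (`key`). -/
theorem KnotSeq.hasDerivAt_bspline (d : ℕ) : ∀ (j : ℤ) {t : ℝ}, (∀ i, t ≠ Δ.x i) →
    HasDerivAt (bspline Δ.x (d + 1) j)
      (((d : ℝ) + 1) * (bspline Δ.x d j t / (Δ.x (j + d + 1) - Δ.x j)
        - bspline Δ.x d (j + 1) t / (Δ.x (j + d + 2) - Δ.x (j + 1)))) t := by
  induction d with
  | zero =>
    intro j t ht
    have h1 := hasDerivAt_bspline_zero Δ.x j ht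
    have h2 := hasDerivAt_bspline_zero Δ.x (j + 1) ht
    have e : bspline Δ.x (0 + 1) j = fun t => _ := funext fun t => bspline_succ Δ.x 0 j t
    rw [e]
    have h3 : HasDerivAt (fun t : ℝ => (t - Δ.x j) / (Δ.x (j + (0 : ℕ) + 1) - Δ.x j))
        (1 / (Δ.x (j + (0 : ℕ) + 1) - Δ.x j)) t := ((hasDerivAt_id t).sub_const _).div_const _
    have h4 : HasDerivAt (fun t : ℝ => (Δ.x (j + (0 : ℕ) + 2) - t) /
        (Δ.x (j + (0 : ℕ) + 2) - Δ.x (j + 1)))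
        (-1 / (Δ.x (j + (0 : ℕ) + 2) - Δ.x (j + 1))) t := ((hasDerivAt_id t).const_sub _).div_const _
    refine ((h3.mul h1).add (h4.mul h2)).congr_deriv ?_
    push_cast; ring
  | succ d ih =>
    intro j t ht
    have h1 := ih j ht
    have h2 := ih (j + 1) ht
    have e : bspline Δ.x (d + 1 + 1) j = fun t => _ := funext fun t => bspline_succ Δ.x (d + 1) j t
    rw [e]
    have h3 : HasDerivAt (fun t : ℝ => (t - Δ.x j) / (Δ.x (j + (d + 1 : ℕ) + 1) - Δ.x j))
        (1 / (Δ.x (j + (d + 1 : ℕ) + 1) - Δ.x j)) t := ((hasDerivAt_id t).sub_const _).div_const _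
    have h4 : HasDerivAt (fun t : ℝ => (Δ.x (j + (d + 1 : ℕ) + 2) - t) /
        (Δ.x (j + (d + 1 : ℕ) + 2) - Δ.x (j + 1)))
        (-1 / (Δ.x (j + (d + 1 : ℕ) + 2) - Δ.x (j + 1))) t :=
      ((hasDerivAt_id t).const_sub _).div_const _
    refine ((h3.mul h1).add (h4.mul h2)).congr_deriv ?_
    have s1 := bspline_succ Δ.x d j t
    have s2 := bspline_succ Δ.x d (j + 1) t
    have c1 : j + 1 + (d : ℤ) + 1 = j + d + 2 := by ring
    have c2 : j + 1 + (d : ℤ) + 2 = j + d + 3 := by ring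
    have c3 : j + ((d + 1 : ℕ) : ℤ) + 1 = j + d + 2 := by push_cast; ring
    have c4 : j + ((d + 1 : ℕ) : ℤ) + 2 = j + d + 3 := by push_cast; ring
    have c5 : j + 1 + 1 = j + 2 := by ring
    simp only [c1, c2, c3, c4, c5] at s1 s2 ⊢
    rw [s1, s2]
    have m1 : Δ.x j ≤ Δ.x (j + 1) := Δ.monotone (by omega)
    have m2 : Δ.x (j + d + 2) ≤ Δ.x (j + d + 3) := Δ.monotone (by omega)
    have m3 : Δ.x (j + 1) ≤ Δ.x (j + d + 2) := Δ.monotone (by omega)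
    have key : (((Δ.x (j + d + 2) - t) / (Δ.x (j + d + 2) - Δ.x j)
        - (t - Δ.x (j + 1)) / (Δ.x (j + d + 3) - Δ.x (j + 1)))
        - ((Δ.x (j + d + 3) - t) / (Δ.x (j + d + 3) - Δ.x (j + 1))
          - (t - Δ.x j) / (Δ.x (j + d + 2) - Δ.x j)))
        * (bspline Δ.x d (j + 1) t / (Δ.x (j + d + 2) - Δ.x (j + 1))) = 0 := by
      rcases m3.eq_or_lt with h | h
      · rw [h]; simp
      · have p1 : Δ.x (j + d + 2) - Δ.x j ≠ 0 := by linarith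
        have p2 : Δ.x (j + d + 3) - Δ.x (j + 1) ≠ 0 := by linarith
        rw [mul_eq_zero]; left
        field_simp
        ring
    push_cast
    linear_combination (-((d : ℝ) + 1)) * key

/-- The length `ξ_{j,d} - ξ_{j-1,d}`. -/
noncomputable def KnotSeq.width (d : ℕ) (j : ℤ) : ℝ := Δ.greville d j - Δ.greville d (j - 1)

theorem KnotSeq.width_eq {d : ℕ} (hd : 1 ≤ d) (j : ℤ) :
    Δ.width d j = (Δ.x (j + d) - Δ.x j) / d := Δ.greville_sub hd j

theorem KnotSeq.width_pos {d : ℕ} (hd : 1 ≤ d) {j : ℤ} (h1 : -(d : ℤ) < j) (h2 : j < n) :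
    0 < Δ.width d j := sub_pos.2 (Δ.greville_lt hd h1 h2)

section Slope

variable {E : Type*} [AddCommGroup E] [Module ℝ E]

/-- The slopes of the control polygon with vertices `(ξ_{j,d}, c_j)`. -/
noncomputable def KnotSeq.slope (d : ℕ) (c : ℤ → E) (j : ℤ) : E :=
  (Δ.width d j)⁻¹ • (c j - c (j - 1))

theorem KnotSeq.width_smul_slope {d : ℕ} (hd : 1 ≤ d) (c : ℤ → E) {j : ℤ} (h1 : -(d : ℤ) < j)
    (h2 : j < n) : Δ.width d j • Δ.slope d c j = c j - c (j - 1) := by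
  rw [KnotSeq.slope, smul_inv_smul₀ (Δ.width_pos hd h1 h2).ne']

/-- Summation by parts moves the differences from the B-splines to the coefficients; the factor
(d+1)/(x_{j+d+1} - x_j) is the reciprocal cell width, so slopes of the control polygon appear. -/
theorem KnotSeq.sum_deriv (d : ℕ) (c : ℤ → E) (t : ℝ) :
    ∑ j ∈ Finset.Ico (-((d + 1 : ℕ) : ℤ)) n,
      (((d : ℝ) + 1) * (bspline Δ.x d j t / (Δ.x (j + d + 1) - Δ.x j)
        - bspline Δ.x d (j + 1) t / (Δ.x (j + d + 2) - Δ.x (j + 1)))) • c j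
      = Δ.spline d (Δ.slope (d + 1) c) t := by
  have e : (-((d + 1 : ℕ) : ℤ)) = -(d : ℤ) - 1 := by push_cast; ring
  have hn := Δ.one_le
  have key := sum_Ico_shift (R := ℝ) (a := -(d : ℤ)) (b := n) (by omega)
    (fun j => ((d : ℝ) + 1) * (bspline Δ.x d j t / (Δ.x (j + d + 1) - Δ.x j)))
    (fun j => -(((d : ℝ) + 1) * (bspline Δ.x d j t / (Δ.x (j + d + 1) - Δ.x j)))) c
    (by simp [Δ.bspline_eq_zero_left (d := d) (j := -(d : ℤ) - 1) t (by omega)])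
    (by simp [Δ.bspline_eq_zero_right (d := d) (j := n) t le_rfl])
  rw [e]
  calc _ = _ := by
        refine Finset.sum_congr rfl fun j _ => ?_
        rw [← add_smul]
        congr 1
        have c1 : j + 1 + (d : ℤ) + 1 = j + d + 2 := by ring
        rw [c1]; ring
    _ = _ := key
    _ = _ := by
        refine Finset.sum_congr rfl fun j _ => ?_
        rw [KnotSeq.slope, Δ.width_eq (by omega), smul_smul, neg_smul, ← sub_eq_add_neg, ← smul_sub]
        congr 1
        push_cast
        rw [add_assoc]
        simp only [div_eq_mul_inv, mul_inv, inv_inv]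
        ring

end Slope

section Normed

variable {E : Type*} [NormedAddCommGroup E] [NormedSpace ℝ E]

theorem KnotSeq.hasDerivAt_spline (d : ℕ) (c : ℤ → E) {t : ℝ} (ht : ∀ i, t ≠ Δ.x i) :
    HasDerivAt (Δ.spline (d + 1) c) (Δ.spline d (Δ.slope (d + 1) c) t) t := by
  rw [← Δ.sum_deriv]
  have := HasDerivAt.fun_sum (u := Finset.Ico (-((d + 1 : ℕ) : ℤ)) n)
    (A := fun j t => bspline Δ.x (d + 1) j t • c j) fun j _ =>
    (Δ.hasDerivAt_bspline d j ht).smul_const (c j)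
  exact this

theorem KnotSeq.continuousOn_spline {d : ℕ} (hd : 1 ≤ d) (c : ℤ → E) :
    ContinuousOn (Δ.spline d c) (Set.Icc 0 1) :=
  continuousOn_finsetSum _ fun j _ => (bspline_continuousOn Δ hd j).smul continuousOn_const

theorem KnotSeq.intervalIntegrable_spline {d : ℕ} (hd : 1 ≤ d) (c : ℤ → E) {s t : ℝ}
    (hs : s ∈ Set.Icc (0 : ℝ) 1) (ht : t ∈ Set.Icc (0 : ℝ) 1) :
    IntervalIntegrable (Δ.spline d c) volume s t :=
  ((Δ.continuousOn_spline hd c).mono (Set.uIcc_subset_Icc hs ht)).intervalIntegrable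

/-- The fundamental theorem with the knots as countable exceptional set. This identity links the
integral operator of degree d with the Schoenberg operator of degree d+1. -/
theorem KnotSeq.integral_spline [CompleteSpace E] {d : ℕ} (hd : 1 ≤ d) (c : ℤ → E) {s t : ℝ}
    (hs : s ∈ Set.Icc (0 : ℝ) 1) (ht : t ∈ Set.Icc (0 : ℝ) 1) :
    ∫ u in s..t, Δ.spline d (Δ.slope (d + 1) c) u = Δ.spline (d + 1) c t - Δ.spline (d + 1) c s := by
  refine integral_eq_of_hasDerivAt_off_countable _ _ (s := Set.range Δ.x)
    (Set.countable_range _) ((Δ.continuousOn_spline (by omega) c).mono (Set.uIcc_subset_Icc hs ht))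
    (fun u hu => Δ.hasDerivAt_spline d c fun i hi => hu.2 ⟨i, hi.symm⟩)
    (Δ.intervalIntegrable_spline hd _ hs ht)

end Normed

/-! ### Shape preservation -/

theorem KnotSeq.spline_mono {d : ℕ} {c c' : ℤ → ℝ} {t : ℝ}
    (h : ∀ j ∈ Finset.Ico (-(d : ℤ)) n, bspline Δ.x d j t ≠ 0 → c j ≤ c' j) :
    Δ.spline d c t ≤ Δ.spline d c' t := by
  refine Finset.sum_le_sum fun j hj => ?_
  rcases eq_or_ne (bspline Δ.x d j t) 0 with h' | h'
  · simp [h']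
  · exact mul_le_mul_of_nonneg_left (h j hj h') (Δ.bspline_nonneg d j t)

theorem KnotSeq.norm_spline_le {E : Type*} [NormedAddCommGroup E] [NormedSpace ℝ E] (d : ℕ)
    (c : ℤ → E) (t : ℝ) : ‖Δ.spline d c t‖ ≤ Δ.spline d (fun j => ‖c j‖) t := by
  refine (norm_sum_le _ _).trans (Finset.sum_le_sum fun j _ => ?_)
  rw [norm_smul, Real.norm_of_nonneg (Δ.bspline_nonneg d j t), smul_eq_mul]

/-- The coefficients after one de Boor step are convex combinations of neighbours. They are
therefore again monotone in the index, and they increase with t. -/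
theorem KnotSeq.monotoneOn_spline_of_monotone (d : ℕ) : ∀ {c : ℤ → ℝ}, Monotone c →
    MonotoneOn (Δ.spline d c) (Set.Icc 0 1) := by
  induction d with
  | zero =>
    intro c hc s hs t ht hst
    obtain ⟨i, hi, h1, h2, h3⟩ := Δ.exists_interval hs
    obtain ⟨j, hj, g1, g2, g3⟩ := Δ.exists_interval ht
    rw [Δ.spline_zero_eq c hi h1 h2 h3, Δ.spline_zero_eq c hj g1 g2 g3]
    apply hc
    by_contra hij
    have := Δ.monotone (show j + 1 ≤ i by omega)
    rcases g3 with g3 | g3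
    · linarith
    · have := (Δ.mem_Icc (i + 1)).2
      linarith [g3.2]
  | succ d ih =>
    intro c hc s hs t ht hst
    rw [Δ.spline_succ, Δ.spline_succ]
    -- The ratio leaves [0, 1] only where its B-spline vanishes, so clamping does not change the
    -- spline and makes every combination convex.
    set r : ℤ → ℝ → ℝ := fun j u => max 0 (min 1 (Δ.ratio d j u)) with hr
    have r0 : ∀ j u, 0 ≤ r j u := fun j u => le_max_left _ _
    have r1 : ∀ j u, r j u ≤ 1 := fun j u => max_le zero_le_one (min_le_left _ _)
    have rr : ∀ {j u}, bspline Δ.x d j u ≠ 0 → r j u = Δ.ratio d j u := by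
      intro j u h
      have := Δ.ratio_mem h
      simp [hr, this.1, this.2]
    have rmono : ∀ j, r j s ≤ r j t := by
      intro j
      refine max_le_max le_rfl (min_le_min le_rfl ?_)
      unfold KnotSeq.ratio
      exact div_le_div_of_nonneg_right (by linarith) (sub_nonneg.2 (Δ.monotone (by omega)))
    have e : ∀ u, Δ.spline d (fun j => (1 - Δ.ratio d j u) • c (j - 1) + Δ.ratio d j u • c j) u
        = Δ.spline d (fun j => (1 - r j u) • c (j - 1) + r j u • c j) u := fun u =>
      Δ.spline_congr fun j _ h => by rw [rr h]
    rw [e s, e t]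
    calc _ ≤ Δ.spline d (fun j => (1 - r j t) • c (j - 1) + r j t • c j) s := by
          refine Δ.spline_mono fun j _ _ => ?_
          simp only [smul_eq_mul]
          nlinarith [rmono j, hc (show j - 1 ≤ j by omega)]
      _ ≤ _ := by
          refine ih ?_ hs ht hst
          refine monotone_int_of_le_succ fun j => ?_
          simp only [smul_eq_mul, add_sub_cancel_right]
          nlinarith [r0 j t, r1 j t, r0 (j + 1) t, r1 (j + 1) t, hc (show j - 1 ≤ j by omega),
            hc (show j ≤ j + 1 by omega)]

theorem KnotSeq.monotoneOn_spline {d : ℕ} {c : ℤ → ℝ}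
    (hc : MonotoneOn c (Set.Ico (-(d : ℤ)) n)) : MonotoneOn (Δ.spline d c) (Set.Icc 0 1) := by
  have hn := Δ.one_le
  -- Coefficients outside the index range do not enter and may be continued as constants.
  have h := Δ.monotoneOn_spline_of_monotone d (c := fun j => c (max (-(d : ℤ)) (min j (n - 1))))
    (fun i j hij => hc ⟨by omega, by omega⟩ ⟨by omega, by omega⟩ (by omega))
  refine h.congr fun t _ => Δ.spline_congr fun j hj _ => ?_
  simp at hj
  congr 1
  omega

theorem convexOn_of_integral_monotone {f g : ℝ → ℝ} (hg : MonotoneOn g (Set.Icc 0 1))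
    (hf : ∀ s ∈ Set.Icc (0 : ℝ) 1, ∀ t ∈ Set.Icc (0 : ℝ) 1, ∫ u in s..t, g u = f t - f s)
    (hi : ∀ s ∈ Set.Icc (0 : ℝ) 1, ∀ t ∈ Set.Icc (0 : ℝ) 1, IntervalIntegrable g volume s t) :
    ConvexOn ℝ (Set.Icc 0 1) f := by
  refine convexOn_of_slope_mono_adjacent (convex_Icc 0 1) fun {x y z} hx hz hxy hyz => ?_
  have hy : y ∈ Set.Icc (0 : ℝ) 1 := ⟨hx.1.trans hxy.le, hyz.le.trans hz.2⟩
  rw [← hf x hx y hy, ← hf y hy z hz]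
  have h1 : ∫ u in x..y, g u ≤ ∫ _ in x..y, g y :=
    intervalIntegral.integral_mono_on hxy.le (hi x hx y hy) intervalIntegrable_const
      fun u hu => hg ⟨hx.1.trans hu.1, hu.2.trans hy.2⟩ hy hu.2
  have h2 : ∫ _ in y..z, g y ≤ ∫ u in y..z, g u :=
    intervalIntegral.integral_mono_on hyz.le intervalIntegrable_const (hi y hy z hz)
      fun u hu => hg hy ⟨hy.1.trans hu.1, hu.2.trans hz.2⟩ hu.1
  rw [intervalIntegral.integral_const, smul_eq_mul] at h1 h2
  calc _ ≤ g y := by rw [div_le_iff₀ (by linarith)]; linarith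
    _ ≤ _ := by rw [le_div_iff₀ (by linarith)]; linarith

theorem KnotSeq.convexOn_spline {d : ℕ} (hd : 1 ≤ d) {c : ℤ → ℝ}
    (hc : MonotoneOn (Δ.slope (d + 1) c) (Set.Ico (-(d : ℤ)) n)) :
    ConvexOn ℝ (Set.Icc 0 1) (Δ.spline (d + 1) c) :=
  convexOn_of_integral_monotone (Δ.monotoneOn_spline hc)
    (fun _ hs _ ht => Δ.integral_spline hd c hs ht)
    (fun _ hs _ ht => Δ.intervalIntegrable_spline hd _ hs ht)

theorem KnotSeq.monotoneOn_slope {d : ℕ} {f : ℝ → ℝ}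
    (hf : ConvexOn ℝ (Set.Icc 0 1) f) :
    MonotoneOn (Δ.slope (d + 1) fun j => f (Δ.greville (d + 1) j)) (Set.Ico (-(d : ℤ)) n) := by
  have step : ∀ i, -(d : ℤ) ≤ i → i + 1 < n →
      Δ.slope (d + 1) (fun j => f (Δ.greville (d + 1) j)) i
        ≤ Δ.slope (d + 1) (fun j => f (Δ.greville (d + 1) j)) (i + 1) := by
    intro i h1 h2
    have a1 := Δ.greville_lt (d := d + 1) (j := i) (by omega) (by push_cast; omega) (by omega)
    have a2 := Δ.greville_lt (d := d + 1) (j := i + 1) (by omega) (by push_cast; omega) (by omega)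
    simp only [KnotSeq.slope, KnotSeq.width, smul_eq_mul, add_sub_cancel_right] at *
    have := hf.slope_mono_adjacent (Δ.greville_mem (d + 1) (i - 1)) (Δ.greville_mem (d + 1) (i + 1))
      a1 a2
    simpa [div_eq_inv_mul] using this
  have key : ∀ (m : ℕ) (i : ℤ), -(d : ℤ) ≤ i → i + m < n →
      Δ.slope (d + 1) (fun j => f (Δ.greville (d + 1) j)) i
        ≤ Δ.slope (d + 1) (fun j => f (Δ.greville (d + 1) j)) (i + m) := by
    intro m
    induction m with
    | zero => intro i _ _; simp
    | succ m ih =>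
      intro i h1 h2
      push_cast at h2
      refine (ih i h1 (by omega)).trans ?_
      have := step (i + m) (by omega) (by omega)
      push_cast
      rwa [← add_assoc]
  intro i hi j hj hij
  have := key (j - i).toNat i hi.1 (by have := hj.2; omega)
  rwa [show i + ((j - i).toNat : ℤ) = j by omega] at this

/-- The Schoenberg operator on functions. -/
noncomputable def KnotSeq.schoen (d : ℕ) (f : ℝ → ℝ) (t : ℝ) : ℝ :=
  Δ.spline d (fun j => f (Δ.greville d j)) t

/-- The control polygon is inscribed in the graph of f, so its slopes increase; they are the
coefficients of the derivative, which therefore increases too. Degree at least 2 makes that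
derivative a continuous spline. -/
theorem KnotSeq.convexOn_schoen {d : ℕ} (hd : 2 ≤ d) {f : ℝ → ℝ}
    (hf : ConvexOn ℝ (Set.Icc 0 1) f) : ConvexOn ℝ (Set.Icc 0 1) (Δ.schoen d f) := by
  obtain ⟨d, rfl⟩ : ∃ e, d = e + 1 := ⟨d - 1, by omega⟩
  exact Δ.convexOn_spline (by omega) (Δ.monotoneOn_slope hf)

/-- Jensen's inequality for the Schoenberg operator. -/
theorem KnotSeq.le_schoen {d : ℕ} (hd : 1 ≤ d) {f : ℝ → ℝ}
    (hf : ConvexOn ℝ (Set.Icc 0 1) f) {t : ℝ} (ht : t ∈ Set.Icc (0 : ℝ) 1) :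
    f t ≤ Δ.schoen d f t := by
  have h := hf.map_sum_le (t := Finset.Ico (-(d : ℤ)) n) (w := fun j => bspline Δ.x d j t)
    (p := fun j => Δ.greville d j) (fun j _ => Δ.bspline_nonneg d j t) (Δ.sum_bspline d ht)
    (fun j _ => Δ.greville_mem d j)
  have h2 := Δ.spline_greville hd ht
  unfold KnotSeq.spline at h2
  rwa [h2] at h

/-! ### Values at the end points -/

theorem KnotSeq.greville_pos {d : ℕ} (hd : 1 ≤ d) {j : ℤ} (h1 : -(d : ℤ) < j) (h2 : j < n) :
    0 < Δ.greville d j :=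
  (Δ.greville_mem d (j - 1)).1.trans_lt (Δ.greville_lt hd h1 h2)

theorem KnotSeq.greville_lt_one {d : ℕ} (hd : 1 ≤ d) {j : ℤ} (h1 : -(d : ℤ) ≤ j) (h2 : j < n - 1) :
    Δ.greville d j < 1 := by
  have := Δ.greville_lt hd (j := j + 1) (by omega) (by omega)
  rw [add_sub_cancel_right] at this
  exact this.trans_le (Δ.greville_mem d _).2

variable {E : Type*} [AddCommGroup E] [Module ℝ E]

/-- Linear precision at 0 says that a sum of nonnegative terms N_j(0) ξ_j vanishes, so N_j(0) = 0
for every node ξ_j > 0. Only the first index is left. -/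
theorem KnotSeq.spline_at_zero {d : ℕ} (hd : 1 ≤ d) (c : ℤ → E) :
    Δ.spline d c 0 = c (-(d : ℤ)) := by
  have h0 : (0 : ℝ) ∈ Set.Icc (0 : ℝ) 1 := by simp
  have h := Δ.spline_greville hd h0
  unfold KnotSeq.spline at h
  rw [Finset.sum_eq_zero_iff_of_nonneg
    (fun j _ => smul_nonneg (Δ.bspline_nonneg d j 0) (Δ.greville_mem d j).1)] at h
  rw [← Δ.spline_const d (c (-(d : ℤ))) h0]
  refine Δ.spline_congr fun j hj hne => ?_
  have h3 := h j hj
  simp only [smul_eq_mul, mul_eq_zero, hne, false_or] at h3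
  simp only [Finset.mem_Ico] at hj
  by_contra hc
  have : j ≠ -(d : ℤ) := fun e => hc (by rw [e])
  exact (Δ.greville_pos hd (by omega) hj.2).ne' h3

theorem KnotSeq.spline_at_one {d : ℕ} (hd : 1 ≤ d) (c : ℤ → E) :
    Δ.spline d c 1 = c (n - 1) := by
  have h0 : (1 : ℝ) ∈ Set.Icc (0 : ℝ) 1 := by simp
  have h := Δ.spline_greville hd h0
  have h' : Δ.spline d (fun j => 1 - Δ.greville d j) 1 = 0 := by
    rw [Δ.spline_sub, h, Δ.spline_const d _ h0, sub_self]
  unfold KnotSeq.spline at h'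
  rw [Finset.sum_eq_zero_iff_of_nonneg
    (fun j _ => smul_nonneg (Δ.bspline_nonneg d j 1) (sub_nonneg.2 (Δ.greville_mem d j).2))] at h'
  rw [← Δ.spline_const d (c (n - 1)) h0]
  refine Δ.spline_congr fun j hj hne => ?_
  have h3 := h' j hj
  simp only [smul_eq_mul, mul_eq_zero, hne, false_or] at h3
  simp only [Finset.mem_Ico] at hj
  by_contra hc
  have : j ≠ n - 1 := fun e => hc (by rw [e])
  have := Δ.greville_lt_one hd hj.1 (by omega)
  linarith

end SplineLower

namespace SplineLower

variable {n : ℕ} (Δ : KnotSeq n)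

/-! ### Lower bounds for the Schoenberg operator at its own nodes -/

theorem KnotSeq.le_greville {d : ℕ} (hd : 1 ≤ d) (j : ℤ) : Δ.x (j + 1) ≤ Δ.greville d j := by
  unfold KnotSeq.greville
  have hd' : (0 : ℝ) < d := by positivity
  rw [le_div_iff₀ hd']
  calc _ = ∑ i ∈ Finset.range d, Δ.x (j + 1) := by simp [mul_comm]
    _ ≤ _ := Finset.sum_le_sum fun i _ => Δ.monotone (by omega)

theorem KnotSeq.greville_le {d : ℕ} (hd : 1 ≤ d) (j : ℤ) : Δ.greville d j ≤ Δ.x (j + d) := by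
  unfold KnotSeq.greville
  have hd' : (0 : ℝ) < d := by positivity
  rw [div_le_iff₀ hd']
  calc _ ≤ ∑ i ∈ Finset.range d, Δ.x (j + d) := Finset.sum_le_sum fun i hi =>
        Δ.monotone (by have := Finset.mem_range.1 hi; omega)
    _ = _ := by simp [mul_comm]

/-- A lower bound for a spline at a point, from an affine minorant of its control points after
one de Boor step. -/
theorem KnotSeq.le_spline_succ {d : ℕ} (hd : 1 ≤ d) (c : ℤ → ℝ) {t : ℝ}
    (ht : t ∈ Set.Icc (0 : ℝ) 1) (u v : ℝ)
    (h : ∀ j ∈ Finset.Ico (-(d : ℤ)) n, ∀ r ∈ Set.Icc (0 : ℝ) 1,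
      ((d : ℝ) + 1) * ((1 - r) * Δ.greville (d + 1) (j - 1) + r * Δ.greville (d + 1) j)
        = d * Δ.greville d j + t →
      u + v * ((d * Δ.greville d j + t) / (d + 1) - t) ≤ (1 - r) * c (j - 1) + r * c j) :
    u ≤ Δ.spline (d + 1) c t := by
  rw [Δ.spline_succ]
  -- The points (d ξ_{j,d} + t)/(d+1) average to t by linear precision, so the affine minorant
  -- contributes exactly u.
  have e : Δ.spline d (fun j => (u - v * t + v * t / (d + 1)) + (v * d / (d + 1)) • Δ.greville d j) t
      = u := by
    rw [Δ.spline_add, Δ.spline_const d _ ht, Δ.spline_smul, Δ.spline_greville hd ht, smul_eq_mul]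
    field_simp
    ring
  rw [← e]
  refine Δ.spline_mono fun j hj hne => ?_
  have := h j hj _ (Δ.ratio_mem hne) (Δ.ratio_greville hne)
  simp only [smul_eq_mul]
  refine le_trans (le_of_eq ?_) this
  field_simp
  ring

section Node

variable {d : ℕ} (hd : 1 ≤ d) {i : ℤ} (h1 : -(d : ℤ) ≤ i) (h2 : i < n - 1)
include hd h1 h2

/-- The node is the mean of the d+1 knots x_{i+1}, …, x_{i+d+1}. As both ends of this window are
among them, its distance from either end is at least the (d+1)-th part of the window. -/
theorem KnotSeq.node_bounds :
    Δ.x (i + 1) < Δ.x (i + d + 1) ∧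
    Δ.x (i + d + 1) - Δ.x (i + 1) ≤ (d + 1) * (Δ.greville (d + 1) i - Δ.x (i + 1)) ∧
    Δ.x (i + d + 1) - Δ.x (i + 1) ≤ (d + 1) * (Δ.x (i + d + 1) - Δ.greville (d + 1) i) := by
  refine ⟨Δ.lt_of_lt (by omega) (by omega) (by omega), ?_, ?_⟩
  · have := Δ.greville_succ_right d i
    have := Δ.le_greville hd i
    have : (d : ℝ) * Δ.x (i + 1) ≤ d * Δ.greville d i := by gcongr
    linarith
  · have h3 := Δ.greville_succ_left d (i + 1)
    have := Δ.greville_le hd (i + 1)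
    have : (d : ℝ) * Δ.greville d (i + 1) ≤ d * Δ.x (i + 1 + d) := by gcongr
    rw [show i + 1 + (d : ℤ) = i + d + 1 by ring] at this
    rw [add_sub_cancel_right] at h3
    linarith

/-- `∑_j (ξ_j - ξ_i)₊ N_j(ξ_i) ≥ α β / ((d + 1) (α + β))`, where `α` and `β` are the distances of
`ξ_i` from the ends of its window of knots. -/
theorem KnotSeq.le_spline_posPart :
    (Δ.greville (d + 1) i - Δ.x (i + 1)) * (Δ.x (i + d + 1) - Δ.greville (d + 1) i)
        / ((d + 1) * (Δ.x (i + d + 1) - Δ.x (i + 1)))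
      ≤ Δ.spline (d + 1) (fun j => max (Δ.greville (d + 1) j - Δ.greville (d + 1) i) 0)
          (Δ.greville (d + 1) i) := by
  obtain ⟨hl, ha, hb⟩ := Δ.node_bounds hd h1 h2
  set ξ := Δ.greville (d + 1) i with hξ
  set α := ξ - Δ.x (i + 1) with hα
  set β := Δ.x (i + d + 1) - ξ with hβ
  have hd0 : (0 : ℝ) < d + 1 := by positivity
  have hl' : 0 < Δ.x (i + d + 1) - Δ.x (i + 1) := sub_pos.2 hl
  have hsum : Δ.x (i + d + 1) - Δ.x (i + 1) = α + β := by rw [hα, hβ]; ring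
  rw [hsum] at ha hb hl' ⊢
  have hα0 : 0 < α := by by_contra h; nlinarith
  have hβ0 : 0 < β := by by_contra h; nlinarith
  have g1 := Δ.greville_succ_right d i
  have g2 := Δ.greville_succ_left d (i + 1)
  rw [add_sub_cancel_right] at g2
  -- After the de Boor step, y = (d+1)(η - ξ) satisfies y ≤ -β for j ≤ i and y ≥ α for j > i.
  -- Outside this gap the positive part of y lies above the line through (-β, 0) and (α, α), which
  -- explains the slope.
  refine Δ.le_spline_succ hd _ (Δ.greville_mem _ _) _ (α / (α + β)) fun j _ r hr e => ?_
  set η := ((d : ℝ) * Δ.greville d j + ξ) / (d + 1) with hη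
  have eη : ((d : ℝ) + 1) * η = d * Δ.greville d j + ξ := by rw [hη]; field_simp
  have eη' : η = (1 - r) * Δ.greville (d + 1) (j - 1) + r * Δ.greville (d + 1) j :=
    mul_left_cancel₀ hd0.ne' (by rw [e, eη])
  have hu : α * β / ((d + 1) * (α + β)) + α / (α + β) * (η - ξ)
      = α * (β + (d + 1) * (η - ξ)) / ((d + 1) * (α + β)) := by field_simp
  rw [hu]
  rcases le_or_gt j i with hj | hj
  · have : (d : ℝ) * Δ.greville d j ≤ d * Δ.greville d i := by
      gcongr; exact Δ.greville_mono d hj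
    refine le_trans (div_nonpos_of_nonpos_of_nonneg ?_ (by positivity))
      (add_nonneg (mul_nonneg (by linarith [hr.2]) (le_max_right _ _))
        (mul_nonneg hr.1 (le_max_right _ _)))
    refine mul_nonpos_of_nonneg_of_nonpos hα0.le ?_
    linarith
  · have : (d : ℝ) * Δ.greville d (i + 1) ≤ d * Δ.greville d j := by
      gcongr; exact Δ.greville_mono d (by omega)
    have m1 : Δ.greville (d + 1) (j - 1) - ξ ≤ max (Δ.greville (d + 1) (j - 1) - ξ) 0 :=
      le_max_left _ _
    have m2 : Δ.greville (d + 1) j - ξ ≤ max (Δ.greville (d + 1) j - ξ) 0 := le_max_left _ _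
    have m3 : η - ξ ≤ (1 - r) * max (Δ.greville (d + 1) (j - 1) - ξ) 0
        + r * max (Δ.greville (d + 1) j - ξ) 0 := by
      have := mul_le_mul_of_nonneg_left m1 (show 0 ≤ 1 - r by linarith [hr.2])
      have := mul_le_mul_of_nonneg_left m2 hr.1
      rw [eη']; linarith
    refine le_trans ?_ m3
    rw [div_le_iff₀ (by positivity)]
    have : α ≤ (d + 1) * (η - ξ) := by linarith
    nlinarith

/-- A lower bound for the variance `∑_j (ξ_j - ξ_i)² N_j(ξ_i)`. -/
theorem KnotSeq.le_spline_sq :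
    (Δ.greville (d + 1) i - Δ.x (i + 1)) * (Δ.x (i + d + 1) - Δ.greville (d + 1) i)
        / ((d : ℝ) + 1) ^ 2
      ≤ Δ.spline (d + 1) (fun j => (Δ.greville (d + 1) j - Δ.greville (d + 1) i) ^ 2)
          (Δ.greville (d + 1) i) := by
  set ξ := Δ.greville (d + 1) i with hξ
  set α := ξ - Δ.x (i + 1) with hα
  set β := Δ.x (i + d + 1) - ξ with hβ
  have hd0 : (0 : ℝ) < d + 1 := by positivity
  have g1 := Δ.greville_succ_right d i
  have g2 := Δ.greville_succ_left d (i + 1)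
  rw [add_sub_cancel_right] at g2
  obtain ⟨hl, ha, hb⟩ := Δ.node_bounds hd h1 h2
  refine Δ.le_spline_succ hd _ (Δ.greville_mem _ _) _ ((α - β) / (d + 1)) fun j _ r hr e => ?_
  set η := ((d : ℝ) * Δ.greville d j + ξ) / (d + 1) with hη
  have eη : ((d : ℝ) + 1) * η = d * Δ.greville d j + ξ := by rw [hη]; field_simp
  have eη' : η = (1 - r) * Δ.greville (d + 1) (j - 1) + r * Δ.greville (d + 1) j :=
    mul_left_cancel₀ hd0.ne' (by rw [e, eη])
  have m3 : (η - ξ) ^ 2 ≤ (1 - r) * (Δ.greville (d + 1) (j - 1) - ξ) ^ 2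
      + r * (Δ.greville (d + 1) j - ξ) ^ 2 := by
    rw [eη']
    nlinarith [mul_nonneg (mul_nonneg hr.1 (sub_nonneg.2 hr.2))
      (sq_nonneg (Δ.greville (d + 1) (j - 1) - Δ.greville (d + 1) j))]
  refine le_trans ?_ m3
  -- The same gap: for y = (d+1)(η - ξ) outside (-β, α), the parabola y² is above its chord (α - β)
  -- y + αβ.
  have key : 0 ≤ ((d + 1) * (η - ξ) + β) * ((d + 1) * (η - ξ) - α) := by
    rcases le_or_gt j i with hj | hj
    · have : (d : ℝ) * Δ.greville d j ≤ d * Δ.greville d i := by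
        gcongr; exact Δ.greville_mono d hj
      apply mul_nonneg_of_nonpos_of_nonpos
      · linarith
      · have : 0 < α := by by_contra h; nlinarith
        have : 0 < β := by by_contra h; nlinarith
        linarith
    · have : (d : ℝ) * Δ.greville d (i + 1) ≤ d * Δ.greville d j := by
        gcongr; exact Δ.greville_mono d (by omega)
      have : 0 < α := by by_contra h; nlinarith
      have : 0 < β := by by_contra h; nlinarith
      apply mul_nonneg <;> linarith
  have e3 : α * β / ((d : ℝ) + 1) ^ 2 + (α - β) / (d + 1) * (η - ξ)
      = (η - ξ) ^ 2 - ((d + 1) * (η - ξ) + β) * ((d + 1) * (η - ξ) - α) / ((d : ℝ) + 1) ^ 2 := by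
    field_simp
    ring
  rw [e3]
  have := div_nonneg key (sq_nonneg ((d : ℝ) + 1))
  linarith

/-- The minorant with slopes sL and sR on the two sides of the i-th vertex is an affine function
plus (sR - sL) times a positive part. The affine part is reproduced and the other is estimated by
`KnotSeq.le_spline_posPart`. -/
theorem KnotSeq.add_kink_le_spline (c : ℤ → ℝ) {sL sR : ℝ} (hs : sL ≤ sR)
    (hR : ∀ j ∈ Finset.Ico (-((d + 1 : ℕ) : ℤ)) n, i < j →
      c i + sR * (Δ.greville (d + 1) j - Δ.greville (d + 1) i) ≤ c j)
    (hL : ∀ j ∈ Finset.Ico (-((d + 1 : ℕ) : ℤ)) n, j < i →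
      c i + sL * (Δ.greville (d + 1) j - Δ.greville (d + 1) i) ≤ c j) :
    c i + (sR - sL) * ((Δ.greville (d + 1) i - Δ.x (i + 1))
        * (Δ.x (i + d + 1) - Δ.greville (d + 1) i)
        / ((d + 1) * (Δ.x (i + d + 1) - Δ.x (i + 1))))
      ≤ Δ.spline (d + 1) c (Δ.greville (d + 1) i) := by
  set ξ := Δ.greville (d + 1) i with hξ
  have hp := mul_le_mul_of_nonneg_left (Δ.le_spline_posPart hd h1 h2) (sub_nonneg.2 hs)
  have e : Δ.spline (d + 1) (fun j => ((c i - sL * ξ) + sL • Δ.greville (d + 1) j)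
      + (sR - sL) • max (Δ.greville (d + 1) j - ξ) 0) ξ
      = c i + (sR - sL) * Δ.spline (d + 1) (fun j => max (Δ.greville (d + 1) j - ξ) 0) ξ := by
    rw [Δ.spline_add, Δ.spline_add, Δ.spline_const _ _ (Δ.greville_mem _ _), Δ.spline_smul,
      Δ.spline_smul, Δ.spline_greville (by omega) (Δ.greville_mem _ _), smul_eq_mul, smul_eq_mul]
    ring
  refine le_trans (by linarith) (e.symm.le.trans (Δ.spline_mono fun j hj _ => ?_))
  simp only [smul_eq_mul]
  rcases lt_trichotomy j i with h | h | h
  · have := hL j hj h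
    have := Δ.greville_mono (d + 1) h.le
    rw [max_eq_right (by linarith)]
    linarith
  · rw [h, ← hξ, sub_self, max_self]; linarith
  · have := hR j hj h
    have := Δ.greville_mono (d + 1) h.le
    rw [max_eq_left (by linarith)]
    linarith

end Node

theorem mul_div_sq_le_quarter {α β l : ℝ} (hl : 0 < l) (h : α + β = l) : α * β / l ^ 2 ≤ 1 / 4 := by
  rw [div_le_iff₀ (by positivity), ← h]
  nlinarith [sq_nonneg (α - β)]

/-- The numerical core of `KnotSeq.le_schoen_node_right` and its mirror image: `S` stands for the
value of the Schoenberg operator at a node, `y` for the value of the function there and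
`T = y + s α / d` for its value at a neighbouring node of lower degree. -/
theorem kink_bound {d : ℕ} (hd : 1 ≤ d) {α β y s S : ℝ} (hα : 0 < α) (hβ : 0 < β) (hy : 0 ≤ y)
    (hb : α + β ≤ (d + 1) * β) (hS : y ≤ S)
    (h : 0 ≤ s → ((d : ℝ) + 1) * y / (α + β) ≤ s →
      y + (s - ((d : ℝ) + 1) * y / (α + β)) * (α * β / ((d + 1) * (α + β))) ≤ S) :
    (d : ℝ) / (d + 1) ^ 2 * (y + s * (α / d)) ≤ S := by
  have hd0 : (1 : ℝ) ≤ d := by exact_mod_cast hd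
  have hp : (d : ℝ) / (d + 1) ^ 2 ≤ 1 / 4 := by
    rw [div_le_iff₀ (by positivity)]; nlinarith [sq_nonneg ((d : ℝ) - 1)]
  have hp0 : 0 ≤ (d : ℝ) / (d + 1) ^ 2 := by positivity
  have e1 : (d : ℝ) / (d + 1) ^ 2 * (y + s * (α / d)) = d / (d + 1) ^ 2 * y + s * α / (d + 1) ^ 2 := by
    field_simp
  rw [e1]
  -- For s negative or below the slope (d+1)y/(α+β), Jensen's bound y ≤ S is already enough; only
  -- steeper s need the gain from the kink.
  rcases lt_or_ge s 0 with hs | hs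
  · have : s * α / (d + 1) ^ 2 ≤ 0 := div_nonpos_of_nonpos_of_nonneg (by nlinarith) (by positivity)
    nlinarith
  rcases lt_or_ge s (((d : ℝ) + 1) * y / (α + β)) with hs' | hs'
  · have h3 : s * α ≤ ((d : ℝ) + 1) * y := by
      rw [lt_div_iff₀ (by linarith)] at hs'
      nlinarith
    have h4 : s * α / (d + 1) ^ 2 ≤ y * (1 / 2) := by
      rw [div_le_iff₀ (by positivity)]
      nlinarith [mul_nonneg hy (show (0 : ℝ) ≤ (d + 1) * (d - 1) by nlinarith)]
    nlinarith
  · refine le_trans ?_ (h hs hs')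
    have h5 := mul_div_sq_le_quarter (α := α) (β := β) (l := α + β) (by linarith) rfl
    have e2 : y + (s - ((d : ℝ) + 1) * y / (α + β)) * (α * β / ((d + 1) * (α + β)))
        = y * (1 - α * β / (α + β) ^ 2) + s * α * (β / ((d + 1) * (α + β))) := by
      field_simp
      ring
    rw [e2]
    have h6 : 1 / ((d : ℝ) + 1) ^ 2 ≤ β / ((d + 1) * (α + β)) := by
      rw [div_le_div_iff₀ (by positivity) (by positivity)]
      nlinarith
    have h7 : s * α / ((d : ℝ) + 1) ^ 2 ≤ s * α * (β / ((d + 1) * (α + β))) := by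
      rw [div_eq_mul_one_div]
      exact mul_le_mul_of_nonneg_left h6 (by positivity)
    nlinarith

theorem ConvexOn.add_slope_mul_le {f : ℝ → ℝ} {s : Set ℝ} (hf : ConvexOn ℝ s f) {x y z : ℝ}
    (hx : x ∈ s) (hz : z ∈ s) (hxy : x < y) (hyz : y ≤ z) :
    f x + (f y - f x) / (y - x) * (z - x) ≤ f z := by
  rcases hyz.eq_or_lt with h | h
  · subst h
    rw [div_mul_cancel₀ _ (by linarith)]; linarith
  · have := hf.secant_mono hx (hf.1.ordConnected.out hx hz ⟨hxy.le, hyz⟩) hz hxy.ne'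
      (by linarith : z ≠ x) hyz
    have h2 := mul_le_mul_of_nonneg_right this (show 0 ≤ z - x by linarith)
    rw [div_mul_cancel₀ _ (show z - x ≠ 0 by linarith)] at h2
    linarith

theorem ConvexOn.sub_slope_mul_le {f : ℝ → ℝ} {s : Set ℝ} (hf : ConvexOn ℝ s f) {x y z : ℝ}
    (hx : x ∈ s) (hz : z ∈ s) (hxy : z ≤ y) (hyz : y < x) :
    f x + (f y - f x) / (y - x) * (z - x) ≤ f z := by
  rcases hxy.eq_or_lt with h | h
  · subst h
    rw [div_mul_cancel₀ _ (by linarith)]; linarith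
  · have := hf.secant_mono hx hz (hf.1.ordConnected.out hz hx ⟨hxy, hyz.le⟩)
      (by linarith : z ≠ x) hyz.ne hxy
    have h2 := mul_le_mul_of_nonpos_right this (show z - x ≤ 0 by linarith)
    rw [div_mul_cancel₀ _ (show z - x ≠ 0 by linarith)] at h2
    linarith

theorem KnotSeq.schoen_node_eq {d : ℕ} (hd : 1 ≤ d) (f : ℝ → ℝ) {i : ℤ}
    (h : i ≤ -(d : ℤ) ∨ (n : ℤ) - 1 ≤ i) :
    Δ.schoen d f (Δ.greville d i) = f (Δ.greville d i) := by
  unfold KnotSeq.schoen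
  rcases h with h | h
  · rw [Δ.greville_left d h, Δ.spline_at_zero hd, Δ.greville_left d le_rfl]
  · rw [Δ.greville_right hd h, Δ.spline_at_one hd, Δ.greville_right hd le_rfl]

/-- For an interior node ξ = ξ_{i,d+1}, the point ξ_{i+1,d} lies at distance α/d to its right and
not beyond the next node of degree d+1. By convexity f is above the secant through these two points
at all later nodes. Earlier nodes are at least (α+β)/(d+1) away, where the line of slope
(d+1)f(ξ)/(α+β) has dropped to 0 or below, hence below f. The two lines form the kink evaluated in
`kink_bound`. -/
theorem KnotSeq.le_schoen_node_right {d : ℕ} (hd : 1 ≤ d) {f : ℝ → ℝ}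
    (hf : ConvexOn ℝ (Set.Icc 0 1) f) (h0 : ∀ t ∈ Set.Icc (0 : ℝ) 1, 0 ≤ f t) (i : ℤ) :
    (d : ℝ) / (d + 1) ^ 2 * f (Δ.greville d (i + 1))
      ≤ Δ.schoen (d + 1) f (Δ.greville (d + 1) i) := by
  have hp : (d : ℝ) / (d + 1) ^ 2 ≤ 1 := by
    rw [div_le_iff₀ (by positivity)]; nlinarith [sq_nonneg (d : ℝ)]
  by_cases hi : i ≤ -((d + 1 : ℕ) : ℤ) ∨ (n : ℤ) - 1 ≤ i
  · rw [Δ.schoen_node_eq (by omega) f hi]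
    have e : Δ.greville d (i + 1) = Δ.greville (d + 1) i := by
      rcases hi with h | h
      · rw [Δ.greville_left _ h, Δ.greville_left]; push_cast at h; omega
      · rw [Δ.greville_right (by omega) h, Δ.greville_right hd]; omega
    rw [e]
    exact mul_le_of_le_one_left (h0 _ (Δ.greville_mem _ _)) hp
  push Not at hi
  obtain ⟨hi1, hi2⟩ := hi
  push_cast at hi1
  have h1 : -(d : ℤ) ≤ i := by omega
  obtain ⟨hl, ha, hb⟩ := Δ.node_bounds hd h1 hi2
  set ξ := Δ.greville (d + 1) i with hξ
  set α := ξ - Δ.x (i + 1) with hα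
  set β := Δ.x (i + d + 1) - ξ with hβ
  have hsum : Δ.x (i + d + 1) - Δ.x (i + 1) = α + β := by rw [hα, hβ]; ring
  have hl' : 0 < α + β := by rw [← hsum]; exact sub_pos.2 hl
  rw [hsum] at ha hb
  have hd0 : (0 : ℝ) < d := by positivity
  have hα0 : 0 < α := by by_contra h; nlinarith
  have hβ0 : 0 < β := by by_contra h; nlinarith
  have g2 := Δ.greville_succ_left d (i + 1)
  rw [add_sub_cancel_right] at g2
  have eT : Δ.greville d (i + 1) - ξ = α / d := by
    rw [eq_div_iff hd0.ne']; linarith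
  have hα' : 0 < α / d := by positivity
  set s := (f (Δ.greville d (i + 1)) - f ξ) / (Δ.greville d (i + 1) - ξ) with hs
  have efT : f (Δ.greville d (i + 1)) = f ξ + s * (α / d) := by
    rw [hs, eT]; field_simp; ring
  rw [efT]
  have hξm := Δ.greville_mem (d + 1) i
  refine kink_bound hd hα0 hβ0 (h0 _ hξm) hb
    (Δ.le_schoen (by omega) hf hξm) fun _ hs' => ?_
  have := Δ.add_kink_le_spline hd h1 hi2 (fun j => f (Δ.greville (d + 1) j)) hs' ?_ ?_
  · rw [hsum] at this
    exact this
  · intro j _ hij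
    refine ConvexOn.add_slope_mul_le hf hξm (Δ.greville_mem _ _) (by linarith) ?_
    have g3 := Δ.greville_succ_right d (i + 1)
    have g4 := Δ.greville_le hd (i + 1)
    have g5 := Δ.monotone (show i + 1 + (d : ℤ) ≤ i + 1 + d + 1 by omega)
    have : Δ.greville d (i + 1) ≤ Δ.greville (d + 1) (i + 1) := by
      by_contra h; push Not at h; nlinarith
    exact this.trans (Δ.greville_mono _ (by omega))
  · intro j _ hij
    refine le_trans ?_ (h0 _ (Δ.greville_mem _ _))
    have w1 := Δ.greville_sub (d := d + 1) (by omega) i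
    have w2 : Δ.greville (d + 1) j ≤ Δ.greville (d + 1) (i - 1) := Δ.greville_mono _ (by omega)
    have w3 : (α + β) / (d + 1) ≤ ξ - Δ.greville (d + 1) (i - 1) := by
      rw [w1, ← hsum]
      push_cast
      rw [← add_assoc]
      gcongr
      exact Δ.monotone (by omega)
    rw [div_le_iff₀ (by positivity)] at w3
    have hyn := h0 _ hξm
    have : ((d : ℝ) + 1) * f ξ / (α + β) * (Δ.greville (d + 1) j - ξ) ≤ - f ξ := by
      rw [div_mul_eq_mul_div, div_le_iff₀ hl']
      have := mul_le_mul_of_nonneg_left w2 (show (0 : ℝ) ≤ d + 1 by positivity)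
      have := mul_le_mul_of_nonneg_left (show α + β ≤ (ξ - Δ.greville (d + 1) j) * (d + 1) by linarith)
        hyn
      linarith
    linarith

/-- Mirror image of `KnotSeq.le_schoen_node_right`: at an interior node, ξ_{i,d} is at distance β/d
to the left, and α and β exchange their roles. -/
theorem KnotSeq.le_schoen_node_left {d : ℕ} (hd : 1 ≤ d) {f : ℝ → ℝ}
    (hf : ConvexOn ℝ (Set.Icc 0 1) f) (h0 : ∀ t ∈ Set.Icc (0 : ℝ) 1, 0 ≤ f t) (i : ℤ) :
    (d : ℝ) / (d + 1) ^ 2 * f (Δ.greville d i)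
      ≤ Δ.schoen (d + 1) f (Δ.greville (d + 1) i) := by
  have hp : (d : ℝ) / (d + 1) ^ 2 ≤ 1 := by
    rw [div_le_iff₀ (by positivity)]; nlinarith [sq_nonneg (d : ℝ)]
  by_cases hi : i ≤ -((d + 1 : ℕ) : ℤ) ∨ (n : ℤ) - 1 ≤ i
  · rw [Δ.schoen_node_eq (by omega) f hi]
    have e : Δ.greville d i = Δ.greville (d + 1) i := by
      rcases hi with h | h
      · rw [Δ.greville_left _ h, Δ.greville_left]; push_cast at h; omega
      · rw [Δ.greville_right hd h, Δ.greville_right (by omega) h]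
    rw [e]
    exact mul_le_of_le_one_left (h0 _ (Δ.greville_mem _ _)) hp
  push Not at hi
  obtain ⟨hi1, hi2⟩ := hi
  push_cast at hi1
  have h1 : -(d : ℤ) ≤ i := by omega
  obtain ⟨hl, ha, hb⟩ := Δ.node_bounds hd h1 hi2
  set ξ := Δ.greville (d + 1) i with hξ
  set α := ξ - Δ.x (i + 1) with hα
  set β := Δ.x (i + d + 1) - ξ with hβ
  have hsum : Δ.x (i + d + 1) - Δ.x (i + 1) = α + β := by rw [hα, hβ]; ring
  have hl' : 0 < α + β := by rw [← hsum]; exact sub_pos.2 hl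
  rw [hsum] at ha hb
  have hd0 : (0 : ℝ) < d := by positivity
  have hα0 : 0 < α := by by_contra h; nlinarith
  have hβ0 : 0 < β := by by_contra h; nlinarith
  have g2 := Δ.greville_succ_right d i
  have eT : ξ - Δ.greville d i = β / d := by
    rw [eq_div_iff hd0.ne']; linarith
  have hβ' : 0 < β / d := by positivity
  set s := (f (Δ.greville d i) - f ξ) / (Δ.greville d i - ξ) with hs
  have efT : f (Δ.greville d i) = f ξ + (-s) * (β / d) := by
    rw [hs, ← eT]
    have : Δ.greville d i - ξ ≠ 0 := by linarith
    field_simp; ring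
  rw [efT]
  have hξm := Δ.greville_mem (d + 1) i
  refine kink_bound hd hβ0 hα0 (h0 _ hξm) (by linarith)
    (Δ.le_schoen (by omega) hf hξm) fun _ hs' => ?_
  have := Δ.add_kink_le_spline hd h1 hi2 (fun j => f (Δ.greville (d + 1) j))
    (sL := s) (sR := -(((d : ℝ) + 1) * f ξ / (β + α))) (by linarith) ?_ ?_
  · rw [hsum] at this
    refine le_trans (le_of_eq ?_) this
    simp only [← hξ, ← hα, ← hβ, add_comm β α, mul_comm β α]
    ring
  · intro j _ hij
    refine le_trans ?_ (h0 _ (Δ.greville_mem _ _))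
    have w1 := Δ.greville_sub (d := d + 1) (by omega) (i + 1)
    rw [add_sub_cancel_right] at w1
    have w2 : Δ.greville (d + 1) (i + 1) ≤ Δ.greville (d + 1) j := Δ.greville_mono _ (by omega)
    have w3 : (α + β) / (d + 1) ≤ Δ.greville (d + 1) (i + 1) - ξ := by
      rw [w1, ← hsum]
      push_cast
      gcongr
      exact Δ.monotone (by omega)
    rw [div_le_iff₀ (by positivity)] at w3
    have hyn := h0 _ hξm
    have : f ξ ≤ ((d : ℝ) + 1) * f ξ / (β + α) * (Δ.greville (d + 1) j - ξ) := by
      rw [div_mul_eq_mul_div, le_div_iff₀ (by linarith)]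
      have := mul_le_mul_of_nonneg_left w2 (show (0 : ℝ) ≤ d + 1 by positivity)
      have := mul_le_mul_of_nonneg_left (show α + β ≤ (Δ.greville (d + 1) j - ξ) * (d + 1) by linarith)
        hyn
      linarith
    simp only [← hξ]
    linarith
  · intro j _ hij
    refine ConvexOn.sub_slope_mul_le hf hξm (Δ.greville_mem _ _) ?_ (by linarith)
    have g3 := Δ.greville_succ_left d i
    have g4 := Δ.le_greville hd i
    have g5 := Δ.monotone (show i ≤ i + 1 by omega)
    have : Δ.greville (d + 1) (i - 1) ≤ Δ.greville d i := by
      by_contra h; push Not at h; nlinarith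
    exact (Δ.greville_mono _ (by omega)).trans this

/-! ### Comparison of Schoenberg operators of consecutive degrees -/

/-- Two steps of the Schoenberg operator of degree `d + 1` dominate one step of degree `d`. -/
theorem KnotSeq.schoen_le_schoen_schoen {d : ℕ} (hd : 1 ≤ d) {f : ℝ → ℝ}
    (hf : ConvexOn ℝ (Set.Icc 0 1) f) (h0 : ∀ t ∈ Set.Icc (0 : ℝ) 1, 0 ≤ f t) (t : ℝ) :
    (d : ℝ) / (d + 1) ^ 2 * Δ.schoen d f t ≤ Δ.schoen (d + 1) (Δ.schoen (d + 1) f) t := by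
  -- One de Boor step on the outer operator leaves a sum over N_{j,d}. The two values averaged in it
  -- belong to ξ_{j-1,d+1} and ξ_{j,d+1}, the neighbours of ξ_{j,d}, and the two node estimates
  -- bound both by f(ξ_{j,d}).
  rw [KnotSeq.schoen, ← smul_eq_mul, ← Δ.spline_smul, KnotSeq.schoen, Δ.spline_succ]
  refine Δ.spline_mono fun j _ hne => ?_
  have hr := Δ.ratio_mem hne
  have e1 := Δ.le_schoen_node_right hd hf h0 (j - 1)
  have e2 := Δ.le_schoen_node_left hd hf h0 j
  rw [sub_add_cancel] at e1
  simp only [smul_eq_mul]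
  have := mul_le_mul_of_nonneg_left e1 (show 0 ≤ 1 - Δ.ratio d j t by linarith [hr.2])
  have := mul_le_mul_of_nonneg_left e2 hr.1
  linarith

theorem ConvexOn.exists_support {f : ℝ → ℝ} (hf : ConvexOn ℝ (Set.Icc 0 1) f) {x : ℝ}
    (hx : x ∈ Set.Ioo (0 : ℝ) 1) :
    ∃ m : ℝ, ∀ y ∈ Set.Icc (0 : ℝ) 1, f x + m * (y - x) ≤ f y := by
  have hi : x ∈ interior (Set.Icc (0 : ℝ) 1) := by rwa [interior_Icc]
  refine ⟨derivWithin f (Set.Ioi x) x, fun y hy => ?_⟩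
  rcases lt_trichotomy x y with h | h | h
  · have := hf.rightDeriv_le_slope_of_mem_interior hi hy h
    rw [slope_def_field, le_div_iff₀ (by linarith)] at this
    linarith
  · subst h; simp
  · have h1 := hf.slope_le_leftDeriv_of_mem_interior hy hi h
    have h2 := h1.trans (hf.leftDeriv_le_rightDeriv_of_mem_interior hi)
    rw [slope_def_field, div_le_iff₀ (by linarith)] at h2
    linarith

theorem KnotSeq.schoen_add_affine {d : ℕ} (hd : 1 ≤ d) (f : ℝ → ℝ) (a b : ℝ) {t : ℝ}
    (ht : t ∈ Set.Icc (0 : ℝ) 1) :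
    Δ.schoen d (fun y => f y + (a + b * y)) t = Δ.schoen d f t + (a + b * t) := by
  unfold KnotSeq.schoen
  have := Δ.spline_smul d b (Δ.greville d) t
  simp only [smul_eq_mul] at this
  rw [Δ.spline_add, Δ.spline_add, Δ.spline_const d _ ht, this, Δ.spline_greville hd ht]

theorem KnotSeq.schoen_congr {d : ℕ} {f g : ℝ → ℝ} (h : ∀ t ∈ Set.Icc (0 : ℝ) 1, f t = g t)
    (t : ℝ) : Δ.schoen d f t = Δ.schoen d g t :=
  Δ.spline_congr fun j _ _ => h _ (Δ.greville_mem d j)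

/-- The operators reproduce affine functions, so a support line of f at t may be subtracted; what
remains is convex, nonnegative and zero at t, and the preceding comparison applies. At 0 and 1,
where no support line need exist, both sides vanish by interpolation. -/
theorem KnotSeq.schoen_sub_le {d : ℕ} (hd : 1 ≤ d) {f : ℝ → ℝ}
    (hf : ConvexOn ℝ (Set.Icc 0 1) f) {t : ℝ} (ht : t ∈ Set.Icc (0 : ℝ) 1) :
    (d : ℝ) / (d + 1) ^ 2 * (Δ.schoen d f t - f t)
      ≤ Δ.schoen (d + 1) (Δ.schoen (d + 1) f) t - f t := by
  have ends : ∀ {e : ℕ}, 1 ≤ e → ∀ g : ℝ → ℝ, Δ.schoen e g 0 = g 0 ∧ Δ.schoen e g 1 = g 1 := by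
    intro e he g
    have a := Δ.schoen_node_eq he g (i := -(e : ℤ)) (Or.inl le_rfl)
    have b := Δ.schoen_node_eq he g (i := (n : ℤ) - 1) (Or.inr le_rfl)
    rw [Δ.greville_left e le_rfl] at a
    rw [Δ.greville_right he le_rfl] at b
    exact ⟨a, b⟩
  rcases eq_or_lt_of_le ht.1 with h | h
  · rw [← h, (ends hd _).1, (ends (by omega : 1 ≤ d + 1) _).1, (ends (by omega : 1 ≤ d + 1) _).1]
    simp
  rcases eq_or_lt_of_le ht.2 with h' | h'
  · rw [h', (ends hd _).2, (ends (by omega : 1 ≤ d + 1) _).2, (ends (by omega : 1 ≤ d + 1) _).2]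
    simp
  obtain ⟨m, hm⟩ := ConvexOn.exists_support hf ⟨h, h'⟩
  set g : ℝ → ℝ := fun y => f y + ((m * t - f t) + (-m) * y) with hg
  have hgc : ConvexOn ℝ (Set.Icc 0 1) g := by
    refine hf.add ⟨convex_Icc 0 1, fun x _ y _ a b _ _ hab => ?_⟩
    simp only [smul_eq_mul]
    apply le_of_eq
    linear_combination (f t - m * t) * hab
  have hg0 : ∀ y ∈ Set.Icc (0 : ℝ) 1, 0 ≤ g y := fun y hy => by
    have := hm y hy
    simp only [hg]; linarith
  have key := Δ.schoen_le_schoen_schoen hd hgc hg0 t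
  have e1 : Δ.schoen d g t = Δ.schoen d f t - f t := by
    rw [hg, Δ.schoen_add_affine hd f _ _ ht]; ring
  have e2 : Δ.schoen (d + 1) (Δ.schoen (d + 1) g) t
      = Δ.schoen (d + 1) (Δ.schoen (d + 1) f) t - f t := by
    rw [Δ.schoen_congr (g := fun y => Δ.schoen (d + 1) f y + ((m * t - f t) + (-m) * y))
      (fun y hy => Δ.schoen_add_affine (by omega) f _ _ hy),
      Δ.schoen_add_affine (by omega) _ _ _ ht]
    ring
  rwa [e1, e2] at key

end SplineLower

namespace SplineLower

variable {n : ℕ} (Δ : KnotSeq n)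

/-! ### The comparison principle -/

/-- Discrete maximum principle. Where ‖F‖/z has its maximum M over the interior nodes, positivity of
the B-splines gives ‖SF‖ ≤ M·Sz, hence M(z - Sz) ≤ ‖F - SF‖ ≤ z - Sz, which contradicts M > 1. -/
theorem KnotSeq.norm_le_of_supersolution {E : Type*} [NormedAddCommGroup E] [NormedSpace ℝ E]
    {d : ℕ} {F : ℤ → E} {z : ℤ → ℝ}
    (h0 : F (-(d : ℤ)) = 0) (h1 : F (n - 1) = 0)
    (hz : ∀ j ∈ Finset.Ico (-(d : ℤ)) n, 0 ≤ z j)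
    (hz' : ∀ j ∈ Finset.Ioo (-(d : ℤ)) (n - 1), 0 < z j - Δ.spline d z (Δ.greville d j))
    (hF : ∀ j ∈ Finset.Ioo (-(d : ℤ)) (n - 1), ‖F j - Δ.spline d F (Δ.greville d j)‖
      ≤ z j - Δ.spline d z (Δ.greville d j)) :
    ∀ j ∈ Finset.Ico (-(d : ℤ)) n, ‖F j‖ ≤ z j := by
  have hpos : ∀ j ∈ Finset.Ioo (-(d : ℤ)) (n - 1), 0 < z j := fun j hj => by
    have h2 := hz' j hj
    have : 0 ≤ Δ.spline d z (Δ.greville d j) :=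
      Finset.sum_nonneg fun i hi => mul_nonneg (Δ.bspline_nonneg d i _) (hz i hi)
    linarith
  by_contra hcon
  push Not at hcon
  obtain ⟨j0, hj0, hlt⟩ := hcon
  have split : ∀ j ∈ Finset.Ico (-(d : ℤ)) n, j ∈ Finset.Ioo (-(d : ℤ)) (n - 1) ∨ F j = 0 := by
    intro j hj
    simp only [Finset.mem_Ico, Finset.mem_Ioo] at *
    by_cases ha : j = -(d : ℤ)
    · right; rw [ha, h0]
    by_cases hb : j = n - 1
    · right; rw [hb, h1]
    left; omega
  have hj0' : j0 ∈ Finset.Ioo (-(d : ℤ)) (n - 1) := by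
    rcases split j0 hj0 with h | h
    · exact h
    · rw [h, norm_zero] at hlt; linarith [hz j0 hj0]
  obtain ⟨j, hj, hmax⟩ := Finset.exists_max_image (Finset.Ioo (-(d : ℤ)) (n - 1))
    (fun j => ‖F j‖ / z j) ⟨j0, hj0'⟩
  set M := ‖F j‖ / z j with hM
  have hM1 : 1 < M := lt_of_lt_of_le ((one_lt_div (hpos _ hj0')).2 hlt) (hmax j0 hj0')
  have hbd : ∀ i ∈ Finset.Ico (-(d : ℤ)) n, ‖F i‖ ≤ M * z i := by
    intro i hi
    rcases split i hi with h | h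
    · have := hmax i h
      rwa [div_le_iff₀ (hpos _ h)] at this
    · rw [h, norm_zero]
      exact mul_nonneg (by linarith) (hz i hi)
  have e1 : ‖F j‖ = M * z j := by rw [hM, div_mul_cancel₀ _ (hpos _ hj).ne']
  have e2 : ‖Δ.spline d F (Δ.greville d j)‖ ≤ M * Δ.spline d z (Δ.greville d j) := by
    refine (Δ.norm_spline_le d F _).trans ?_
    rw [← smul_eq_mul, ← Δ.spline_smul]
    exact Δ.spline_mono fun i hi _ => hbd i hi
  have e3 : ‖F j‖ ≤ ‖F j - Δ.spline d F (Δ.greville d j)‖ + ‖Δ.spline d F (Δ.greville d j)‖ := by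
    simpa using norm_add_le (F j - Δ.spline d F (Δ.greville d j)) (Δ.spline d F (Δ.greville d j))
  have e4 := hF j hj
  have e5 := hz' j hj
  nlinarith

theorem KnotSeq.mem_Ioo_of_node {d : ℕ} (hd : 1 ≤ d) {j : ℤ}
    (hj : j ∈ Finset.Ioo (-(d : ℤ)) (n - 1)) : Δ.greville d j ∈ Set.Ioo (0 : ℝ) 1 := by
  simp only [Finset.mem_Ioo] at hj
  exact ⟨Δ.greville_pos hd hj.1 (by omega), Δ.greville_lt_one hd hj.1.le hj.2⟩

/-- `ξ (1 - ξ)` is a strict supersolution. -/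
theorem KnotSeq.le_quadratic_sub {d : ℕ} (hd : 1 ≤ d) {i : ℤ} (h1 : -(d : ℤ) ≤ i) (h2 : i < n - 1) :
    (Δ.greville (d + 1) i - Δ.x (i + 1)) * (Δ.x (i + d + 1) - Δ.greville (d + 1) i)
        / ((d : ℝ) + 1) ^ 2
      ≤ Δ.greville (d + 1) i * (1 - Δ.greville (d + 1) i)
        - Δ.spline (d + 1) (fun j => Δ.greville (d + 1) j * (1 - Δ.greville (d + 1) j))
          (Δ.greville (d + 1) i) := by
  refine (Δ.le_spline_sq hd h1 h2).trans (le_of_eq ?_)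
  set ξ := Δ.greville (d + 1) i with hξ
  have hm := Δ.greville_mem (d + 1) i
  have e : Δ.spline (d + 1) (fun j => (Δ.greville (d + 1) j - ξ) ^ 2
      + Δ.greville (d + 1) j * (1 - Δ.greville (d + 1) j)) ξ
      = Δ.spline (d + 1) (fun j => ξ ^ 2 + (1 - 2 * ξ) • Δ.greville (d + 1) j) ξ := by
    refine Δ.spline_congr fun j _ _ => ?_
    simp only [smul_eq_mul]; ring
  rw [Δ.spline_add, Δ.spline_add, Δ.spline_const _ _ hm, Δ.spline_smul,
    Δ.spline_greville (by omega) hm, smul_eq_mul] at e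
  linarith

theorem KnotSeq.quadratic_sub_pos {d : ℕ} (hd : 2 ≤ d) {i : ℤ}
    (hi : i ∈ Finset.Ioo (-(d : ℤ)) (n - 1)) :
    0 < Δ.greville d i * (1 - Δ.greville d i)
        - Δ.spline d (fun j => Δ.greville d j * (1 - Δ.greville d j)) (Δ.greville d i) := by
  obtain ⟨d, rfl⟩ : ∃ e, d = e + 1 := ⟨d - 1, by omega⟩
  simp only [Finset.mem_Ioo] at hi
  push_cast at hi
  have hd' : 1 ≤ d := by omega
  obtain ⟨hl, ha, hb⟩ := Δ.node_bounds hd' (i := i) (by omega) (by omega)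
  refine lt_of_lt_of_le (div_pos (mul_pos ?_ ?_) (by positivity))
    (Δ.le_quadratic_sub hd' (by omega) (by omega))
  · by_contra h; nlinarith
  · by_contra h; nlinarith

/-- Comparison with εξ(1-ξ) for every ε > 0. This gives uniqueness for the discrete problem and
excludes the eigenvalue 1 for sequences vanishing at both ends. -/
theorem KnotSeq.eq_zero_of_fixed {E : Type*} [NormedAddCommGroup E] [NormedSpace ℝ E] {d : ℕ}
    (hd : 2 ≤ d) {c : ℤ → E} (c0 : c (-(d : ℤ)) = 0) (c1 : c (n - 1) = 0)
    (h : ∀ j ∈ Finset.Ioo (-(d : ℤ)) (n - 1), Δ.spline d c (Δ.greville d j) = c j) :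
    ∀ j ∈ Finset.Ico (-(d : ℤ)) n, c j = 0 := by
  intro j hj
  have key : ∀ ε : ℝ, 0 < ε → ‖c j‖ ≤ ε := by
    intro ε hε
    have hs : ∀ t, Δ.spline d (fun j => ε * (Δ.greville d j * (1 - Δ.greville d j))) t
        = ε * Δ.spline d (fun j => Δ.greville d j * (1 - Δ.greville d j)) t := fun t => by
      have := Δ.spline_smul d ε (fun j => Δ.greville d j * (1 - Δ.greville d j)) t
      simpa only [smul_eq_mul] using this
    have := Δ.norm_le_of_supersolution (d := d) (F := c)
      (z := fun j => ε * (Δ.greville d j * (1 - Δ.greville d j))) c0 c1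
      (fun j _ => mul_nonneg hε.le (mul_nonneg (Δ.greville_mem d j).1
        (sub_nonneg.2 (Δ.greville_mem d j).2)))
      (fun i hi => by
        rw [hs, ← mul_sub]
        exact mul_pos hε (Δ.quadratic_sub_pos hd hi))
      (fun i hi => by
        rw [h i hi, sub_self, norm_zero, hs, ← mul_sub]
        exact (mul_pos hε (Δ.quadratic_sub_pos hd hi)).le) j hj
    refine this.trans ?_
    have h2 := Δ.greville_mem d j
    have : Δ.greville d j * (1 - Δ.greville d j) ≤ 1 := by nlinarith [h2.1, h2.2]
    nlinarith
  have : ‖c j‖ ≤ 0 := le_of_forall_pos_le_add fun ε hε => by simpa using key ε hε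
  exact norm_le_zero_iff.1 this

/-! ### Concave supersolutions from the spectrum -/

/-- The number `γ` bounds all eigenvalues `z ≠ 0, 1` of the matrix `(N_{i,d}(ξ_{j,d}))` whose
eigenvectors vanish at the end points. -/
def KnotSeq.EigenBound (d : ℕ) (γ : ℝ) : Prop :=
  ∀ (z : ℂ) (c : ℤ → ℂ), z ≠ 0 → z ≠ 1 → c (-(d : ℤ)) = 0 → c (n - 1) = 0 →
    (∀ j ∈ Finset.Ico (-(d : ℤ)) n, Δ.spline d c (Δ.greville d j) = z * c j) →
    (∃ j ∈ Finset.Ico (-(d : ℤ)) n, c j ≠ 0) → ‖z‖ ≤ γ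

open Classical in
/-- The matrix of the Schoenberg operator on functions vanishing at the end points. -/
noncomputable def KnotSeq.mat (d : ℕ) :
    Matrix (Finset.Ico (-(d : ℤ)) n) (Finset.Ico (-(d : ℤ)) n) ℂ :=
  fun i j => if j.1 = -(d : ℤ) ∨ j.1 = n - 1 then 0 else (bspline Δ.x d j.1 (Δ.greville d i.1) : ℂ)

theorem KnotSeq.mat_mulVec (d : ℕ) (c : ℤ → ℂ) (h0 : c (-(d : ℤ)) = 0) (h1 : c (n - 1) = 0)
    (i : Finset.Ico (-(d : ℤ)) n) :
    (Δ.mat d).mulVec (fun j => c j.1) i = Δ.spline d c (Δ.greville d i.1) := by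
  unfold Matrix.mulVec dotProduct KnotSeq.spline KnotSeq.mat
  beta_reduce
  rw [← Finset.sum_coe_sort (Finset.Ico (-(d : ℤ)) n)]
  refine Finset.sum_congr rfl fun j _ => ?_
  split_ifs with h
  · rcases h with h | h <;> simp [h, h0, h1]
  · simp

/-- The rows of the end nodes are zero, because the only B-spline alive there has its column
removed. An eigenvector for z ≠ 0 thus vanishes at both ends and is an eigenvector of the full node
matrix; z = 1 is excluded by `KnotSeq.eq_zero_of_fixed`. -/
theorem KnotSeq.norm_le_of_mem_spectrum {d : ℕ} (hd : 2 ≤ d) {γ : ℝ} (hγ : 0 ≤ γ)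
    (hE : Δ.EigenBound d γ) {z : ℂ} (hz : z ∈ spectrum ℂ (Δ.mat d)) : ‖z‖ ≤ γ := by
  rcases eq_or_ne z 0 with rfl | hz0
  · simpa using hγ
  rw [spectrum.mem_iff, Matrix.isUnit_iff_isUnit_det, isUnit_iff_ne_zero, not_not,
    ← Matrix.exists_mulVec_eq_zero_iff] at hz
  obtain ⟨v, hv, hv0⟩ := hz
  classical
  rw [Matrix.sub_mulVec, sub_eq_zero] at hv0
  have hv1 : ∀ i, (Δ.mat d).mulVec v i = z * v i := fun i => by
    rw [← hv0, Matrix.algebraMap_eq_diagonal, Matrix.mulVec_diagonal]; simp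
  have hn := Δ.one_le
  set c : ℤ → ℂ := fun j => if h : j ∈ Finset.Ico (-(d : ℤ)) n then v ⟨j, h⟩ else 0 with hc
  have hcv : ∀ j : Finset.Ico (-(d : ℤ)) n, c j.1 = v j := fun j => dif_pos j.2
  have ends : ∀ j : Finset.Ico (-(d : ℤ)) n, (∀ c' : ℤ → ℂ, Δ.spline d c' (Δ.greville d j.1) = c' j.1)
      → j.1 = -(d : ℤ) ∨ j.1 = n - 1 → v j = 0 := by
    intro j hj hj'
    have h1 := hv1 j
    have h2 : (Δ.mat d).mulVec v j = 0 := by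
      have h3 := hj fun i => if i = -(d : ℤ) ∨ i = n - 1 then 0 else c i
      rw [← Δ.mat_mulVec d _ (by simp) (by simp)] at h3
      rw [if_pos hj'] at h3
      rw [← h3]
      unfold Matrix.mulVec dotProduct
      refine Finset.sum_congr rfl fun i _ => ?_
      unfold KnotSeq.mat
      beta_reduce
      split_ifs with h
      · simp
      · rw [hcv]
    rw [h2] at h1
    exact (mul_eq_zero.1 h1.symm).resolve_left hz0
  have c0 : c (-(d : ℤ)) = 0 := by
    rw [hcv ⟨-(d : ℤ), by simp; omega⟩]
    exact ends _ (fun c' => by rw [Δ.greville_left d le_rfl, Δ.spline_at_zero (by omega)]) (Or.inl rfl)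
  have c1 : c (n - 1) = 0 := by
    rw [hcv ⟨n - 1, by simp; omega⟩]
    exact ends _ (fun c' => by
      rw [Δ.greville_right (by omega) le_rfl, Δ.spline_at_one (by omega)]) (Or.inr rfl)
  have heig : ∀ j ∈ Finset.Ico (-(d : ℤ)) n, Δ.spline d c (Δ.greville d j) = z * c j := by
    intro j hj
    rw [← Δ.mat_mulVec d c c0 c1 ⟨j, hj⟩, hcv ⟨j, hj⟩, ← hv1]
    simp only [hcv]
  have hne : ∃ j ∈ Finset.Ico (-(d : ℤ)) n, c j ≠ 0 := by
    by_contra h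
    push Not at h
    exact hv (funext fun j => by rw [← hcv]; exact h _ j.2)
  refine hE z c hz0 ?_ c0 c1 heig hne
  rintro rfl
  obtain ⟨j, hj, hj'⟩ := hne
  exact hj' (Δ.eq_zero_of_fixed hd c0 c1 (fun i hi => by
    rw [heig i (by simp only [Finset.mem_Ioo, Finset.mem_Ico] at *; omega), one_mul]) j hj)

section Gelfand

attribute [local instance] Matrix.linftyOpNormedRing Matrix.linftyOpNormedAlgebra

/-- Gelfand's formula with a rate strictly between γ and l; the quotient of the rates then makes
room for any constant ε. -/
theorem KnotSeq.exists_norm_pow_le {d : ℕ} (hd : 2 ≤ d) {γ l ε : ℝ} (hγ : 0 ≤ γ)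
    (hE : Δ.EigenBound d γ) (hl : γ < l) (hε : 0 < ε) :
    ∃ m : ℕ, 0 < m ∧ ‖Δ.mat d ^ m‖ ≤ ε * l ^ m := by
  have hr : spectralRadius ℂ (Δ.mat d) ≤ ENNReal.ofReal γ := by
    refine iSup₂_le fun z hz => ?_
    rw [← enorm_eq_nnnorm, ← ofReal_norm]
    exact ENNReal.ofReal_le_ofReal (Δ.norm_le_of_mem_spectrum hd hγ hE hz)
  obtain ⟨l', h1, h2⟩ := exists_between hl
  have ht := spectrum.pow_nnnorm_pow_one_div_tendsto_nhds_spectralRadius (Δ.mat d)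
  have hlt : spectralRadius ℂ (Δ.mat d) < ENNReal.ofReal l' :=
    hr.trans_lt ((ENNReal.ofReal_lt_ofReal_iff (by linarith)).2 h1)
  have ev := ht.eventually (gt_mem_nhds hlt)
  have hl0 : 0 < l := by linarith
  have hl'0 : 0 < l' := by linarith
  have hq : Filter.Tendsto (fun m : ℕ => (l' / l) ^ m) Filter.atTop (nhds 0) :=
    tendsto_pow_atTop_nhds_zero_of_lt_one (by positivity) ((div_lt_one hl0).2 h2)
  have ev2 := hq.eventually (gt_mem_nhds hε)
  obtain ⟨m, ⟨e1, e2⟩, e3⟩ := ((ev.and ev2).and (Filter.eventually_gt_atTop 0)).exists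
  refine ⟨m, e3, ?_⟩
  have hm : (0 : ℝ) < m := by exact_mod_cast e3
  have e4 : ‖Δ.mat d ^ m‖ ≤ l' ^ m := by
    have := ENNReal.rpow_le_rpow e1.le hm.le
    rw [← ENNReal.rpow_mul, one_div_mul_cancel hm.ne', ENNReal.rpow_one, ENNReal.rpow_natCast,
      ← ENNReal.ofReal_pow hl'0.le, ← enorm_eq_nnnorm, ← ofReal_norm] at this
    exact (ENNReal.ofReal_le_ofReal_iff (by positivity)).1 this
  refine e4.trans ?_
  rw [div_pow, div_lt_iff₀ (by positivity)] at e2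
  exact e2.le

/-- All iterates vanish at 0 and 1, so their node values are powers of the reduced matrix applied to
those of f; the norm is the operator norm for the maximum norm. -/
theorem KnotSeq.abs_iterate_schoen_le {d : ℕ} (hd : 1 ≤ d) {f : ℝ → ℝ} (h0 : f 0 = 0)
    (h1 : f 1 = 0) (hf : ∀ t ∈ Set.Icc (0 : ℝ) 1, |f t| ≤ 1) (m : ℕ)
    (i : Finset.Ico (-(d : ℤ)) n) :
    |(Δ.schoen d)^[m] f (Δ.greville d i.1)| ≤ ‖Δ.mat d ^ m‖ := by
  have ends : ∀ m : ℕ, (Δ.schoen d)^[m] f 0 = 0 ∧ (Δ.schoen d)^[m] f 1 = 0 := by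
    intro m
    induction m with
    | zero => exact ⟨h0, h1⟩
    | succ m ih =>
      rw [Function.iterate_succ_apply']
      unfold KnotSeq.schoen
      rw [Δ.spline_at_zero hd, Δ.spline_at_one hd, Δ.greville_left d le_rfl,
        Δ.greville_right hd le_rfl]
      exact ih
  have key : ∀ m : ℕ, (Δ.mat d ^ m).mulVec (fun j => (f (Δ.greville d j.1) : ℂ))
      = fun j => ((Δ.schoen d)^[m] f (Δ.greville d j.1) : ℂ) := by
    intro m
    induction m with
    | zero => simp
    | succ m ih =>
      rw [pow_succ', ← Matrix.mulVec_mulVec, ih]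
      funext i
      rw [Δ.mat_mulVec d (fun j => ((Δ.schoen d)^[m] f (Δ.greville d j) : ℂ))]
      · rw [Function.iterate_succ_apply', KnotSeq.schoen]
        simp [KnotSeq.spline]
      · rw [Δ.greville_left d le_rfl, (ends m).1]; simp
      · rw [Δ.greville_right hd le_rfl, (ends m).2]; simp
  have h2 := congr_fun (key m) i
  have h3 := Matrix.linfty_opNorm_mulVec (Δ.mat d ^ m) (fun j => (f (Δ.greville d j.1) : ℂ))
  have h4 : ‖(fun j : Finset.Ico (-(d : ℤ)) n => (f (Δ.greville d j.1) : ℂ))‖ ≤ 1 :=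
    (pi_norm_le_iff_of_nonneg zero_le_one).2 fun j => by
      rw [Complex.norm_real]; exact hf _ (Δ.greville_mem d _)
  have h5 := (norm_le_pi_norm _ i).trans h3
  rw [h2, Complex.norm_real, Real.norm_eq_abs] at h5
  exact h5.trans (mul_le_of_le_one_right (norm_nonneg _) h4)

end Gelfand

end SplineLower

/-! ### Concave approximate eigenfunctions -/

namespace SplineLower

variable {n : ℕ} (Δ : KnotSeq n)

/-- The spline of degree d+1 with coefficients stepping from 0 to 1 at index i climbs from 0 to 1,
while its derivative is a multiple of N_{i,d}. -/
theorem KnotSeq.exists_bspline_pos {d : ℕ} (hd : 1 ≤ d) {i : ℤ} (hi : i ∈ Finset.Ico (-(d : ℤ)) n) :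
    ∃ t ∈ Set.Icc (0 : ℝ) 1, 0 < bspline Δ.x d i t := by
  by_contra hcon
  push Not at hcon
  have h0 : (0 : ℝ) ∈ Set.Icc (0 : ℝ) 1 := by simp
  have h1 : (1 : ℝ) ∈ Set.Icc (0 : ℝ) 1 := by simp
  simp only [Finset.mem_Ico] at hi
  have hint := Δ.integral_spline hd (fun j => if i ≤ j then (1 : ℝ) else 0) h0 h1
  rw [Δ.spline_at_zero (by omega), Δ.spline_at_one (by omega), if_pos (by omega),
    if_neg (by push_cast; omega), sub_zero] at hint
  refine zero_ne_one (α := ℝ) (hint ▸ ?_)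
  rw [intervalIntegral.integral_congr (g := fun _ => (0 : ℝ))]
  · simp
  · intro t ht
    rw [Set.uIcc_of_le zero_le_one] at ht
    refine Finset.sum_eq_zero fun j _ => ?_
    by_cases hj : j = i
    · subst hj
      rw [le_antisymm (hcon t ht) (Δ.bspline_nonneg d j t), zero_smul]
    · have : (if i ≤ j then (1 : ℝ) else 0) = if i ≤ j - 1 then 1 else 0 :=
        if_congr (by omega) rfl rfl
      rw [KnotSeq.slope]
      rw [this, sub_self, smul_zero, smul_zero]

theorem concaveOn_mul_one_sub : ConcaveOn ℝ (Set.Icc (0 : ℝ) 1) fun t => t * (1 - t) := by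
  have h : ConvexOn ℝ (Set.Icc (0 : ℝ) 1) fun t : ℝ => t ^ 2 :=
    (convexOn_pow 2).subset (fun t ht => ht.1) (convex_Icc 0 1)
  have h2 := (concaveOn_id (𝕜 := ℝ) (β := ℝ) (convex_Icc 0 1)).sub h
  refine h2.congr fun t _ => ?_
  simp only [Pi.sub_apply, id]
  ring

/-- A nonnegative concave function lies above the triangle with apex (s, 1), hence above t to the
left of s and above 1 - t to the right. -/
theorem ConcaveOn.le_of_max {w : ℝ → ℝ} (hw : ConcaveOn ℝ (Set.Icc 0 1) w)
    (h0 : ∀ t ∈ Set.Icc (0 : ℝ) 1, 0 ≤ w t) {s : ℝ} (hs : s ∈ Set.Icc (0 : ℝ) 1) (h1 : w s = 1)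
    {t : ℝ} (ht : t ∈ Set.Icc (0 : ℝ) 1) : t * (1 - t) ≤ w t := by
  have z0 : (0 : ℝ) ∈ Set.Icc (0 : ℝ) 1 := by simp
  have z1 : (1 : ℝ) ∈ Set.Icc (0 : ℝ) 1 := by simp
  rcases le_total t s with h | h
  · rcases hs.1.eq_or_lt with hs0 | hs0
    · rw [← hs0] at h1 h
      rw [le_antisymm h ht.1, h1]; norm_num
    have h2 := hw.2 z0 hs (show 0 ≤ 1 - t / s from sub_nonneg.2 ((div_le_one hs0).2 h))
      (show 0 ≤ t / s from div_nonneg ht.1 hs0.le) (by ring)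
    simp only [smul_eq_mul, mul_zero, zero_add, h1, mul_one, div_mul_cancel₀ t hs0.ne'] at h2
    have h3 : t ≤ t / s := le_div_self ht.1 hs0 hs.2
    have h4 := mul_nonneg (sub_nonneg.2 ((div_le_one hs0).2 h)) (h0 0 z0)
    nlinarith [ht.1]
  · rcases hs.2.eq_or_lt with hs0 | hs0
    · rw [hs0] at h1 h
      rw [le_antisymm ht.2 h, h1]; norm_num
    have p : 0 < 1 - s := by linarith
    have h2 := hw.2 z1 hs (show 0 ≤ 1 - (1 - t) / (1 - s) from
        sub_nonneg.2 ((div_le_one p).2 (by linarith)))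
      (show 0 ≤ (1 - t) / (1 - s) from div_nonneg (by linarith [ht.2]) p.le) (by ring)
    have e : (1 - (1 - t) / (1 - s)) • (1 : ℝ) + ((1 - t) / (1 - s)) • s = t := by
      simp only [smul_eq_mul]; field_simp; ring
    rw [e, h1, smul_eq_mul, smul_eq_mul, mul_one] at h2
    have h3 : 1 - t ≤ (1 - t) / (1 - s) := le_div_self (by linarith [ht.2]) p (by linarith [hs.1])
    have h4 := mul_nonneg (sub_nonneg.2 ((div_le_one p).2 (by linarith : 1 - t ≤ 1 - s))) (h0 1 z1)
    nlinarith [ht.1, ht.2]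

theorem KnotSeq.schoen_nonneg (d : ℕ) {f : ℝ → ℝ} (hf : ∀ t ∈ Set.Icc (0 : ℝ) 1, 0 ≤ f t) (t : ℝ) :
    0 ≤ Δ.schoen d f t := by
  unfold KnotSeq.schoen KnotSeq.spline
  exact Finset.sum_nonneg fun j _ => mul_nonneg (Δ.bspline_nonneg d j t) (hf _ (Δ.greville_mem d j))

theorem KnotSeq.schoen_mul (d : ℕ) (r : ℝ) (f : ℝ → ℝ) (t : ℝ) :
    Δ.schoen d (fun t => r * f t) t = r * Δ.schoen d f t := by
  simpa [KnotSeq.schoen] using Δ.spline_smul d r (fun j => f (Δ.greville d j)) t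

theorem KnotSeq.schoen_sum (d m : ℕ) (f : ℕ → ℝ → ℝ) (t : ℝ) :
    Δ.schoen d (fun t => ∑ i ∈ Finset.range m, f i t) t
      = ∑ i ∈ Finset.range m, Δ.schoen d (f i) t := by
  simp only [KnotSeq.schoen, KnotSeq.spline, smul_eq_mul, Finset.mul_sum]
  exact Finset.sum_comm

theorem KnotSeq.concaveOn_schoen {d : ℕ} (hd : 2 ≤ d) {f : ℝ → ℝ}
    (hf : ConcaveOn ℝ (Set.Icc 0 1) f) : ConcaveOn ℝ (Set.Icc 0 1) (Δ.schoen d f) := by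
  have h := Δ.convexOn_schoen hd hf.neg
  rw [← neg_convexOn_iff]
  refine h.congr fun t _ => ?_
  have := Δ.schoen_mul d (-1) f t
  simp only [neg_mul, one_mul] at this
  exact this

/-- A concave approximate eigenfunction of the Schoenberg operator. -/
theorem KnotSeq.exists_concave_supersolution {d : ℕ} (hd : 2 ≤ d) {γ l : ℝ} (hγ : 0 ≤ γ)
    (hE : Δ.EigenBound d γ) (hl : γ < l) :
    ∃ w : ℝ → ℝ, ConcaveOn ℝ (Set.Icc 0 1) w ∧ (∀ t ∈ Set.Icc (0 : ℝ) 1, t * (1 - t) ≤ w t) ∧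
      (∀ t ∈ Set.Icc (0 : ℝ) 1, w t ≤ 1) ∧
      ∀ t ∈ Set.Icc (0 : ℝ) 1, Δ.schoen d w t ≤ l * w t := by
  have hn := Δ.one_le
  have hl0 : 0 < l := by linarith
  set g : ℝ → ℝ := fun t => t * (1 - t) with hg
  have g0 : ∀ t ∈ Set.Icc (0 : ℝ) 1, 0 ≤ g t := fun t ht => mul_nonneg ht.1 (by linarith [ht.2])
  have g1 : ∀ t ∈ Set.Icc (0 : ℝ) 1, |g t| ≤ 1 := fun t ht => by
    rw [abs_of_nonneg (g0 t ht)]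
    simp only [hg]; nlinarith [ht.1, ht.2]
  obtain ⟨i₀, hi₀, hmin⟩ := Finset.exists_min_image (Finset.Ioo (-(d : ℤ)) (n - 1))
    (fun j => g (Δ.greville d j)) ⟨-(d : ℤ) + 1, by simp only [Finset.mem_Ioo]; omega⟩
  have hpos : 0 < g (Δ.greville d i₀) := by
    have := Δ.mem_Ioo_of_node (by omega) hi₀
    exact mul_pos this.1 (by linarith [this.2])
  -- With ε the least value of g at an interior node, the norm bound becomes P^m g ≤ l^m g at every
  -- node.
  obtain ⟨m, hm, hpow⟩ := Δ.exists_norm_pow_le hd hγ hE hl hpos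
  set P := Δ.schoen d with hP
  have iter : ∀ i, ConcaveOn ℝ (Set.Icc 0 1) (P^[i] g) ∧ ∀ t ∈ Set.Icc (0 : ℝ) 1, 0 ≤ P^[i] g t := by
    intro i
    induction i with
    | zero => exact ⟨concaveOn_mul_one_sub, g0⟩
    | succ i ih =>
      rw [Function.iterate_succ_apply']
      exact ⟨Δ.concaveOn_schoen hd ih.1, fun t _ => Δ.schoen_nonneg d ih.2 t⟩
  have hlast : ∀ t, P (P^[m] g) t ≤ l ^ m * P g t := by
    intro t
    rw [hP, ← Δ.schoen_mul]
    refine Δ.spline_mono fun j hj _ => ?_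
    have hb := Δ.abs_iterate_schoen_le (by omega) (f := g) (by simp [hg]) (by simp [hg]) g1 m ⟨j, hj⟩
    have hends : (j ≤ -(d : ℤ) ∨ (n : ℤ) - 1 ≤ j) ∨ j ∈ Finset.Ioo (-(d : ℤ)) (n - 1) := by
      simp only [Finset.mem_Ioo]; omega
    rcases hends with h | h
    · have hz : ∀ i, P^[i] g (Δ.greville d j) = 0 := by
        intro i
        induction i with
        | zero =>
          rcases h with h | h
          · simp [hg, Δ.greville_left d h]
          · simp [hg, Δ.greville_right (d := d) (by omega) h]
        | succ i ih =>
          rw [Function.iterate_succ_apply', hP, Δ.schoen_node_eq (by omega) _ h]; exact ih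
      beta_reduce
      rw [hz m, show g (Δ.greville d j) = 0 from hz 0, mul_zero]
    · calc _ ≤ _ := le_abs_self _
        _ ≤ _ := hb
        _ ≤ _ := hpow
        _ ≤ _ := by
          rw [mul_comm]
          exact mul_le_mul_of_nonneg_left (hmin j h) (by positivity)
  -- A truncated Neumann series: l⁻¹ P w₀ = w₀ - P g + l⁻ᵐ P^{m+1} g, and `hlast` absorbs the last
  -- term into P g. The series starts at P g rather than g because P^m g ≤ l^m g is known at the
  -- nodes only; one more application of P carries it to all t.
  set w₀ : ℝ → ℝ := fun t => ∑ i ∈ Finset.range m, (l⁻¹) ^ i * P (P^[i] g) t with hw₀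
  have hw₀c : ConcaveOn ℝ (Set.Icc 0 1) w₀ := by
    have : ∀ m : ℕ, ConcaveOn ℝ (Set.Icc 0 1)
        fun t => ∑ i ∈ Finset.range m, (l⁻¹) ^ i * P (P^[i] g) t := by
      intro m
      induction m with
      | zero => simpa using concaveOn_const 0 (convex_Icc (0 : ℝ) 1)
      | succ m ih =>
        simp only [Finset.sum_range_succ]
        refine ih.add ?_
        have := (iter (m + 1)).1
        rw [Function.iterate_succ_apply'] at this
        exact this.smul (c := (l⁻¹) ^ m) (by positivity)
    exact this m
  have hterm : ∀ i t, t ∈ Set.Icc (0 : ℝ) 1 → 0 ≤ (l⁻¹) ^ i * P (P^[i] g) t := fun i t _ =>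
    mul_nonneg (by positivity) (Δ.schoen_nonneg d (iter i).2 t)
  have hw₀n : ∀ t ∈ Set.Icc (0 : ℝ) 1, 0 ≤ w₀ t := fun t ht =>
    Finset.sum_nonneg fun i _ => hterm i t ht
  have hPw : ∀ t, P w₀ t ≤ l * w₀ t := by
    intro t
    have e1 : P w₀ t = ∑ i ∈ Finset.range m, (l⁻¹) ^ i * P (P (P^[i] g)) t := by
      rw [hP, hw₀, Δ.schoen_sum]
      exact Finset.sum_congr rfl fun i _ => Δ.schoen_mul d _ _ t
    have e2 : ∑ i ∈ Finset.range (m + 1), (l⁻¹) ^ i * P (P^[i] g) t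
        = l⁻¹ * P w₀ t + P g t := by
      rw [Finset.sum_range_succ', e1, Finset.mul_sum]
      congr 1
      · refine Finset.sum_congr rfl fun i _ => ?_
        rw [Function.iterate_succ_apply', pow_succ']; ring
      · simp
    rw [Finset.sum_range_succ] at e2
    have e3 : (l⁻¹) ^ m * P (P^[m] g) t ≤ P g t := by
      calc _ ≤ (l⁻¹) ^ m * (l ^ m * P g t) := mul_le_mul_of_nonneg_left (hlast t) (by positivity)
        _ = P g t := by rw [← mul_assoc, ← mul_pow, inv_mul_cancel₀ hl0.ne', one_pow, one_mul]
    have e4 : l⁻¹ * P w₀ t ≤ w₀ t := by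
      simp only [hw₀] at e2 ⊢; linarith
    rwa [inv_mul_le_iff₀ hl0] at e4
  have hcont : ContinuousOn w₀ (Set.Icc 0 1) :=
    continuousOn_finsetSum _ fun i _ =>
      continuousOn_const.mul (Δ.continuousOn_spline (d := d) (by omega) _)
  obtain ⟨s, hs, hmax⟩ := isCompact_Icc.exists_isMaxOn (Set.nonempty_Icc.2 zero_le_one) hcont
  have hM : 0 < w₀ s := by
    obtain ⟨t, ht, htp⟩ := Δ.exists_bspline_pos (d := d) (by omega) (i := i₀)
      (by simp only [Finset.mem_Ioo, Finset.mem_Ico] at *; omega)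
    refine lt_of_lt_of_le ?_ (hmax ht)
    refine lt_of_lt_of_le ?_ (Finset.single_le_sum (fun i _ => hterm i t ht)
      (Finset.mem_range.2 hm))
    simp only [pow_zero, one_mul, Function.iterate_zero, id]
    refine lt_of_lt_of_le (mul_pos htp hpos) ?_
    have hi₁ : i₀ ∈ Finset.Ico (-(d : ℤ)) n := by
      simp only [Finset.mem_Ioo, Finset.mem_Ico] at *; omega
    exact Finset.single_le_sum (f := fun j => bspline Δ.x d j t * g (Δ.greville d j))
      (fun j _ => mul_nonneg (Δ.bspline_nonneg d j t) (g0 _ (Δ.greville_mem d j))) hi₁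
  have hc : ConcaveOn ℝ (Set.Icc 0 1) fun t => (w₀ s)⁻¹ * w₀ t := hw₀c.smul (by positivity)
  refine ⟨fun t => (w₀ s)⁻¹ * w₀ t, hc, fun t ht => ?_, fun t ht => ?_, fun t _ => ?_⟩
  · exact ConcaveOn.le_of_max hc (fun t ht => mul_nonneg (by positivity) (hw₀n t ht)) hs
      (inv_mul_cancel₀ hM.ne') ht
  · rw [inv_mul_le_one₀ hM]; exact hmax ht
  · rw [hP, Δ.schoen_mul]
    beta_reduce
    rw [mul_left_comm]
    exact mul_le_mul_of_nonneg_left (hPw t) (by positivity)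

end SplineLower

namespace SplineLower

variable {n : ℕ} (Δ : KnotSeq n)

/-! ### Mesh gauge -/

theorem KnotSeq.meshMin_le {j : ℤ} (h0 : 0 ≤ j) (h1 : j < n) :
    Δ.meshMin ≤ Δ.x (j + 1) - Δ.x j := by
  have := ciInf_le (Set.finite_range fun j : Fin n => Δ.x ((j : ℤ) + 1) - Δ.x (j : ℤ)).bddBelow
    (⟨j.toNat, by omega⟩ : Fin n)
  have e : ((j.toNat : ℕ) : ℤ) = j := Int.toNat_of_nonneg h0
  simpa [KnotSeq.meshMin, e] using this

theorem KnotSeq.meshMin_pos : 0 < Δ.meshMin := by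
  have : Nonempty (Fin n) := ⟨⟨0, Δ.one_le⟩⟩
  obtain ⟨j, hj⟩ := exists_eq_ciInf_of_finite
    (f := fun j : Fin n => Δ.x ((j : ℤ) + 1) - Δ.x (j : ℤ))
  rw [KnotSeq.meshMin, ← hj, sub_pos]
  exact Δ.lt_of_lt (by omega) (by omega) (by omega)

theorem KnotSeq.meshMin_le_sub {i j : ℤ} (hij : i < j) (hi : i < n) (hj : 0 < j) :
    Δ.meshMin ≤ Δ.x j - Δ.x i := by
  have hn := Δ.one_le
  have h := Δ.meshMin_le (j := max i 0) (by omega) (by omega)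
  have h1 : Δ.x i ≤ Δ.x (max i 0) := Δ.monotone (le_max_left _ _)
  have h2 : Δ.x (max i 0 + 1) ≤ Δ.x j := Δ.monotone (by omega)
  linarith

theorem KnotSeq.two_mul_meshMin_le_sub {i j : ℤ} (hij : i + 1 < j) (hi : i < n - 1) (hj : 1 < j)
    (hn : 2 ≤ n) : 2 * Δ.meshMin ≤ Δ.x j - Δ.x i := by
  have h := Δ.meshMin_le (j := max i 0) (by omega) (by omega)
  have h' := Δ.meshMin_le (j := max i 0 + 1) (by omega) (by omega)
  have h1 : Δ.x i ≤ Δ.x (max i 0) := Δ.monotone (le_max_left _ _)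
  have h2 : Δ.x (max i 0 + 1 + 1) ≤ Δ.x j := Δ.monotone (by omega)
  linarith

theorem KnotSeq.meshMin_div_le_width {d : ℕ} (hd : 1 ≤ d) {j : ℤ} (h1 : -(d : ℤ) < j)
    (h2 : j < n) : Δ.meshMin / d ≤ Δ.width d j := by
  rw [Δ.width_eq hd]
  gcongr
  exact Δ.meshMin_le_sub (by omega) h2 (by omega)

theorem sum_Ico_sub_pred {E : Type*} [AddCommGroup E] (f : ℤ → E) {a b : ℤ} (hab : a ≤ b) :
    ∑ j ∈ Finset.Ico a b, (f j - f (j - 1)) = f (b - 1) - f (a - 1) := by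
  induction b, hab using Int.leInduction with
  | base => simp
  | succ b hb ih =>
    have : Finset.Ico a (b + 1) = insert b (Finset.Ico a b) := by
      ext j; simp only [Finset.mem_Ico, Finset.mem_insert]; omega
    rw [this, Finset.sum_insert (by simp), ih, add_sub_cancel_right]
    abel

/-! ### Green's functions -/

section Jump

variable {E : Type*} [AddCommGroup E] [Module ℝ E]

/-- The jump of the slope of the polygon with values `c` at the Greville nodes. -/
noncomputable def KnotSeq.jump (d : ℕ) (c : ℤ → E) (j : ℤ) : E :=
  Δ.slope d c j - Δ.slope d c (j - 1)

end Jump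

/-- The Green function of the second derivative on `[0, 1]`. -/
noncomputable def green (t s : ℝ) : ℝ := min (s * (1 - t)) (t * (1 - s))

theorem concaveOn_green (t : ℝ) : ConcaveOn ℝ (Set.Icc 0 1) (green t) := by
  have h1 : ConcaveOn ℝ (Set.Icc (0 : ℝ) 1) fun s => s * (1 - t) := by
    refine ⟨convex_Icc 0 1, fun x _ y _ a b _ _ _ => le_of_eq ?_⟩
    simp only [smul_eq_mul]; ring
  have h2 : ConcaveOn ℝ (Set.Icc (0 : ℝ) 1) fun s => t * (1 - s) := by
    refine ⟨convex_Icc 0 1, fun x _ y _ a b _ _ hab => le_of_eq ?_⟩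
    simp only [smul_eq_mul]; linear_combination t * hab
  exact h1.inf h2

theorem green_nonneg {t s : ℝ} (ht : t ∈ Set.Icc (0 : ℝ) 1) (hs : s ∈ Set.Icc (0 : ℝ) 1) :
    0 ≤ green t s :=
  le_min (mul_nonneg hs.1 (sub_nonneg.2 ht.2)) (mul_nonneg ht.1 (sub_nonneg.2 hs.2))

theorem green_le {t s : ℝ} (hs : s ∈ Set.Icc (0 : ℝ) 1) :
    green t s ≤ s * (1 - s) := by
  unfold green
  rcases le_total t s with h | h
  · exact (min_le_right _ _).trans (mul_le_mul_of_nonneg_right h (sub_nonneg.2 hs.2))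
  · exact (min_le_left _ _).trans (mul_le_mul_of_nonneg_left (by linarith) hs.1)

theorem green_of_le {t s : ℝ} (h : t ≤ s) : green t s = t * (1 - s) :=
  min_eq_right (by linarith)

theorem green_of_ge {t s : ℝ} (h : s ≤ t) : green t s = s * (1 - t) :=
  min_eq_left (by linarith)

/-- Monotone iteration f ↦ Sf + G from 0. Since G ≤ ξ(1-ξ) ≤ z - Sz at the interior nodes, z bounds
all iterates and the node values converge. Each iterate is concave because S preserves concavity,
and decreasing slopes survive the limit. -/
theorem KnotSeq.exists_green {d : ℕ} (hd : 1 ≤ d) {z : ℤ → ℝ}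
    (hz0 : ∀ j ∈ Finset.Ico (-((d + 1 : ℕ) : ℤ)) n, 0 ≤ z j)
    (hz : ∀ j ∈ Finset.Ioo (-((d + 1 : ℕ) : ℤ)) (n - 1),
      Δ.greville (d + 1) j * (1 - Δ.greville (d + 1) j)
        ≤ z j - Δ.spline (d + 1) z (Δ.greville (d + 1) j))
    {G : ℝ → ℝ} (hG : ConcaveOn ℝ (Set.Icc 0 1) G) (hG0 : ∀ s ∈ Set.Icc (0 : ℝ) 1, 0 ≤ G s)
    (hG1 : ∀ s ∈ Set.Icc (0 : ℝ) 1, G s ≤ s * (1 - s)) :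
    ∃ U : ℤ → ℝ, U (-((d + 1 : ℕ) : ℤ)) = 0 ∧ U (n - 1) = 0 ∧
      (∀ j ∈ Finset.Ico (-((d + 1 : ℕ) : ℤ)) n, 0 ≤ U j ∧ U j ≤ z j) ∧
      (∀ j ∈ Finset.Ioo (-((d + 1 : ℕ) : ℤ)) (n - 1),
        U j - Δ.spline (d + 1) U (Δ.greville (d + 1) j) = G (Δ.greville (d + 1) j)) ∧
      AntitoneOn (Δ.slope (d + 1) U) (Set.Ico (-(d : ℤ)) n) := by
  have hn := Δ.one_le
  set ξ := Δ.greville (d + 1) with hξ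
  set P := Δ.schoen (d + 1) with hP
  set f : ℕ → ℝ → ℝ := fun N => Nat.rec (fun _ => 0) (fun _ g t => P g t + G t) N with hf
  have fs : ∀ N t, f (N + 1) t = P (f N) t + G t := fun N t => rfl
  have hξm := Δ.greville_mem (d + 1)
  have hG00 : G 0 = 0 := le_antisymm (by simpa using hG1 0 (by simp)) (hG0 0 (by simp))
  have hG11 : G 1 = 0 := le_antisymm (by simpa using hG1 1 (by simp)) (hG0 1 (by simp))
  have ends : ∀ j : ℤ, (j ≤ -((d + 1 : ℕ) : ℤ) ∨ (n : ℤ) - 1 ≤ j) → ∀ N, f N (ξ j) = 0 := by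
    intro j hj N
    induction N with
    | zero => rfl
    | succ N ih =>
      rw [fs, hP, Δ.schoen_node_eq (by omega) _ hj, ih, zero_add]
      rcases hj with h | h
      · rw [hξ, Δ.greville_left _ h, hG00]
      · rw [hξ, Δ.greville_right (by omega) h, hG11]
  have conc : ∀ N, ConcaveOn ℝ (Set.Icc 0 1) (f N) := by
    intro N
    induction N with
    | zero => exact concaveOn_const 0 (convex_Icc 0 1)
    | succ N ih => exact (Δ.concaveOn_schoen (by omega) ih).add hG
  have mono : ∀ N j, f N (ξ j) ≤ f (N + 1) (ξ j) := by
    intro N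
    induction N with
    | zero =>
      intro j
      rw [fs]
      exact add_nonneg (Δ.schoen_nonneg _ (fun _ _ => le_rfl) _) (hG0 _ (hξm j))
    | succ N ih =>
      intro j
      rw [fs, fs (N + 1)]
      refine add_le_add ?_ le_rfl
      exact Δ.spline_mono fun i _ _ => ih i
  have hmono : ∀ j, Monotone fun N => f N (ξ j) := fun j => monotone_nat_of_le_succ fun N => mono N j
  have cases : ∀ j ∈ Finset.Ico (-((d + 1 : ℕ) : ℤ)) n,
      (j ≤ -((d + 1 : ℕ) : ℤ) ∨ (n : ℤ) - 1 ≤ j) ∨ j ∈ Finset.Ioo (-((d + 1 : ℕ) : ℤ)) (n - 1) := by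
    intro j hj
    simp only [Finset.mem_Ico, Finset.mem_Ioo] at *; omega
  have bdd : ∀ N, ∀ j ∈ Finset.Ico (-((d + 1 : ℕ) : ℤ)) n, f N (ξ j) ≤ z j := by
    intro N
    induction N with
    | zero => exact hz0
    | succ N ih =>
      intro j hj
      rcases cases j hj with h | h
      · exact (ends j h (N + 1)).le.trans (hz0 j hj)
      · have h1 : P (f N) (ξ j) ≤ Δ.spline (d + 1) z (ξ j) := Δ.spline_mono fun i hi _ => ih i hi
        have h2 := hz j h
        have h3 := hG1 _ (hξm j)
        rw [fs]; linarith
  set U : ℤ → ℝ := fun j => ⨆ N, f N (ξ j) with hU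
  have lim : ∀ j ∈ Finset.Ico (-((d + 1 : ℕ) : ℤ)) n,
      Filter.Tendsto (fun N => f N (ξ j)) Filter.atTop (nhds (U j)) := fun j hj =>
    tendsto_atTop_ciSup (hmono j) ⟨z j, by rintro _ ⟨N, rfl⟩; exact bdd N j hj⟩
  have Uends : ∀ j : ℤ, (j ≤ -((d + 1 : ℕ) : ℤ) ∨ (n : ℤ) - 1 ≤ j) → U j = 0 := fun j hj => by
    simp only [hU, ends j hj, ciSup_const]
  have slim : ∀ t, Filter.Tendsto (fun N => P (f N) t) Filter.atTop (nhds (Δ.spline (d + 1) U t)) :=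
    fun t => tendsto_finsetSum _ fun j hj => (lim j hj).const_smul _
  refine ⟨U, Uends _ (Or.inl le_rfl), Uends _ (Or.inr le_rfl), fun j hj => ⟨?_, ?_⟩, fun j hj => ?_,
    ?_⟩
  · exact ge_of_tendsto' (lim j hj) fun N => (hmono j (Nat.zero_le N) : f 0 (ξ j) ≤ f N (ξ j))
  · exact le_of_tendsto' (lim j hj) fun N => bdd N j hj
  · have h1 : Filter.Tendsto (fun N => f (N + 1) (ξ j)) Filter.atTop (nhds (U j)) :=
      (lim j (by simp only [Finset.mem_Ico, Finset.mem_Ioo] at *; omega)).comp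
        (Filter.tendsto_add_atTop_nat 1)
    have h2 := (slim (ξ j)).add_const (G (ξ j))
    have := tendsto_nhds_unique h1 h2
    linarith
  · have sl : ∀ j ∈ Set.Ico (-(d : ℤ)) n, Filter.Tendsto
        (fun N => Δ.slope (d + 1) (fun j => f N (ξ j)) j) Filter.atTop
        (nhds (Δ.slope (d + 1) U j)) := fun j hj =>
      ((lim j (by simp only [Finset.mem_Ico, Set.mem_Ico] at *; omega)).sub
        (lim (j - 1) (by simp only [Finset.mem_Ico, Set.mem_Ico] at *; omega))).const_smul _
    intro i hi j hj hij
    refine le_of_tendsto_of_tendsto' (sl j hj) (sl i hi) fun N => ?_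
    have := Δ.monotoneOn_slope (conc N).neg hi hj hij
    have e : ∀ i, Δ.slope (d + 1) (fun j => (-f N) (Δ.greville (d + 1) j)) i
        = -Δ.slope (d + 1) (fun j => f N (ξ j)) i := fun i => by
      simp only [KnotSeq.slope, Pi.neg_apply, smul_eq_mul]; ring
    rw [e, e] at this
    exact neg_le_neg_iff.1 this

end SplineLower

/-! ### Row and column sums of the kernel of the discrete problem -/

namespace SplineLower

variable {n : ℕ} (Δ : KnotSeq n)

/-- `F i` solves the discrete problem with the right-hand side that belongs to the indicator of
the `i`-th Greville cell. -/
structure KnotSeq.IsKernel (d : ℕ) (F : ℤ → ℤ → ℝ) : Prop where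
  left : ∀ i ∈ Finset.Ico (-(d : ℤ)) n, F i (-((d + 1 : ℕ) : ℤ)) = 0
  right : ∀ i ∈ Finset.Ico (-(d : ℤ)) n, F i (n - 1) = 0
  eq : ∀ i ∈ Finset.Ico (-(d : ℤ)) n, ∀ j ∈ Finset.Ioo (-((d + 1 : ℕ) : ℤ)) (n - 1),
    F i j - Δ.spline (d + 1) (F i) (Δ.greville (d + 1) j)
      = Δ.width (d + 1) i * ((if i ≤ j then 1 else 0) - Δ.greville (d + 1) j)

variable {Δ} {d : ℕ}

/-- All jumps are nonpositive, so the sum telescopes to the first slope minus the last. As U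
vanishes at the ends, either one is in modulus at most Z divided by the least possible cell width
meshMin/(d+1). -/
theorem KnotSeq.sum_abs_jump_le {U : ℤ → ℝ} {Z : ℝ} (h0 : U (-((d + 1 : ℕ) : ℤ)) = 0)
    (h1 : U (n - 1) = 0)
    (hU : ∀ j ∈ Finset.Ico (-((d + 1 : ℕ) : ℤ)) n, 0 ≤ U j ∧ U j ≤ Z)
    (hm : AntitoneOn (Δ.slope (d + 1) U) (Set.Ico (-(d : ℤ)) n)) :
    ∑ j ∈ Finset.Ico (-(d : ℤ) + 1) n, |Δ.jump (d + 1) U j| ≤ 2 * Z * (d + 1) / Δ.meshMin := by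
  have hn := Δ.one_le
  have hmp := Δ.meshMin_pos
  have key : ∀ j ∈ Finset.Ico (-(d : ℤ)) n, ∀ y, 0 ≤ y → y ≤ Z →
      (Δ.width (d + 1) j)⁻¹ * y ≤ Z * (d + 1) / Δ.meshMin := by
    intro j hj y hy0 hy
    simp only [Finset.mem_Ico] at hj
    have hw := Δ.meshMin_div_le_width (d := d + 1) (j := j) (by omega) (by push_cast; omega) hj.2
    have hw2 : (Δ.width (d + 1) j)⁻¹ ≤ (Δ.meshMin / (d + 1 : ℕ))⁻¹ :=
      inv_anti₀ (by positivity) hw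
    calc _ ≤ (Δ.meshMin / (d + 1 : ℕ))⁻¹ * Z :=
          mul_le_mul hw2 hy hy0 (by positivity)
      _ = _ := by push_cast; rw [inv_div]; ring
  have e : ∑ j ∈ Finset.Ico (-(d : ℤ) + 1) n, |Δ.jump (d + 1) U j|
      = -∑ j ∈ Finset.Ico (-(d : ℤ) + 1) n, (Δ.slope (d + 1) U j - Δ.slope (d + 1) U (j - 1)) := by
    rw [← Finset.sum_neg_distrib]
    refine Finset.sum_congr rfl fun j hj => ?_
    simp only [Finset.mem_Ico] at hj
    exact abs_of_nonpos (sub_nonpos.2 (hm ⟨by omega, by omega⟩ ⟨by omega, by omega⟩ (by omega)))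
  rw [e, sum_Ico_sub_pred _ (by omega), add_sub_cancel_right]
  have a1 := key (-(d : ℤ)) (by simp only [Finset.mem_Ico]; omega) (U (-(d : ℤ)))
    (hU _ (by simp only [Finset.mem_Ico]; omega)).1
    (hU _ (by simp only [Finset.mem_Ico]; omega)).2
  have a2 := key (n - 1) (by simp only [Finset.mem_Ico]; omega) (U (n - 1 - 1))
    (hU _ (by simp only [Finset.mem_Ico]; omega)).1
    (hU _ (by simp only [Finset.mem_Ico]; omega)).2
  have e1 : Δ.slope (d + 1) U (-(d : ℤ)) = (Δ.width (d + 1) (-(d : ℤ)))⁻¹ * U (-(d : ℤ)) := by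
    rw [KnotSeq.slope, show (-(d : ℤ) - 1) = -((d + 1 : ℕ) : ℤ) by push_cast; ring, h0, sub_zero,
      smul_eq_mul]
  have e2 : Δ.slope (d + 1) U (n - 1) = -((Δ.width (d + 1) (n - 1))⁻¹ * U (n - 1 - 1)) := by
    rw [KnotSeq.slope, h1, zero_sub, smul_eq_mul, mul_neg]
  rw [e1, e2]
  have : 2 * Z * (d + 1) / Δ.meshMin = Z * (d + 1) / Δ.meshMin + Z * (d + 1) / Δ.meshMin := by ring
  linarith

theorem KnotSeq.jump_sub (d : ℕ) (c c' : ℤ → ℝ) (j : ℤ) :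
    Δ.jump d (fun j => c j - c' j) j = Δ.jump d c j - Δ.jump d c' j := by
  simp only [KnotSeq.jump, KnotSeq.slope, smul_eq_mul]; ring

/-- The kernel is a difference of two solutions whose data are the Green functions with poles ξ_i
and ξ_{i-1}; at ξ_j these data differ by the cell width times (1 or 0) - ξ_j. Each solution
contributes 2Z(d+1)/meshMin to the column sum. -/
theorem KnotSeq.exists_kernel (Δ : KnotSeq n) (hd : 1 ≤ d) {z : ℤ → ℝ} {Z : ℝ}
    (hz0 : ∀ j ∈ Finset.Ico (-((d + 1 : ℕ) : ℤ)) n, 0 ≤ z j ∧ z j ≤ Z)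
    (hz : ∀ j ∈ Finset.Ioo (-((d + 1 : ℕ) : ℤ)) (n - 1),
      Δ.greville (d + 1) j * (1 - Δ.greville (d + 1) j)
        ≤ z j - Δ.spline (d + 1) z (Δ.greville (d + 1) j)) :
    ∃ F : ℤ → ℤ → ℝ, Δ.IsKernel d F ∧ ∀ i, ∑ j ∈ Finset.Ico (-(d : ℤ) + 1) n,
      |Δ.jump (d + 1) (F i) j| ≤ 4 * Z * (d + 1) / Δ.meshMin := by
  have H : ∀ i : ℤ, ∃ U : ℤ → ℝ, _ := fun i => Δ.exists_green hd (fun j hj => (hz0 j hj).1) hz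
    (concaveOn_green (Δ.greville (d + 1) i)) (fun s hs => green_nonneg (Δ.greville_mem _ i) hs)
    (fun s hs => green_le hs)
  choose U hU0 hU1 hUb hUe hUm using H
  refine ⟨fun i j => U i j - U (i - 1) j, ⟨fun i _ => ?_, fun i _ => ?_, fun i _ j hj => ?_⟩,
    fun i => ?_⟩
  · rw [hU0, hU0, sub_zero]
  · rw [hU1, hU1, sub_zero]
  · rw [Δ.spline_sub, KnotSeq.width]
    have h1 := hUe i j hj
    have h2 := hUe (i - 1) j hj
    have hm := Δ.greville_mono (d + 1)
    split_ifs with h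
    · rw [green_of_le (hm h)] at h1
      rw [green_of_le (hm (by omega))] at h2
      linear_combination h1 - h2
    · rw [green_of_ge (hm (by omega))] at h1
      rw [green_of_ge (hm (by omega))] at h2
      linear_combination h1 - h2
  · have h1 := Δ.sum_abs_jump_le (hU0 i) (hU1 i)
      (fun j hj => ⟨(hUb i j hj).1, (hUb i j hj).2.trans (hz0 j hj).2⟩) (hUm i)
    have h2 := Δ.sum_abs_jump_le (hU0 (i - 1)) (hU1 (i - 1))
      (fun j hj => ⟨(hUb (i - 1) j hj).1, (hUb (i - 1) j hj).2.trans (hz0 j hj).2⟩) (hUm (i - 1))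
    calc _ ≤ ∑ j ∈ Finset.Ico (-(d : ℤ) + 1) n,
          (|Δ.jump (d + 1) (U i) j| + |Δ.jump (d + 1) (U (i - 1)) j|) :=
          Finset.sum_le_sum fun j _ => by rw [KnotSeq.jump_sub]; exact abs_sub _ _
      _ ≤ _ := by
        rw [Finset.sum_add_distrib]
        refine (add_le_add h1 h2).trans (le_of_eq ?_)
        ring

theorem KnotSeq.spline_sum {E : Type*} [AddCommGroup E] [Module ℝ E] {ι : Type*} (d : ℕ)
    (s : Finset ι) (c : ι → ℤ → E) (t : ℝ) :
    Δ.spline d (fun j => ∑ i ∈ s, c i j) t = ∑ i ∈ s, Δ.spline d (c i) t := by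
  simp only [KnotSeq.spline, Finset.smul_sum]
  exact Finset.sum_comm

theorem KnotSeq.spline_smul_const {E : Type*} [AddCommGroup E] [Module ℝ E] (d : ℕ)
    (c : ℤ → ℝ) (b : E) (t : ℝ) :
    Δ.spline d (fun j => c j • b) t = Δ.spline d c t • b := by
  simp only [KnotSeq.spline, Finset.sum_smul, smul_smul, smul_eq_mul]

/-- By uniqueness, c is the superposition of the kernels with weights b. The condition `hb` cancels
the terms -ξ_j in the data of the kernels, so that only the partial sums remain. -/
theorem KnotSeq.IsKernel.jump_eq {F : ℤ → ℤ → ℝ} (hF : Δ.IsKernel d F) (hd : 1 ≤ d)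
    {b c : ℤ → ℂ} (hb : ∑ i ∈ Finset.Ico (-(d : ℤ)) n, Δ.width (d + 1) i • b i = 0)
    (c0 : c (-((d + 1 : ℕ) : ℤ)) = 0) (c1 : c (n - 1) = 0)
    (hc : ∀ j ∈ Finset.Ioo (-((d + 1 : ℕ) : ℤ)) (n - 1),
      c j - Δ.spline (d + 1) c (Δ.greville (d + 1) j)
        = ∑ i ∈ Finset.Ico (-(d : ℤ)) (j + 1), Δ.width (d + 1) i • b i)
    {j : ℤ} (hj : j ∈ Finset.Ico (-(d : ℤ) + 1) n) :
    Δ.jump (d + 1) c j = ∑ i ∈ Finset.Ico (-(d : ℤ)) n, Δ.jump (d + 1) (F i) j • b i := by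
  have key := Δ.eq_zero_of_fixed (d := d + 1)
    (c := fun j => c j - ∑ i ∈ Finset.Ico (-(d : ℤ)) n, F i j • b i) (by omega)
    (by
      rw [c0, Finset.sum_eq_zero fun i hi => ?_, sub_zero]
      rw [hF.left i hi, zero_smul])
    (by
      rw [c1, Finset.sum_eq_zero fun i hi => ?_, sub_zero]
      rw [hF.right i hi, zero_smul])
    (fun l hl => by
      rw [Δ.spline_sub, Δ.spline_sum]
      simp only [KnotSeq.spline_smul_const]
      have h1 := hc l hl
      have h2 : ∑ i ∈ Finset.Ico (-(d : ℤ)) n,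
          (F i l • b i - Δ.spline (d + 1) (F i) (Δ.greville (d + 1) l) • b i)
          = ∑ i ∈ Finset.Ico (-(d : ℤ)) (l + 1), Δ.width (d + 1) i • b i := by
        have h3 : ∀ i ∈ Finset.Ico (-(d : ℤ)) n,
            (F i l • b i - Δ.spline (d + 1) (F i) (Δ.greville (d + 1) l) • b i)
            = (if i ≤ l then Δ.width (d + 1) i • b i else 0)
              - Δ.greville (d + 1) l • (Δ.width (d + 1) i • b i) := by
          intro i hi
          rw [← sub_smul, hF.eq i hi l hl]
          split_ifs <;> module
        rw [Finset.sum_congr rfl h3, Finset.sum_sub_distrib, ← Finset.smul_sum, hb, smul_zero,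
          sub_zero, ← Finset.sum_filter]
        refine Finset.sum_congr ?_ fun _ _ => rfl
        ext i
        simp only [Finset.mem_filter, Finset.mem_Ico, Finset.mem_Ioo] at *
        omega
      rw [Finset.sum_sub_distrib] at h2
      linear_combination h2 - h1)
  have e : ∀ l ∈ Finset.Ico (-((d + 1 : ℕ) : ℤ)) n,
      c l = ∑ i ∈ Finset.Ico (-(d : ℤ)) n, F i l • b i := fun l hl => sub_eq_zero.1 (key l hl)
  simp only [Finset.mem_Ico] at hj
  simp only [KnotSeq.jump, KnotSeq.slope]
  rw [e j (by simp only [Finset.mem_Ico]; omega), e (j - 1) (by simp only [Finset.mem_Ico]; omega),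
    e (j - 1 - 1) (by simp only [Finset.mem_Ico]; omega)]
  simp only [Finset.smul_sum, ← Finset.sum_sub_distrib]
  refine Finset.sum_congr rfl fun i _ => ?_
  simp only [smul_eq_mul]
  module

/-- The right-hand sides of a kernel sum up, in absolute value, to `2 ξ (1 - ξ)`. -/
theorem KnotSeq.sum_abs_cell (Δ : KnotSeq n) (d : ℕ) {j : ℤ} (h1 : -((d + 1 : ℕ) : ℤ) ≤ j)
    (h2 : j < n) :
    ∑ i ∈ Finset.Ico (-(d : ℤ)) n,
      |Δ.width (d + 1) i * ((if i ≤ j then 1 else 0) - Δ.greville (d + 1) j)|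
      = 2 * (Δ.greville (d + 1) j * (1 - Δ.greville (d + 1) j)) := by
  have hn := Δ.one_le
  have hm := Δ.greville_mem (d + 1) j
  have hw : ∀ i ∈ Finset.Ico (-(d : ℤ)) n, 0 ≤ Δ.width (d + 1) i := fun i hi => by
    simp only [Finset.mem_Ico] at hi
    exact (Δ.width_pos (by omega) (by push_cast; omega) hi.2).le
  push_cast at h1
  rw [← Finset.Ico_union_Ico_eq_Ico (by omega : -(d : ℤ) ≤ j + 1) (by omega : j + 1 ≤ (n : ℤ)),
    Finset.sum_union (Finset.Ico_disjoint_Ico_consecutive _ _ _)]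
  rw [Finset.sum_congr rfl (g := fun i => (Δ.greville (d + 1) i - Δ.greville (d + 1) (i - 1))
    * (1 - Δ.greville (d + 1) j)), Finset.sum_congr (s₁ := Finset.Ico (j + 1) n) rfl
    (g := fun i => (Δ.greville (d + 1) i - Δ.greville (d + 1) (i - 1)) * Δ.greville (d + 1) j),
    ← Finset.sum_mul, ← Finset.sum_mul, sum_Ico_sub_pred _ (by omega), sum_Ico_sub_pred _ (by omega),
    Δ.greville_right (d := d + 1) (by omega) (j := n - 1) le_rfl,
    Δ.greville_left (d + 1) (j := -(d : ℤ) - 1) (by push_cast; omega), add_sub_cancel_right]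
  · ring
  · intro i hi
    have hi' := Finset.mem_Ico.1 hi
    rw [if_neg (by omega), abs_mul, abs_of_nonneg (hw i (by simp only [Finset.mem_Ico]; omega)),
      zero_sub, abs_neg, abs_of_nonneg hm.1]
    rfl
  · intro i hi
    have hi' := Finset.mem_Ico.1 hi
    rw [if_pos (by omega), abs_mul, abs_of_nonneg (hw i (by simp only [Finset.mem_Ico]; omega)),
      abs_of_nonneg (sub_nonneg.2 hm.2)]
    rfl

/-- Rows of the kernel: `R` bounds the slopes of every polygon dominated by `2 z`. -/
theorem KnotSeq.IsKernel.sum_abs_jump_le {F : ℤ → ℤ → ℝ} (hF : Δ.IsKernel d F) (hd : 1 ≤ d)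
    {z : ℤ → ℝ} {Z R : ℝ} (hz0 : ∀ j ∈ Finset.Ico (-((d + 1 : ℕ) : ℤ)) n, 0 ≤ z j ∧ z j ≤ Z)
    (hz : ∀ j ∈ Finset.Ioo (-((d + 1 : ℕ) : ℤ)) (n - 1),
      Δ.greville (d + 1) j * (1 - Δ.greville (d + 1) j)
        ≤ z j - Δ.spline (d + 1) z (Δ.greville (d + 1) j))
    (hR : ∀ c : ℤ → ℝ, c (-((d + 1 : ℕ) : ℤ)) = 0 → c (n - 1) = 0 →
      (∀ j ∈ Finset.Ico (-((d + 1 : ℕ) : ℤ)) n, |c j| ≤ 2 * Z) →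
      ∀ j ∈ Finset.Ico (-(d : ℤ)) n, |Δ.slope (d + 1) c j| ≤ R)
    {j : ℤ} (hj : j ∈ Finset.Ico (-(d : ℤ) + 1) n) :
    ∑ i ∈ Finset.Ico (-(d : ℤ)) n, |Δ.jump (d + 1) (F i) j| ≤ 2 * R := by
  -- Duality: superposing the kernels with the signs of their jumps at j turns the absolute row sum
  -- into the jump at j of one polygon, and the comparison principle bounds that polygon by 2z.
  set c : ℤ → ℝ := fun l => ∑ i ∈ Finset.Ico (-(d : ℤ)) n, F i l * SignType.sign (Δ.jump (d + 1) (F i) j)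
    with hc
  have c0 : c (-((d + 1 : ℕ) : ℤ)) = 0 := Finset.sum_eq_zero fun i hi => by
    rw [hF.left i hi, zero_mul]
  have c1 : c (n - 1) = 0 := Finset.sum_eq_zero fun i hi => by
    rw [hF.right i hi, zero_mul]
  have hs : ∀ x : ℝ, |((SignType.sign x : SignType) : ℝ)| ≤ 1 := fun x => by
    rcases lt_trichotomy x 0 with h | h | h
    · simp [sign_neg h]
    · simp [h]
    · simp [sign_pos h]
  have hpos : ∀ i ∈ Finset.Ioo (-((d + 1 : ℕ) : ℤ)) (n - 1),
      0 < Δ.greville (d + 1) i * (1 - Δ.greville (d + 1) i) := fun i hi => by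
    have := Δ.mem_Ioo_of_node (by omega) hi
    exact mul_pos this.1 (by linarith [this.2])
  have e2 : ∀ t, Δ.spline (d + 1) (fun j => 2 * z j) t = 2 * Δ.spline (d + 1) z t := fun t => by
    simpa only [smul_eq_mul] using Δ.spline_smul (d + 1) (2 : ℝ) z t
  have hcz := Δ.norm_le_of_supersolution (d := d + 1) (F := c) (z := fun j => 2 * z j) c0 c1
    (fun j hj => mul_nonneg zero_le_two (hz0 j hj).1)
    (fun i hi => by rw [e2]; linarith [hz i hi, hpos i hi])
    (fun l hl => by
      have e1 : c l - Δ.spline (d + 1) c (Δ.greville (d + 1) l)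
          = ∑ i ∈ Finset.Ico (-(d : ℤ)) n,
            (Δ.width (d + 1) i * ((if i ≤ l then 1 else 0) - Δ.greville (d + 1) l))
              * SignType.sign (Δ.jump (d + 1) (F i) j) := by
        rw [hc, Δ.spline_sum, ← Finset.sum_sub_distrib]
        refine Finset.sum_congr rfl fun i hi => ?_
        rw [← hF.eq i hi l hl, sub_mul]
        congr 1
        exact Δ.spline_smul_const (d + 1) (F i) _ _
      rw [e1, e2, Real.norm_eq_abs]
      refine (Finset.abs_sum_le_sum_abs _ _).trans ?_
      have hl' := Finset.mem_Ioo.1 hl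
      have h3 := Δ.sum_abs_cell d (j := l) (by omega) (by omega)
      have h4 : ∑ i ∈ Finset.Ico (-(d : ℤ)) n,
            |(Δ.width (d + 1) i * ((if i ≤ l then 1 else 0) - Δ.greville (d + 1) l))
              * SignType.sign (Δ.jump (d + 1) (F i) j)|
          ≤ ∑ i ∈ Finset.Ico (-(d : ℤ)) n,
      |Δ.width (d + 1) i * ((if i ≤ l then 1 else 0) - Δ.greville (d + 1) l)| := by
        refine Finset.sum_le_sum fun i _ => ?_
        rw [abs_mul]
        exact mul_le_of_le_one_right (abs_nonneg _) (hs _)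
      linarith [hz l hl])
  have hsl := hR c c0 c1 fun l hl => by
    have h1 := hcz l hl
    rw [Real.norm_eq_abs] at h1
    linarith [(hz0 l hl).2]
  simp only [Finset.mem_Ico] at hj
  have h1 := hsl j (by simp only [Finset.mem_Ico]; omega)
  have h2 := hsl (j - 1) (by simp only [Finset.mem_Ico]; omega)
  have h3 : Δ.jump (d + 1) c j = ∑ i ∈ Finset.Ico (-(d : ℤ)) n, |Δ.jump (d + 1) (F i) j| := by
    simp only [← self_mul_sign]
    simp only [KnotSeq.jump, KnotSeq.slope, hc, smul_eq_mul, ← Finset.sum_sub_distrib,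
      Finset.mul_sum]
    refine Finset.sum_congr rfl fun i _ => ?_
    ring
  rw [← h3]
  have h4 := abs_sub (Δ.slope (d + 1) c j) (Δ.slope (d + 1) c (j - 1))
  have h5 := le_abs_self (Δ.jump (d + 1) c j)
  unfold KnotSeq.jump at *
  linarith

theorem KnotSeq.abs_slope_le (hd : 1 ≤ d) {c : ℤ → ℝ} {M : ℝ}
    (hM : ∀ j ∈ Finset.Ico (-((d + 1 : ℕ) : ℤ)) n, |c j| ≤ M)
    {j : ℤ} (hj : j ∈ Finset.Ico (-(d : ℤ)) n) :
    |Δ.slope (d + 1) c j| ≤ 2 * (M * (d + 1) / Δ.meshMin) := by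
  have hmp := Δ.meshMin_pos
  have hj' := Finset.mem_Ico.1 hj
  have hw := Δ.meshMin_div_le_width (d := d + 1) (j := j) (by omega) (by push_cast; omega) hj'.2
  push_cast at hw
  rw [div_le_iff₀ (by positivity)] at hw
  have hwp := Δ.width_pos (d := d + 1) (j := j) (by omega) (by push_cast; omega) hj'.2
  have h1 := hM j (by simp only [Finset.mem_Ico]; omega)
  have h2 := hM (j - 1) (by simp only [Finset.mem_Ico]; omega)
  rw [KnotSeq.slope, smul_eq_mul, abs_mul, abs_inv, abs_of_pos hwp, inv_mul_le_iff₀ hwp,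
    mul_comm (Δ.width _ _), ← mul_div_assoc, div_mul_eq_mul_div, le_div_iff₀ hmp]
  have h3 := abs_sub (c j) (c (j - 1))
  have h0 := (abs_nonneg _).trans h1
  nlinarith

/-- This saves the factor 2 of `KnotSeq.abs_slope_le`: on the first and the last cell one of the two
values is zero, and for every other cell x_{j+d+1} - x_j spans at least two knot intervals. -/
theorem KnotSeq.abs_slope_le_of_two_le (hd : 1 ≤ d) (hn : 2 ≤ n) {c : ℤ → ℝ} {M : ℝ}
    (c0 : c (-((d + 1 : ℕ) : ℤ)) = 0) (c1 : c (n - 1) = 0)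
    (hM : ∀ j ∈ Finset.Ico (-((d + 1 : ℕ) : ℤ)) n, |c j| ≤ M)
    {j : ℤ} (hj : j ∈ Finset.Ico (-(d : ℤ)) n) :
    |Δ.slope (d + 1) c j| ≤ M * (d + 1) / Δ.meshMin := by
  have hmp := Δ.meshMin_pos
  have hj' := Finset.mem_Ico.1 hj
  have hwp := Δ.width_pos (d := d + 1) (j := j) (by omega) (by push_cast; omega) hj'.2
  have h1 := hM j (by simp only [Finset.mem_Ico]; omega)
  have h2 := hM (j - 1) (by simp only [Finset.mem_Ico]; omega)
  have h3 := abs_sub (c j) (c (j - 1))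
  have h0 := (abs_nonneg _).trans h1
  rw [KnotSeq.slope, smul_eq_mul, abs_mul, abs_inv, abs_of_pos hwp, inv_mul_le_iff₀ hwp,
    mul_comm (Δ.width _ _), div_mul_eq_mul_div, le_div_iff₀ hmp]
  have hw := Δ.meshMin_div_le_width (d := d + 1) (j := j) (by omega) (by push_cast; omega) hj'.2
  push_cast at hw
  rw [div_le_iff₀ (by positivity)] at hw
  by_cases ha : j = -(d : ℤ)
  · have : c (j - 1) = 0 := by
      rw [ha, show (-(d : ℤ) - 1) = -((d + 1 : ℕ) : ℤ) by push_cast; ring, c0]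
    rw [this, sub_zero]
    nlinarith
  by_cases hb : j = n - 1
  · rw [hb] at h2 hw hwp ⊢
    rw [c1, zero_sub, abs_neg]
    nlinarith
  have h5 := Δ.two_mul_meshMin_le_sub (i := j) (j := j + (d + 1 : ℕ)) (by push_cast; omega) (by omega)
    (by push_cast; omega) hn
  have h6 := Δ.width_eq (d := d + 1) (by omega) j
  rw [eq_div_iff (by positivity)] at h6
  push_cast at h6 h5
  have h7 : 2 * Δ.meshMin ≤ Δ.width (d + 1) j * (d + 1) := by rw [h6]; exact h5
  nlinarith

end SplineLower

/-! ### From supersolutions to kernel bounds -/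

namespace SplineLower

variable {n : ℕ} (Δ : KnotSeq n) {d : ℕ}

/-- Bounds for the rows and the columns of a kernel. -/
def KnotSeq.KernelBound (d : ℕ) (C : ℝ) : Prop :=
  ∃ F : ℤ → ℤ → ℝ, Δ.IsKernel d F ∧
    (∀ j ∈ Finset.Ico (-(d : ℤ) + 1) n,
      ∑ i ∈ Finset.Ico (-(d : ℤ)) n, |Δ.jump (d + 1) (F i) j| ≤ C * Δ.width d j) ∧
    ∀ i ∈ Finset.Ico (-(d : ℤ)) n,
      ∑ j ∈ Finset.Ico (-(d : ℤ) + 1) n, |Δ.jump (d + 1) (F i) j| ≤ C * Δ.width (d + 1) i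

variable {Δ}

theorem KnotSeq.KernelBound.mono {C C' : ℝ} (hd : 1 ≤ d) (h : Δ.KernelBound d C) (hC : C ≤ C') :
    Δ.KernelBound d C' := by
  obtain ⟨F, h1, h2, h3⟩ := h
  refine ⟨F, h1, fun j hj => (h2 j hj).trans ?_, fun i hi => (h3 i hi).trans ?_⟩
  · simp only [Finset.mem_Ico] at hj
    exact mul_le_mul_of_nonneg_right hC (Δ.width_pos hd (by omega) hj.2).le
  · simp only [Finset.mem_Ico] at hi
    exact mul_le_mul_of_nonneg_right hC
      (Δ.width_pos (d := d + 1) (by omega) (by push_cast; omega) hi.2).le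

/-- A supersolution bounded by `Z` at the Greville nodes of degree `d`. -/
def KnotSeq.HasSupersolution (Δ : KnotSeq n) (d : ℕ) (Z : ℝ) : Prop :=
  ∃ z : ℤ → ℝ, (∀ j ∈ Finset.Ico (-(d : ℤ)) n, 0 ≤ z j ∧ z j ≤ Z) ∧
    ∀ j ∈ Finset.Ioo (-(d : ℤ)) (n - 1), Δ.greville d j * (1 - Δ.greville d j)
      ≤ z j - Δ.spline d z (Δ.greville d j)

/-- The two conditions on C compare the row bound 2R and the column bound 4Z(d+1)/meshMin with the
least cell widths meshMin/d and meshMin/(d+1). -/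
theorem KnotSeq.HasSupersolution.kernelBound {Z R C : ℝ} (hZ : Δ.HasSupersolution (d + 1) Z)
    (hd : 1 ≤ d)
    (hR : ∀ c : ℤ → ℝ, c (-((d + 1 : ℕ) : ℤ)) = 0 → c (n - 1) = 0 →
      (∀ j ∈ Finset.Ico (-((d + 1 : ℕ) : ℤ)) n, |c j| ≤ 2 * Z) →
      ∀ j ∈ Finset.Ico (-(d : ℤ)) n, |Δ.slope (d + 1) c j| ≤ R)
    (h1 : 2 * R * d ≤ C * Δ.meshMin) (h2 : 4 * Z * (d + 1) ^ 2 ≤ C * Δ.meshMin ^ 2) :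
    Δ.KernelBound d C := by
  obtain ⟨z, hz0, hz⟩ := hZ
  obtain ⟨F, hF, hcol⟩ := Δ.exists_kernel hd hz0 hz
  have hmp := Δ.meshMin_pos
  have hd0 : (0 : ℝ) < d := by positivity
  have hZ0 : 0 ≤ Z := by
    have hn := Δ.one_le
    have := hz0 (n - 1) (by simp only [Finset.mem_Ico]; push_cast; omega)
    linarith
  have hC : 0 ≤ C := by
    by_contra hC
    have : 0 ≤ 4 * Z * ((d : ℝ) + 1) ^ 2 := by positivity
    nlinarith [pow_pos hmp 2]
  refine ⟨F, hF, fun j hj => ?_, fun i hi => (hcol i).trans ?_⟩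
  · refine (hF.sum_abs_jump_le hd hz0 hz hR hj).trans ?_
    simp only [Finset.mem_Ico] at hj
    have hw := Δ.meshMin_div_le_width (d := d) (j := j) hd (by omega) hj.2
    refine le_trans ?_ (mul_le_mul_of_nonneg_left hw hC)
    rw [← mul_div_assoc, le_div_iff₀ hd0]
    exact h1
  · simp only [Finset.mem_Ico] at hi
    have hw := Δ.meshMin_div_le_width (d := d + 1) (j := i) (by omega) (by push_cast; omega) hi.2
    refine le_trans ?_ (mul_le_mul_of_nonneg_left hw hC)
    push_cast
    rw [← mul_div_assoc, div_le_div_iff₀ hmp (by positivity)]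
    linarith

theorem KnotSeq.meshMin_eq_one (Δ : KnotSeq n) (hn : n = 1) : Δ.meshMin = 1 := by
  subst hn
  simp [KnotSeq.meshMin, Δ.eq_zero 0 le_rfl, Δ.eq_one 1 (by simp)]

/-- Without interior knots the window of every interior node is [0, 1], so
`KnotSeq.le_quadratic_sub` shows that (d+1)²ξ(1-ξ) is a supersolution; it is at most (d+1)²/4. -/
theorem KnotSeq.kernelBound_of_eq_one {C : ℝ} (hn : n = 1) (hd : 1 ≤ d)
    (hC : 2 * d * ((d : ℝ) + 1) ^ 3 ≤ C) : Δ.KernelBound d C := by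
  have hm := Δ.meshMin_eq_one hn
  have hd1 : (1 : ℝ) ≤ d := by exact_mod_cast hd
  have hs : Δ.HasSupersolution (d + 1) (((d : ℝ) + 1) ^ 2 / 4) := by
    refine ⟨fun j => ((d : ℝ) + 1) ^ 2 * (Δ.greville (d + 1) j * (1 - Δ.greville (d + 1) j)),
      fun j _ => ⟨?_, ?_⟩, fun j hj => ?_⟩
    · have := Δ.greville_mem (d + 1) j
      exact mul_nonneg (by positivity) (mul_nonneg this.1 (sub_nonneg.2 this.2))
    · nlinarith [sq_nonneg (Δ.greville (d + 1) j - 1 / 2),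
        mul_nonneg (sq_nonneg ((d : ℝ) + 1)) (sq_nonneg (Δ.greville (d + 1) j - 1 / 2))]
    · have e := Δ.spline_smul (d + 1) (((d : ℝ) + 1) ^ 2)
        (fun j => Δ.greville (d + 1) j * (1 - Δ.greville (d + 1) j)) (Δ.greville (d + 1) j)
      simp only [smul_eq_mul] at e
      rw [e, ← mul_sub]
      simp only [Finset.mem_Ioo] at hj
      push_cast at hj
      have := Δ.le_quadratic_sub hd (i := j) (by omega) (by omega)
      rw [Δ.eq_zero (j + 1) (by omega), Δ.eq_one (j + d + 1) (by omega),
        div_le_iff₀ (by positivity)] at this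
      linarith
  refine hs.kernelBound hd (R := 2 * (2 * (((d : ℝ) + 1) ^ 2 / 4) * (d + 1) / Δ.meshMin))
    (fun c _ _ hc j hj => Δ.abs_slope_le hd hc hj) ?_ ?_
  · rw [hm]
    have : 2 * (2 * (2 * (((d : ℝ) + 1) ^ 2 / 4) * (d + 1) / 1)) * d
        = 2 * d * ((d : ℝ) + 1) ^ 3 := by ring
    linarith
  · rw [hm]
    have : 0 ≤ ((d : ℝ) + 1) ^ 3 * (d - 1) := mul_nonneg (by positivity) (by linarith)
    nlinarith

theorem KnotSeq.HasSupersolution.kernelBound_of_two_le {Z : ℝ}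
    (hZ : Δ.HasSupersolution (d + 1) Z) (hn : 2 ≤ n) (hd : 1 ≤ d) :
    Δ.KernelBound d (4 * Z * (d + 1) ^ 2 / Δ.meshMin ^ 2) := by
  have hmp := Δ.meshMin_pos
  have hZ0 : 0 ≤ Z := by
    obtain ⟨z, hz0, -⟩ := hZ
    have := hz0 (n - 1) (by simp only [Finset.mem_Ico]; push_cast; omega)
    linarith
  refine hZ.kernelBound hd (R := 2 * Z * (d + 1) / Δ.meshMin)
    (fun c c0 c1 hc j hj => Δ.abs_slope_le_of_two_le hd hn c0 c1 hc hj) ?_ ?_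
  · rw [show 4 * Z * ((d : ℝ) + 1) ^ 2 / Δ.meshMin ^ 2 * Δ.meshMin
      = 4 * Z * ((d : ℝ) + 1) ^ 2 / Δ.meshMin by field_simp,
      show 2 * (2 * Z * ((d : ℝ) + 1) / Δ.meshMin) * d
      = 4 * Z * ((d + 1) * d) / Δ.meshMin by ring]
    gcongr
    nlinarith
  · rw [div_mul_cancel₀ _ (by positivity)]

variable (Δ)

/-- The supersolution is w/(1-l) with 1 - l = (1-γ)/D. Since D > 1, this l exceeds γ, as the
construction of w requires. -/
theorem KnotSeq.hasSupersolution_of_eigenBound_succ {γ D : ℝ} (hd : 1 ≤ d) (hγ : 0 ≤ γ) (hγ1 : γ < 1)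
    (hD : 2 * ((d : ℝ) + 1) ^ 2 / d < D) (hE : Δ.EigenBound (d + 1) γ) :
    Δ.HasSupersolution (d + 1) (D / (1 - γ)) := by
  have hd0 : (1 : ℝ) ≤ d := by exact_mod_cast hd
  have hD1 : 1 < D := lt_of_le_of_lt (by rw [le_div_iff₀ (by positivity)]; nlinarith) hD
  have hg : 0 < 1 - γ := by linarith
  set l := 1 - (1 - γ) / D with hl
  have e : 1 - l = (1 - γ) / D := by rw [hl]; ring
  have hp : 0 < 1 - l := by rw [e]; positivity
  have hγl : γ < l := by
    have : (1 - γ) / D < 1 - γ := by rw [div_lt_iff₀ (by linarith)]; nlinarith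
    linarith
  obtain ⟨w, -, h1, h2, h3⟩ := Δ.exists_concave_supersolution (d := d + 1) (by omega) hγ hE hγl
  refine ⟨fun j => (1 - l)⁻¹ * w (Δ.greville (d + 1) j), fun j _ => ⟨?_, ?_⟩, fun j _ => ?_⟩
  · have hm := Δ.greville_mem (d + 1) j
    exact mul_nonneg (inv_nonneg.2 hp.le)
      ((mul_nonneg hm.1 (sub_nonneg.2 hm.2)).trans (h1 _ hm))
  · rw [e, inv_div]
    exact mul_le_of_le_one_right (by positivity) (h2 _ (Δ.greville_mem _ _))
  · have hm := Δ.greville_mem (d + 1) j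
    have e2 := Δ.schoen_mul (d + 1) (1 - l)⁻¹ w (Δ.greville (d + 1) j)
    rw [KnotSeq.schoen] at e2
    rw [e2, ← mul_sub, le_inv_mul_iff₀ hp]
    have h4 := h1 _ hm
    have h5 := h3 _ hm
    nlinarith

/-- Here w belongs to degree d. With S of degree d+1, z = (w + Sw)/s has z - Sz = (w - S²w)/s, and
`KnotSeq.schoen_sub_le` for the convex function -w bounds w - S²w from below by the defect of w in
degree d. -/
theorem KnotSeq.hasSupersolution_of_eigenBound {γ D : ℝ} (hd : 2 ≤ d) (hγ : 0 ≤ γ) (hγ1 : γ < 1)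
    (hD : 2 * ((d : ℝ) + 1) ^ 2 / d < D) (hE : Δ.EigenBound d γ) :
    Δ.HasSupersolution (d + 1) (D / (1 - γ)) := by
  have hd0 : (0 : ℝ) < d := by positivity
  have hg : 0 < 1 - γ := by linarith
  have hD0 : 0 < D := lt_of_le_of_lt (by positivity) hD
  -- Chosen so that 2/s, the bound for z, becomes D/(1-γ). The hypothesis on D says q < 1, which
  -- means l > γ.
  set q := 2 * ((d : ℝ) + 1) ^ 2 / d / D with hq
  have hq0 : 0 < q := by positivity
  have hq1 : q < 1 := (div_lt_one hD0).2 hD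
  set l := 1 - (1 - γ) * q with hl
  have hγl : γ < l := by nlinarith
  set s := (d : ℝ) / (d + 1) ^ 2 * (1 - l) with hs
  have e : 2 / s = D / (1 - γ) := by
    rw [hs, hl, hq]; field_simp; ring
  have hsp : 0 < s := by
    have : 0 < 1 - l := by rw [hl]; nlinarith
    positivity
  obtain ⟨w, hw, h1, h2, h3⟩ := Δ.exists_concave_supersolution hd hγ hE hγl
  have hw0 : ∀ t ∈ Set.Icc (0 : ℝ) 1, 0 ≤ w t := fun t ht =>
    (mul_nonneg ht.1 (sub_nonneg.2 ht.2)).trans (h1 _ ht)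
  have hS1 : ∀ t ∈ Set.Icc (0 : ℝ) 1, Δ.schoen (d + 1) w t ≤ 1 := fun t ht => by
    rw [← Δ.spline_const (d + 1) (1 : ℝ) ht]
    exact Δ.spline_mono fun j _ _ => h2 _ (Δ.greville_mem _ _)
  refine ⟨fun j => s⁻¹ * (w (Δ.greville (d + 1) j) + Δ.schoen (d + 1) w (Δ.greville (d + 1) j)),
    fun j _ => ⟨?_, ?_⟩, fun j _ => ?_⟩
  · exact mul_nonneg (inv_nonneg.2 hsp.le)
      (add_nonneg (hw0 _ (Δ.greville_mem _ _)) (Δ.schoen_nonneg _ hw0 _))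
  · rw [← e, div_eq_inv_mul]
    refine mul_le_mul_of_nonneg_left ?_ (inv_nonneg.2 hsp.le)
    linarith [h2 _ (Δ.greville_mem (d + 1) j), hS1 _ (Δ.greville_mem (d + 1) j)]
  · have hm := Δ.greville_mem (d + 1) j
    set t := Δ.greville (d + 1) j with ht
    have e2 : Δ.spline (d + 1) (fun j => s⁻¹ * (w (Δ.greville (d + 1) j)
        + Δ.schoen (d + 1) w (Δ.greville (d + 1) j))) t
        = s⁻¹ * (Δ.schoen (d + 1) w t + Δ.schoen (d + 1) (Δ.schoen (d + 1) w) t) := by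
      have := Δ.spline_smul (d + 1) s⁻¹ (fun j => w (Δ.greville (d + 1) j)
        + Δ.schoen (d + 1) w (Δ.greville (d + 1) j)) t
      simp only [smul_eq_mul] at this
      rw [this, Δ.spline_add]
      rfl
    rw [e2, ← mul_sub, le_inv_mul_iff₀ hsp]
    have h4 := Δ.schoen_sub_le (d := d) (by omega) hw.neg hm
    have neg : ∀ (e : ℕ) (f : ℝ → ℝ) (u : ℝ), Δ.schoen e (-f) u = -Δ.schoen e f u := fun e f u => by
      have := Δ.schoen_mul e (-1) f u
      simp only [neg_mul, one_mul] at this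
      exact this
    have neg2 : Δ.schoen (d + 1) (-w) = -Δ.schoen (d + 1) w := funext fun u => neg _ _ u
    rw [neg2, neg, neg, Pi.neg_apply] at h4
    have h5 := h3 t hm
    have h6 := h1 t hm
    have h7 : (d : ℝ) / (d + 1) ^ 2 * ((1 - l) * w t)
        ≤ (d : ℝ) / (d + 1) ^ 2 * (w t - Δ.schoen d w t) :=
      mul_le_mul_of_nonneg_left (by linarith) (by positivity)
    have h8 : s * (t * (1 - t)) ≤ s * w t := mul_le_mul_of_nonneg_left h6 hsp.le
    have h9 : s * w t = (d : ℝ) / (d + 1) ^ 2 * ((1 - l) * w t) := by rw [hs]; ring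
    linarith

/-- Some supersolution always exists. -/
theorem KnotSeq.exists_hasSupersolution (hd : 1 ≤ d) : ∃ Z, Δ.HasSupersolution (d + 1) Z := by
  have hn := Δ.one_le
  set g : ℤ → ℝ := fun j => Δ.greville (d + 1) j * (1 - Δ.greville (d + 1) j) with hg
  obtain ⟨i, hi, hmin⟩ := Finset.exists_min_image (Finset.Ioo (-((d + 1 : ℕ) : ℤ)) (n - 1))
    (fun j => g j - Δ.spline (d + 1) g (Δ.greville (d + 1) j))
    ⟨-(d : ℤ), by simp only [Finset.mem_Ioo]; push_cast; omega⟩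
  have hpos := Δ.quadratic_sub_pos (d := d + 1) (by omega) hi
  set δ := g i - Δ.spline (d + 1) g (Δ.greville (d + 1) i) with hδ
  have hg1 : ∀ j, 0 ≤ g j ∧ g j ≤ 1 := fun j => by
    have := Δ.greville_mem (d + 1) j
    exact ⟨mul_nonneg this.1 (sub_nonneg.2 this.2), by simp only [hg]; nlinarith [this.1, this.2]⟩
  have hδ0 : 0 < δ := hpos
  refine ⟨δ⁻¹, fun j => δ⁻¹ * g j, fun j _ => ⟨mul_nonneg (inv_nonneg.2 hδ0.le) (hg1 j).1, ?_⟩,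
    fun j hj => ?_⟩
  · exact mul_le_of_le_one_right (inv_nonneg.2 hδ0.le) (hg1 j).2
  · have := Δ.spline_smul (d + 1) δ⁻¹ g (Δ.greville (d + 1) j)
    simp only [smul_eq_mul] at this
    rw [this, ← mul_sub, le_inv_mul_iff₀ hδ0]
    exact (mul_le_of_le_one_right hδ0.le (hg1 j).2).trans (hmin j hj)

theorem KnotSeq.sum_width (hd : 1 ≤ d) :
    ∑ j ∈ Finset.Ico (-(d : ℤ) + 1) n, Δ.width d j = 1 := by
  have hn := Δ.one_le
  have := sum_Ico_sub_pred (Δ.greville d) (a := -(d : ℤ) + 1) (b := n) (by omega)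
  rw [Δ.greville_right hd le_rfl, Δ.greville_left d (by omega), sub_zero] at this
  exact this

/-- A kernel bound that results from a uniform bound of the jumps. -/
theorem KnotSeq.kernelBound_of_jump_le {κ : ℝ} (hd : 1 ≤ d) (hκ : 0 ≤ κ)
    (h : ∀ (c : ℤ → ℝ) (W : ℝ), c (-((d + 1 : ℕ) : ℤ)) = 0 → c (n - 1) = 0 →
      (∀ j ∈ Finset.Ioo (-((d + 1 : ℕ) : ℤ)) (n - 1),
        |c j - Δ.spline (d + 1) c (Δ.greville (d + 1) j)| ≤ W) →
      ∀ j ∈ Finset.Ico (-(d : ℤ) + 1) n, |Δ.jump (d + 1) c j| ≤ κ * W / Δ.meshMin) :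
    Δ.KernelBound d (κ * d / Δ.meshMin ^ 2) := by
  -- Any supersolution will do: only the existence of the kernel is needed, and Z does not enter the
  -- bound.
  obtain ⟨Z, z, hz0, hz⟩ := Δ.exists_hasSupersolution hd
  obtain ⟨F, hF, -⟩ := Δ.exists_kernel hd hz0 hz
  have hmp := Δ.meshMin_pos
  have hd0 : (0 : ℝ) < d := by positivity
  have hw : ∀ i ∈ Finset.Ico (-(d : ℤ)) n, 0 ≤ Δ.width (d + 1) i := fun i hi => by
    simp only [Finset.mem_Ico] at hi
    exact (Δ.width_pos (by omega) (by push_cast; omega) hi.2).le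
  have key : ∀ i ∈ Finset.Ico (-(d : ℤ)) n, ∀ j ∈ Finset.Ico (-(d : ℤ) + 1) n,
      |Δ.jump (d + 1) (F i) j| ≤ κ * d / Δ.meshMin ^ 2 * Δ.width d j * Δ.width (d + 1) i := by
    intro i hi j hj
    refine (h (F i) (Δ.width (d + 1) i) (hF.left i hi) (hF.right i hi) (fun l hl => ?_) j hj).trans ?_
    · rw [hF.eq i hi l hl, abs_mul, abs_of_nonneg (hw i hi)]
      refine mul_le_of_le_one_right (hw i hi) ?_
      have := Δ.greville_mem (d + 1) l
      rw [abs_le]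
      split_ifs <;> constructor <;> linarith [this.1, this.2]
    · simp only [Finset.mem_Ico] at hj
      have h1 := Δ.meshMin_div_le_width (d := d) (j := j) hd (by omega) hj.2
      calc κ * Δ.width (d + 1) i / Δ.meshMin
          = κ * d / Δ.meshMin ^ 2 * (Δ.meshMin / d) * Δ.width (d + 1) i := by field_simp
        _ ≤ _ := by
          have := hw i hi
          gcongr
  refine ⟨F, hF, fun j hj => (Finset.sum_le_sum fun i hi => key i hi j hj).trans (le_of_eq ?_),
    fun i hi => (Finset.sum_le_sum fun j hj => key i hi j hj).trans (le_of_eq ?_)⟩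
  · rw [← Finset.mul_sum]
    have := Δ.sum_width (d := d + 1) (by omega)
    rw [show (-((d + 1 : ℕ) : ℤ) + 1) = -(d : ℤ) by push_cast; ring] at this
    rw [this, mul_one]
  · rw [← Finset.sum_mul, ← Finset.mul_sum, Δ.sum_width hd, mul_one]

end SplineLower

namespace SplineLower

variable {n : ℕ} (Δ : KnotSeq n)

/-! ### Quadratic and cubic splines -/

theorem KnotSeq.bspline_le_one (d : ℕ) (j : ℤ) {t : ℝ} (ht : t ∈ Set.Icc (0 : ℝ) 1) :
    bspline Δ.x d j t ≤ 1 := by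
  by_cases hj : j ∈ Finset.Ico (-(d : ℤ)) n
  · rw [← Δ.sum_bspline d ht]
    exact Finset.single_le_sum (f := fun j => bspline Δ.x d j t)
      (fun i _ => Δ.bspline_nonneg d i t) hj
  · have : bspline Δ.x d j t = 0 := by
      simp only [Finset.mem_Ico, not_and_or, not_le, not_lt] at hj
      rcases hj with h | h
      · exact Δ.bspline_eq_zero_left t (by omega)
      · exact Δ.bspline_eq_zero_right t h
    rw [this]; exact zero_le_one

theorem KnotSeq.bspline_succ_of_lt {d : ℕ} {j : ℤ} {t : ℝ} (h : t < Δ.x (j + 1)) :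
    bspline Δ.x (d + 1) j t = (t - Δ.x j) / (Δ.x (j + d + 1) - Δ.x j) * bspline Δ.x d j t := by
  have : bspline Δ.x d (j + 1) t = 0 := by
    by_contra h'
    exact absurd (Δ.bspline_support h').1 (not_le.2 h)
  rw [bspline_succ, this, mul_zero, add_zero]

theorem KnotSeq.bspline_succ_of_gt {d : ℕ} {j : ℤ} {t : ℝ} (h : Δ.x (j + d + 1) < t) :
    bspline Δ.x (d + 1) j t
      = (Δ.x (j + d + 2) - t) / (Δ.x (j + d + 2) - Δ.x (j + 1)) * bspline Δ.x d (j + 1) t := by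
  have : bspline Δ.x d j t = 0 := by
    by_contra h'
    exact absurd (Δ.bspline_support h').2.1 (not_le.2 h)
  rw [bspline_succ, this, mul_zero, zero_add]

/-- The numerical core of the estimates of a cubic B-spline near the ends of its support. -/
theorem cubic_tail {u e f g N : ℝ} (hu : 0 ≤ u) (he : 3 * u ≤ e) (hu' : u < e) (hf : e ≤ f) (hg : e ≤ g)
    (hN : N ≤ 1) :
    u / f * (u / g * (u / e * N)) * (f / 3) ≤ e / 81 := by
  have he0 : 0 < e := by linarith
  have hf0 : 0 < f := by linarith
  have hg0 : 0 < g := by linarith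
  have a1 : u / e ≤ 1 / 3 := by rw [div_le_iff₀ he0]; linarith
  have a2 : u / g ≤ 1 / 3 := by rw [div_le_iff₀ hg0]; linarith
  have b1 : 0 ≤ u / e := by positivity
  have b2 : 0 ≤ u / g := by positivity
  have e1 : u / f * (u / g * (u / e * N)) * (f / 3) = u / 3 * (u / g * (u / e * N)) := by
    field_simp
  rw [e1]
  have c1 : u / e * N ≤ 1 / 3 := (mul_le_of_le_one_right b1 hN).trans a1
  have c2 : u / g * (u / e * N) ≤ u / g * (1 / 3) := mul_le_mul_of_nonneg_left c1 b2
  have c3 : u / 3 * (u / g * (u / e * N)) ≤ u / 3 * (1 / 9) :=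
    mul_le_mul_of_nonneg_left (by linarith) (by linarith)
  linarith

/-- The node lies in the first knot interval of N_{i+2,3}, where the B-spline is a product of three
ratios with numerator ξ - x_{i+2}. As ξ is the mean of three knots, this numerator is at most
(x_{i+3} - x_{i+2})/3. -/
theorem KnotSeq.bspline_three_right {i : ℤ} (h1 : -2 ≤ i) (h3 : i + 2 < n)
    (h : Δ.x (i + 2) ≤ Δ.greville 3 i) :
    bspline Δ.x 3 (i + 2) (Δ.greville 3 i) * Δ.width 3 (i + 2)
      ≤ (Δ.x (i + 3) - Δ.x (i + 1)) / 81 := by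
  have hm := Δ.greville_mem 3 i
  have e : 3 * Δ.greville 3 i = Δ.x (i + 1) + Δ.x (i + 2) + Δ.x (i + 3) := by
    have := Δ.greville_mul 3 i
    simp only [Finset.sum_range_succ, Finset.sum_range_zero] at this
    push_cast at this
    ring_nf at this ⊢
    linarith
  set ξ := Δ.greville 3 i with hξ
  have k1 : Δ.x (i + 1) < Δ.x (i + 3) := Δ.lt_of_lt (by omega) (by omega) (by omega)
  have k2 : Δ.x (i + 1) ≤ Δ.x (i + 2) := Δ.monotone (by omega)
  have k3 : Δ.x (i + 3) ≤ Δ.x (i + 4) := Δ.monotone (by omega)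
  have k4 : Δ.x (i + 4) ≤ Δ.x (i + 5) := Δ.monotone (by omega)
  have hlt : ξ < Δ.x (i + 3) := by
    have : Δ.x (i + 2) ≤ Δ.x (i + 3) := Δ.monotone (by omega)
    linarith
  have hl : ξ < Δ.x (i + 2 + 1) := by rw [show i + 2 + 1 = i + 3 by ring]; exact hlt
  rw [Δ.bspline_succ_of_lt (d := 2) hl, Δ.bspline_succ_of_lt (d := 1) hl,
    Δ.bspline_succ_of_lt (d := 0) hl, Δ.width_eq (by norm_num)]
  push_cast
  have i1 : i + 2 + 2 + 1 = i + 5 := by ring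
  have i2 : i + 2 + 1 + 1 = i + 4 := by ring
  have i3 : i + 2 + 0 + 1 = i + 3 := by ring
  have i4 : i + 2 + 3 = i + 5 := by ring
  rw [i1, i2, i3, i4]
  refine (cubic_tail (u := ξ - Δ.x (i + 2)) (by linarith) (e := Δ.x (i + 3) - Δ.x (i + 2))
    (by linarith) (by linarith) (by linarith) (by linarith) (Δ.bspline_le_one 0 _ hm)).trans ?_
  linarith

theorem KnotSeq.bspline_three_left {i : ℤ} (h2 : i < n - 1) (h3 : -1 ≤ i)
    (h : Δ.greville 3 i ≤ Δ.x (i + 2)) :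
    bspline Δ.x 3 (i - 2) (Δ.greville 3 i) * Δ.width 3 (i - 1)
      ≤ (Δ.x (i + 3) - Δ.x (i + 1)) / 81 := by
  have hm := Δ.greville_mem 3 i
  have e : 3 * Δ.greville 3 i = Δ.x (i + 1) + Δ.x (i + 2) + Δ.x (i + 3) := by
    have := Δ.greville_mul 3 i
    simp only [Finset.sum_range_succ, Finset.sum_range_zero] at this
    push_cast at this
    ring_nf at this ⊢
    linarith
  set ξ := Δ.greville 3 i with hξ
  have k1 : Δ.x (i + 1) < Δ.x (i + 3) := Δ.lt_of_lt (by omega) (by omega) (by omega)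
  have k2 : Δ.x (i + 2) ≤ Δ.x (i + 3) := Δ.monotone (by omega)
  have k3 : Δ.x i ≤ Δ.x (i + 1) := Δ.monotone (by omega)
  have k4 : Δ.x (i - 1) ≤ Δ.x i := Δ.monotone (by omega)
  have hlt : Δ.x (i + 1) < ξ := by
    have : Δ.x (i + 1) ≤ Δ.x (i + 2) := Δ.monotone (by omega)
    linarith
  have l2 : Δ.x (i - 2 + (2 : ℕ) + 1) < ξ := by
    rw [show i - 2 + (2 : ℕ) + 1 = i + 1 by push_cast; ring]; exact hlt
  have l1 : Δ.x (i - 2 + 1 + (1 : ℕ) + 1) < ξ := by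
    rw [show i - 2 + 1 + (1 : ℕ) + 1 = i + 1 by push_cast; ring]; exact hlt
  have l0 : Δ.x (i - 2 + 1 + 1 + (0 : ℕ) + 1) < ξ := by
    rw [show i - 2 + 1 + 1 + (0 : ℕ) + 1 = i + 1 by push_cast; ring]; exact hlt
  rw [Δ.bspline_succ_of_gt (d := 2) l2, Δ.bspline_succ_of_gt (d := 1) l1,
    Δ.bspline_succ_of_gt (d := 0) l0, Δ.width_eq (by norm_num)]
  push_cast
  have i1 : i - 2 + 2 + 2 = i + 2 := by ring
  have i2 : i - 2 + 1 = i - 1 := by ring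
  have i3 : i - 1 + 1 + 2 = i + 2 := by ring
  have i4 : i - 1 + 1 = i := by ring
  have i5 : i + 0 + 2 = i + 2 := by ring
  have i6 : i - 1 + 3 = i + 2 := by ring
  rw [i1, i2, i3, i4, i5, i6]
  refine (cubic_tail (u := Δ.x (i + 2) - ξ) (by linarith) (e := Δ.x (i + 2) - Δ.x (i + 1))
    (by linarith) (by linarith) (by linarith) (by linarith) (Δ.bspline_le_one 0 _ hm)).trans ?_
  linarith

/-- The value of a polygon at nodes near the `i`-th one, in terms of the jumps of its slope. -/
theorem KnotSeq.eq_add_jump {d : ℕ} (hd : 1 ≤ d) (c : ℤ → ℝ) {i : ℤ} (h1 : -(d : ℤ) < i)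
    (h2 : i < n - 1) :
    c (i + 1) = c i + Δ.slope d c i * (Δ.greville d (i + 1) - Δ.greville d i)
      + Δ.jump d c (i + 1) * (Δ.greville d (i + 1) - Δ.greville d i) := by
  have h := Δ.width_smul_slope hd c (j := i + 1) (by omega) (by omega)
  rw [add_sub_cancel_right, KnotSeq.width, add_sub_cancel_right, smul_eq_mul] at h
  rw [KnotSeq.jump, add_sub_cancel_right]
  linear_combination -h

/-- Any line through the i-th vertex may be subtracted, by linear precision. With s the slope of the
polygon just left of that vertex, the remaining values near it are expressed by jumps alone. -/
theorem KnotSeq.spline_sub_node {d : ℕ} (hd : 1 ≤ d) (c : ℤ → ℝ) (s : ℝ) (i : ℤ) :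
    Δ.spline d c (Δ.greville d i) - c i
      = Δ.spline d (fun j => c j - (c i + s * (Δ.greville d j - Δ.greville d i)))
          (Δ.greville d i) := by
  have hm := Δ.greville_mem d i
  have e : (fun j => c i + s * (Δ.greville d j - Δ.greville d i))
      = fun j => (c i - s * Δ.greville d i) + s • Δ.greville d j := by
    funext j; simp only [smul_eq_mul]; ring
  rw [Δ.spline_sub, e, Δ.spline_add, Δ.spline_const d _ hm, Δ.spline_smul,
    Δ.spline_greville hd hm, smul_eq_mul]
  ring

/-- At ξ_i, the midpoint of x_{i+1} and x_{i+2}, only the coefficients i-1, i, i+1 are active. The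
defect there is, up to sign, the jump at i+1 times the B-spline average of (ξ_j - ξ_i)₊, which is at
least meshMin/8. -/
theorem KnotSeq.abs_jump_le_two {c : ℤ → ℝ} {W : ℝ}
    (hc : ∀ j ∈ Finset.Ioo (-2 : ℤ) (n - 1), |c j - Δ.spline 2 c (Δ.greville 2 j)| ≤ W) :
    ∀ j ∈ Finset.Ico (0 : ℤ) n, |Δ.jump 2 c j| ≤ 8 * W / Δ.meshMin := by
  intro j hj
  obtain ⟨i, rfl⟩ : ∃ i, j = i + 1 := ⟨j - 1, by ring⟩
  simp only [Finset.mem_Ico] at hj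
  have hmp := Δ.meshMin_pos
  have hW := hc i (by simp only [Finset.mem_Ioo]; omega)
  have e : 2 * Δ.greville 2 i = Δ.x (i + 1) + Δ.x (i + 2) := by
    have := Δ.greville_mul 2 i
    simp only [Finset.sum_range_succ, Finset.sum_range_zero] at this
    push_cast at this
    ring_nf at this ⊢
    linarith
  have k1 : Δ.meshMin ≤ Δ.x (i + 2) - Δ.x (i + 1) :=
    Δ.meshMin_le_sub (by omega) (by omega) (by omega)
  have hpp := Δ.le_spline_posPart (d := 1) le_rfl (i := i) (by push_cast; omega) (by omega)
  norm_num at hpp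
  rw [show i + 1 + 1 = i + 2 by ring] at hpp
  set ξ := Δ.greville 2 i with hξ
  have key : Δ.spline 2 c ξ - c i
      = Δ.jump 2 c (i + 1) * Δ.spline 2 (fun j => max (Δ.greville 2 j - ξ) 0) ξ := by
    rw [hξ, Δ.spline_sub_node (by norm_num) c (Δ.slope 2 c i) i, ← smul_eq_mul, ← Δ.spline_smul]
    refine Δ.spline_congr fun j hj' hne => ?_
    have hs := Δ.bspline_support hne
    rw [← hξ] at hs ⊢
    have b1 : j ≤ i + 1 := by
      by_contra h
      have : Δ.x (i + 2) ≤ Δ.x j := Δ.monotone (by omega)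
      linarith [hs.1]
    have b2 : i - 1 ≤ j := by
      by_contra h
      have : Δ.x (j + (2 : ℕ) + 1) ≤ Δ.x (i + 1) := Δ.monotone (by push_cast; omega)
      linarith [hs.2.1]
    have hmono := Δ.greville_mono 2
    simp only [smul_eq_mul]
    rcases (by omega : j = i + 1 ∨ j = i ∨ j = i - 1) with rfl | rfl | rfl
    · rw [max_eq_left (sub_nonneg.2 (hmono (by omega)))]
      have := Δ.eq_add_jump (d := 2) (by norm_num) c (i := i) (by push_cast; omega) (by omega)
      rw [← hξ] at this
      linear_combination this
    · simp [← hξ]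
    · rw [max_eq_right (sub_nonpos.2 (hmono (by omega)))]
      have := Δ.width_smul_slope (d := 2) (by norm_num) c (j := i) (by push_cast; omega) (by omega)
      rw [KnotSeq.width, ← hξ, smul_eq_mul] at this
      linear_combination this
  rw [abs_sub_comm, key, abs_mul] at hW
  have h8 : Δ.meshMin / 8 ≤ Δ.spline 2 (fun j => max (Δ.greville 2 j - ξ) 0) ξ := by
    refine le_trans ?_ hpp
    have l0 : 0 < Δ.x (i + 2) - Δ.x (i + 1) := by linarith
    rw [le_div_iff₀ (by linarith)]
    have : (ξ - Δ.x (i + 1)) * (Δ.x (i + 2) - ξ) = (Δ.x (i + 2) - Δ.x (i + 1)) ^ 2 / 4 := by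
      rw [show ξ = (Δ.x (i + 1) + Δ.x (i + 2)) / 2 by linarith]; ring
    nlinarith
  rw [abs_of_nonneg (by linarith : 0 ≤ Δ.spline 2 (fun j => max (Δ.greville 2 j - ξ) 0) ξ)] at hW
  rw [le_div_iff₀ hmp]
  nlinarith [abs_nonneg (Δ.jump 2 c (i + 1))]

theorem KnotSeq.abs_spline_single_le (d : ℕ) (l : ℤ) (v t B : ℝ) (hB : 0 ≤ B)
    (h : l ∈ Finset.Ico (-(d : ℤ)) n → bspline Δ.x d l t * |v| ≤ B) :
    |Δ.spline d (fun j => if j = l then v else 0) t| ≤ B := by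
  simp only [KnotSeq.spline, smul_eq_mul, mul_ite, mul_zero, Finset.sum_ite_eq']
  split_ifs with hl
  · rw [abs_mul, abs_of_nonneg (Δ.bspline_nonneg d l t)]
    exact h hl
  · simpa using hB

/-- Five coefficients may be active, and the outer two bring in the jumps at i and i+2. At the
largest jump M, with window length l, the main term is at least 2lM/27 and each perturbation at most
lM/81, which leaves 4lM/81 ≤ W. -/
theorem KnotSeq.abs_jump_le_three {c : ℤ → ℝ} {W : ℝ}
    (hc : ∀ j ∈ Finset.Ioo (-3 : ℤ) (n - 1), |c j - Δ.spline 3 c (Δ.greville 3 j)| ≤ W) :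
    ∀ j ∈ Finset.Ico (-1 : ℤ) n, |Δ.jump 3 c j| ≤ 81 / 4 * W / Δ.meshMin := by
  intro j hj
  obtain ⟨j₀, hj₀, hmax⟩ := Finset.exists_max_image (Finset.Ico (-1 : ℤ) n)
    (fun j => |Δ.jump 3 c j|) ⟨j, hj⟩
  refine (hmax j hj).trans ?_
  obtain ⟨i, rfl⟩ : ∃ i, j₀ = i + 1 := ⟨j₀ - 1, by ring⟩
  simp only [Finset.mem_Ico] at hj₀
  have hmp := Δ.meshMin_pos
  have hW := hc i (by simp only [Finset.mem_Ioo]; omega)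
  have e : 3 * Δ.greville 3 i = Δ.x (i + 1) + Δ.x (i + 2) + Δ.x (i + 3) := by
    have := Δ.greville_mul 3 i
    simp only [Finset.sum_range_succ, Finset.sum_range_zero] at this
    push_cast at this
    ring_nf at this ⊢
    linarith
  have k1 : Δ.meshMin ≤ Δ.x (i + 3) - Δ.x (i + 1) :=
    Δ.meshMin_le_sub (by omega) (by omega) (by omega)
  have k2 : Δ.x (i + 1) ≤ Δ.x (i + 2) := Δ.monotone (by omega)
  have k3 : Δ.x (i + 2) ≤ Δ.x (i + 3) := Δ.monotone (by omega)
  have hpp := Δ.le_spline_posPart (d := 2) (by norm_num) (i := i) (by push_cast; omega) (by omega)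
  norm_num at hpp
  rw [show i + 2 + 1 = i + 3 by ring] at hpp
  have hright := fun h => Δ.bspline_three_right (i := i) (by omega) h
  have hleft := fun h => Δ.bspline_three_left (i := i) (by omega) h
  set ξ := Δ.greville 3 i with hξ
  set l := Δ.x (i + 3) - Δ.x (i + 1) with hl
  set M := |Δ.jump 3 c (i + 1)| with hM
  have hM0 : 0 ≤ M := abs_nonneg _
  have hl0 : 0 < l := by linarith
  have hmono := Δ.greville_mono 3
  have hw : ∀ i, 0 ≤ Δ.width 3 i := fun i => sub_nonneg.2 (hmono (by omega))
  have key : Δ.spline 3 c ξ - c i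
      = Δ.jump 3 c (i + 1) * Δ.spline 3 (fun j => max (Δ.greville 3 j - ξ) 0) ξ
        + (Δ.spline 3 (fun j => if j = i + 2 then Δ.width 3 (i + 2) * Δ.jump 3 c (i + 2) else 0) ξ
        + Δ.spline 3 (fun j => if j = i - 2 then Δ.width 3 (i - 1) * Δ.jump 3 c i else 0) ξ) := by
    rw [hξ, Δ.spline_sub_node (by norm_num) c (Δ.slope 3 c i) i, ← smul_eq_mul (Δ.jump 3 c (i + 1)),
      ← Δ.spline_smul, ← Δ.spline_add, ← Δ.spline_add]
    refine Δ.spline_congr fun j hj' hne => ?_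
    have hs := Δ.bspline_support hne
    rw [← hξ] at hs ⊢
    simp only [Finset.mem_Ico] at hj'
    have b1 : j ≤ i + 2 := by
      by_contra h
      have : Δ.x (i + 3) ≤ Δ.x j := Δ.monotone (by omega)
      linarith [hs.1]
    have b2 : i - 2 ≤ j := by
      by_contra h
      have : Δ.x (j + (3 : ℕ) + 1) ≤ Δ.x (i + 1) := Δ.monotone (by push_cast; omega)
      linarith [hs.2.1]
    simp only [smul_eq_mul]
    have w0 := Δ.width_smul_slope (d := 3) (by norm_num) c (j := i) (by push_cast; omega) (by omega)
    have w1 := Δ.eq_add_jump (d := 3) (by norm_num) c (i := i) (by push_cast; omega) (by omega)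
    rw [← hξ] at w1
    simp only [KnotSeq.width, smul_eq_mul, ← hξ] at w0
    rcases (by omega : j = i + 2 ∨ j = i + 1 ∨ j = i ∨ j = i - 1 ∨ j = i - 2) with
      rfl | rfl | rfl | rfl | rfl
    · rw [max_eq_left (sub_nonneg.2 (hmono (by omega))), if_pos rfl, if_neg (by omega)]
      have w2 := Δ.eq_add_jump (d := 3) (by norm_num) c (i := i + 1) (by push_cast; omega) (by omega)
      rw [show i + 1 + 1 = i + 2 by ring] at w2
      have j1 : Δ.jump 3 c (i + 1) = Δ.slope 3 c (i + 1) - Δ.slope 3 c i := by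
        rw [KnotSeq.jump, add_sub_cancel_right]
      rw [KnotSeq.width, show i + 2 - 1 = i + 1 by ring]
      linear_combination w2 + w1 - (Δ.greville 3 (i + 2) - Δ.greville 3 (i + 1)) * j1
    · rw [max_eq_left (sub_nonneg.2 (hmono (by omega))), if_neg (by omega), if_neg (by omega)]
      linear_combination w1
    · rw [if_neg (by omega), if_neg (by omega)]; simp [← hξ]
    · rw [max_eq_right (sub_nonpos.2 (hmono (by omega))), if_neg (by omega), if_neg (by omega)]
      linear_combination w0
    · rw [max_eq_right (sub_nonpos.2 (hmono (by omega))), if_neg (by omega), if_pos rfl]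
      have w2 := Δ.width_smul_slope (d := 3) (by norm_num) c (j := i - 1) (by push_cast at hj' ⊢; omega)
        (by omega)
      have j1 : Δ.jump 3 c i = Δ.slope 3 c i - Δ.slope 3 c (i - 1) := rfl
      rw [KnotSeq.width, show i - 1 - 1 = i - 2 by ring, smul_eq_mul] at *
      linear_combination w2 + w0 - (Δ.greville 3 (i - 1) - Δ.greville 3 (i - 2)) * j1
  have h8 : 2 * l / 27 ≤ Δ.spline 3 (fun j => max (Δ.greville 3 j - ξ) 0) ξ := by
    refine le_trans ?_ hpp
    rw [div_le_div_iff₀ (by norm_num) (by linarith)]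
    have a1 : l ≤ 3 * (ξ - Δ.x (i + 1)) := by linarith
    have a2 : l ≤ 3 * (Δ.x (i + 3) - ξ) := by linarith
    nlinarith [mul_nonneg (sub_nonneg.2 a1) (sub_nonneg.2 a2)]
  have T1 : |Δ.spline 3 (fun j => if j = i + 2 then Δ.width 3 (i + 2) * Δ.jump 3 c (i + 2) else 0) ξ|
      ≤ l / 81 * M := by
    refine Δ.abs_spline_single_le _ _ _ _ _ (by positivity) fun h => ?_
    simp only [Finset.mem_Ico] at h
    rw [abs_mul, abs_of_nonneg (hw _), ← mul_assoc]
    have hJ : |Δ.jump 3 c (i + 2)| ≤ M := hmax _ (by simp only [Finset.mem_Ico]; omega)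
    refine mul_le_mul ?_ hJ (abs_nonneg _) (by positivity)
    rcases le_or_gt (Δ.x (i + 2)) ξ with h' | h'
    · exact hright h.2 h'
    · have : bspline Δ.x 3 (i + 2) ξ = 0 := by
        by_contra h2
        linarith [(Δ.bspline_support h2).1]
      rw [this, zero_mul]; positivity
  have T2 : |Δ.spline 3 (fun j => if j = i - 2 then Δ.width 3 (i - 1) * Δ.jump 3 c i else 0) ξ|
      ≤ l / 81 * M := by
    refine Δ.abs_spline_single_le _ _ _ _ _ (by positivity) fun h => ?_
    simp only [Finset.mem_Ico] at h
    push_cast at h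
    rw [abs_mul, abs_of_nonneg (hw _), ← mul_assoc]
    have hJ : |Δ.jump 3 c i| ≤ M := hmax _ (by simp only [Finset.mem_Ico]; omega)
    refine mul_le_mul ?_ hJ (abs_nonneg _) (by positivity)
    rcases le_or_gt ξ (Δ.x (i + 2)) with h' | h'
    · exact hleft (by omega) h'
    · have : bspline Δ.x 3 (i - 2) ξ = 0 := by
        by_contra h2
        have h3 := (Δ.bspline_support h2).2.1
        rw [show i - 2 + ((3 : ℕ) : ℤ) + 1 = i + 2 by push_cast; ring] at h3
        linarith
      rw [this, zero_mul]; positivity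
  set S := Δ.spline 3 (fun j => max (Δ.greville 3 j - ξ) 0) ξ with hS
  have hS0 : 0 ≤ S := le_trans (by positivity) h8
  have e1 : M * S ≤ W + (l / 81 * M + l / 81 * M) := by
    have e2 : M * S = |Δ.jump 3 c (i + 1) * S| := by rw [abs_mul, abs_of_nonneg hS0]
    rw [e2, eq_sub_of_add_eq key.symm]
    refine (abs_sub _ _).trans (add_le_add (by rwa [abs_sub_comm]) ?_)
    exact (abs_add_le _ _).trans (add_le_add T1 T2)
  have e3 : M * (2 * l / 27) ≤ M * S := mul_le_mul_of_nonneg_left h8 hM0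
  have e4 : M * Δ.meshMin ≤ M * l := mul_le_mul_of_nonneg_left k1 hM0
  rw [le_div_iff₀ hmp]
  linarith

theorem KnotSeq.kernelBound_one : Δ.KernelBound 1 (8 / Δ.meshMin ^ 2) := by
  have := Δ.kernelBound_of_jump_le (d := 1) (κ := 8) le_rfl (by norm_num)
    fun c W _ _ h j hj => Δ.abs_jump_le_two (c := c) (W := W) (by simpa using h) j (by simpa using hj)
  simpa using this

theorem KnotSeq.kernelBound_two : Δ.KernelBound 2 (81 / 2 / Δ.meshMin ^ 2) := by
  have := Δ.kernelBound_of_jump_le (d := 2) (κ := 81 / 4) (by norm_num) (by norm_num)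
    fun c W _ _ h j hj => Δ.abs_jump_le_three (c := c) (W := W) (by simpa using h) j
      (by simpa using hj)
  norm_num at this
  exact this

end SplineLower

namespace SplineLower

/-! ### A lower bound for the condition number -/

/-- The knot sequence without interior knots. -/
noncomputable def bernsteinKnots : KnotSeq 1 where
  x j := if j ≤ 0 then 0 else 1
  eq_zero j hj := if_pos hj
  eq_one j hj := if_neg (by push_cast at hj; omega)
  strictMonoOn := by
    intro i hi j hj hij
    simp only [Set.mem_Icc, Nat.cast_one] at hi hj
    rw [show i = 0 by omega, show j = 1 by omega]
    simp

/-- The de Casteljau step. -/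
noncomputable def casteljau (t : ℝ) : (ℤ → ℝ) →ₗ[ℝ] (ℤ → ℝ) where
  toFun c j := (1 - t) * c (j - 1) + t * c j
  map_add' c c' := by funext j; simp only [Pi.add_apply]; ring
  map_smul' r c := by funext j; simp only [Pi.smul_apply, smul_eq_mul, RingHom.id_apply]; ring

/-- The shift of a sequence. -/
noncomputable def shiftSeq : (ℤ → ℝ) →ₗ[ℝ] (ℤ → ℝ) where
  toFun c j := c (j - 1)
  map_add' _ _ := rfl
  map_smul' _ _ := rfl

theorem shiftSeq_pow (m : ℕ) (c : ℤ → ℝ) (j : ℤ) : (shiftSeq ^ m) c j = c (j - m) := by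
  induction m generalizing j with
  | zero => simp
  | succ m ih =>
    rw [pow_succ', Module.End.mul_apply]
    change (shiftSeq ^ m) c (j - 1) = _
    rw [ih]
    congr 1
    push_cast
    ring

/-- A de Casteljau step is t times the identity plus 1 - t times the shift; these commute, so the
binomial theorem applies. -/
theorem casteljau_pow (t : ℝ) (d : ℕ) (c : ℤ → ℝ) :
    (casteljau t ^ d) c 0
      = ∑ i ∈ Finset.range (d + 1), t ^ i * (1 - t) ^ (d - i) * d.choose i * c (i - d) := by
  have e : casteljau t = t • 1 + (1 - t) • shiftSeq := by
    ext c j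
    simp only [casteljau, shiftSeq, LinearMap.coe_mk, AddHom.coe_mk, LinearMap.add_apply,
      LinearMap.smul_apply, Module.End.one_apply, Pi.add_apply, Pi.smul_apply, smul_eq_mul]
    ring
  have hc : Commute (t • (1 : Module.End ℝ (ℤ → ℝ))) ((1 - t) • shiftSeq) :=
    ((Commute.one_left _).smul_left t)
  rw [e, hc.add_pow, LinearMap.sum_apply, Finset.sum_apply]
  refine Finset.sum_congr rfl fun i hi => ?_
  have hi' : i ≤ d := by have := Finset.mem_range.1 hi; omega
  rw [smul_pow, smul_pow, one_pow, ← nsmul_eq_mul', smul_mul_smul_comm, one_mul, LinearMap.smul_apply,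
    LinearMap.smul_apply, Pi.smul_apply, Pi.smul_apply, shiftSeq_pow, nsmul_eq_mul, smul_eq_mul,
    Nat.cast_sub hi']
  rw [show (0 : ℤ) - ((d : ℤ) - i) = i - d by ring]
  ring

theorem spline_bernstein (d : ℕ) (c : ℤ → ℝ) {t : ℝ} (ht : t ∈ Set.Icc (0 : ℝ) 1) :
    bernsteinKnots.spline d c t = (casteljau t ^ d) c 0 := by
  induction d generalizing c with
  | zero =>
    rw [bernsteinKnots.spline_zero_eq c (i := 0) (by simp)]
    · simp
    · simpa [bernsteinKnots] using ht.1
    · simp [bernsteinKnots]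
    · simp only [bernsteinKnots]
      rcases ht.2.eq_or_lt with h | h
      · right; simp [h]
      · left; simpa using h
  | succ d ih =>
    rw [bernsteinKnots.spline_succ, pow_succ, Module.End.mul_apply, ← ih]
    refine bernsteinKnots.spline_congr fun j hj _ => ?_
    simp only [Finset.mem_Ico] at hj
    have e : bernsteinKnots.ratio d j t = t := by
      rw [KnotSeq.ratio, bernsteinKnots.eq_zero j (by push_cast at hj; omega),
        bernsteinKnots.eq_one (j + d + 1) (by push_cast; omega)]
      simp
    rw [e]
    rfl

theorem sum_range_even_odd (f : ℕ → ℂ) (K : ℕ) :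
    ∑ m ∈ Finset.range (2 * K + 1), f m
      = ∑ i ∈ Finset.range (K + 1), f (2 * i) + ∑ i ∈ Finset.range K, f (2 * i + 1) := by
  induction K with
  | zero => simp
  | succ K ih =>
    rw [show 2 * (K + 1) + 1 = 2 * K + 1 + 1 + 1 by ring, Finset.sum_range_succ,
      Finset.sum_range_succ, ih, Finset.sum_range_succ (fun i => f (2 * i)) (K + 1),
      Finset.sum_range_succ (fun i => f (2 * i + 1)) K,
      show 2 * (K + 1) = 2 * K + 1 + 1 by ring]
    ring

/-- The Chebyshev polynomial on `[0, 1]` in the Bernstein basis is bounded by `1`. -/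
theorem abs_chebyshev_le (K : ℕ) {t : ℝ} (ht : t ∈ Set.Icc (0 : ℝ) 1) :
    |∑ i ∈ Finset.range (K + 1), t ^ i * (1 - t) ^ (K - i) * ((-1) ^ i * (2 * K).choose (2 * i))| ≤ 1 := by
  -- The sum is the real part of (a + ib)^{2K}, a power of a number of modulus 1.
  set a := √(1 - t) with ha
  set b := √t with hb
  have ha2 : a ^ 2 = 1 - t := Real.sq_sqrt (by linarith [ht.2])
  have hb2 : b ^ 2 = t := Real.sq_sqrt ht.1
  have hn : ‖(⟨a, b⟩ : ℂ) ^ (2 * K)‖ = 1 := by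
    have : ‖(⟨a, b⟩ : ℂ)‖ ^ 2 = 1 := by
      rw [← Complex.normSq_eq_norm_sq, Complex.normSq_mk]
      linear_combination ha2 + hb2
    rw [norm_pow, pow_mul, this, one_pow]
  have e : ((⟨a, b⟩ : ℂ) ^ (2 * K)).re
      = ∑ i ∈ Finset.range (K + 1), t ^ i * (1 - t) ^ (K - i) * ((-1) ^ i * (2 * K).choose (2 * i)) := by
    have e0 : (⟨a, b⟩ : ℂ) = Complex.I * b + a := by
      apply Complex.ext <;> simp
    rw [e0, add_pow, sum_range_even_odd, Complex.add_re, Complex.re_sum, Complex.re_sum,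
      Finset.sum_eq_zero (s := Finset.range K), add_zero]
    · refine Finset.sum_congr rfl fun i hi => ?_
      have hi' : i ≤ K := by have := Finset.mem_range.1 hi; omega
      have : (Complex.I * b) ^ (2 * i) * (a : ℂ) ^ (2 * K - 2 * i) * ((2 * K).choose (2 * i) : ℂ)
          = ((t ^ i * (1 - t) ^ (K - i) * ((-1) ^ i * (2 * K).choose (2 * i)) : ℝ) : ℂ) := by
        rw [← Nat.mul_sub, pow_mul, pow_mul, mul_pow, Complex.I_sq, ← ha2, ← hb2]
        push_cast
        rw [neg_one_mul, neg_pow]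
        ring
      rw [this, Complex.ofReal_re]
    · intro i _
      have : (Complex.I * b) ^ (2 * i + 1) * (a : ℂ) ^ (2 * K - (2 * i + 1))
            * ((2 * K).choose (2 * i + 1) : ℂ)
          = Complex.I * (((-1) ^ i * b ^ (2 * i + 1) * a ^ (2 * K - (2 * i + 1))
            * (2 * K).choose (2 * i + 1) : ℝ) : ℂ) := by
        rw [mul_pow, pow_succ Complex.I, pow_mul Complex.I, Complex.I_sq]
        push_cast
        ring
      rw [this, Complex.re_mul_ofReal, Complex.I_re, zero_mul]
  rw [← e, ← hn]
  exact Complex.abs_re_le_norm _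

theorem choose_ratio {K : ℕ} (hK : 2 ≤ K) :
    ((2 * K).choose 4 : ℝ) / K.choose 2 = (2 * K - 1) * (2 * K - 3) / 3 := by
  obtain ⟨L, rfl⟩ : ∃ L, K = L + 2 := ⟨K - 2, by omega⟩
  have h1 := Nat.ascFactorial_eq_factorial_mul_choose (2 * L) 4
  have h2 := Nat.ascFactorial_eq_factorial_mul_choose L 2
  simp only [Nat.ascFactorial, Nat.factorial] at h1 h2
  have h1' : ((2 * (L + 2)).choose 4 : ℝ) * 24 = (2 * L + 1) * (2 * L + 2) * (2 * L + 3) * (2 * L + 4) := by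
    rw [show 2 * (L + 2) = 2 * L + 4 by ring]
    have : (((2 * L + 1 + 3) * ((2 * L + 1 + 2) * ((2 * L + 1 + 1) * ((2 * L + 1 + 0) * 1))) : ℕ) : ℝ)
        = ((24 * (2 * L + 4).choose 4 : ℕ) : ℝ) := by
      exact_mod_cast h1
    push_cast at this
    linarith
  have h2' : ((L + 2).choose 2 : ℝ) * 2 = (L + 1) * (L + 2) := by
    have : (((L + 1 + 1) * ((L + 1 + 0) * 1) : ℕ) : ℝ) = ((2 * (L + 2).choose 2 : ℕ) : ℝ) := by
      exact_mod_cast h2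
    push_cast at this
    linarith
  have hp : (0 : ℝ) < ((L + 2).choose 2 : ℝ) := by
    exact_mod_cast Nat.choose_pos (by omega)
  rw [div_eq_iff hp.ne']
  push_cast
  linear_combination h1' / 24 - (2 * (L + 2 : ℝ) - 1) * (2 * (L + 2) - 3) / 6 * h2'

/-- The Chebyshev polynomial on [0, 1] is bounded by 1 and has Bernstein coefficients (-1)^i
C(2K,2i)/C(K,i); the one with i = 2 gives the bound. The hypothesis `h0` makes the set of admissible
constants nonempty, as the infimum of the empty set is 0. -/
theorem le_bsplineCond {K : ℕ} (hK : 2 ≤ K) (h0 : bsplineCond K ≠ 0) :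
    (2 * (K : ℝ) - 1) * (2 * K - 3) / 3 ≤ bsplineCond K := by
  unfold bsplineCond at h0 ⊢
  refine le_csInf ?_ ?_
  · by_contra h
    rw [Set.not_nonempty_iff_eq_empty] at h
    rw [h, Real.sInf_empty] at h0
    exact h0 rfl
  intro D hD
  set c : ℤ → ℝ := fun j => (-1) ^ (j + K).toNat * ((2 * K).choose (2 * (j + K).toNat) : ℝ)
    / K.choose (j + K).toNat with hc
  have h := hD 1 bernsteinKnots c 1 (fun t ht => by
    have e : ∑ j ∈ Finset.Ico (-(K : ℤ)) (1 : ℕ), c j * bspline bernsteinKnots.x K j t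
        = bernsteinKnots.spline K c t := Finset.sum_congr rfl fun j _ => mul_comm _ _
    rw [e, spline_bernstein K c ht, casteljau_pow]
    refine le_trans (le_of_eq ?_) (abs_chebyshev_le K ht)
    congr 1
    refine Finset.sum_congr rfl fun i hi => ?_
    have hi' : i ≤ K := by have := Finset.mem_range.1 hi; omega
    have hp : (K.choose i : ℝ) ≠ 0 := by exact_mod_cast (Nat.choose_pos hi').ne'
    simp only [hc, sub_add_cancel, Int.toNat_natCast]
    field_simp) (2 - K) (by simp only [Finset.mem_Ico]; push_cast; omega)
  have e2 : c (2 - K) = (2 * (K : ℝ) - 1) * (2 * K - 3) / 3 := by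
    simp only [hc, sub_add_cancel]
    rw [← choose_ratio hK, show Int.toNat 2 = 2 from rfl]
    norm_num
  rw [e2, mul_one] at h
  exact (le_abs_self _).trans h

end SplineLower

namespace SplineLower

variable {n : ℕ} (Δ : KnotSeq n) {d : ℕ}

/-- The kernel bound in terms of the condition number of the B-spline basis. -/
theorem KnotSeq.kernelBound_bsplineCond (hd : 1 ≤ d) {γ : ℝ} (hγ : 0 ≤ γ) (hγ1 : γ < 1)
    (hD : bsplineCond (d + 1) ≠ 0) (hE : Δ.EigenBound (d + 1) γ ∨ Δ.EigenBound d γ) :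
    Δ.KernelBound d
      (4 * ((d : ℝ) + 1) ^ 2 * bsplineCond (d + 1) / (Δ.meshMin ^ 2 * (1 - γ))) := by
  have hle := le_bsplineCond (K := d + 1) (by omega) hD
  push_cast at hle
  set D := bsplineCond (d + 1) with hDdef
  have hmp := Δ.meshMin_pos
  have hg : 0 < 1 - γ := by linarith
  have hd1 : (1 : ℝ) ≤ d := by exact_mod_cast hd
  have hD0 : 0 < D := by nlinarith
  have e : 4 * ((d : ℝ) + 1) ^ 2 * D / (Δ.meshMin ^ 2 * (1 - γ))
      = 4 * (D / (1 - γ)) * (d + 1) ^ 2 / Δ.meshMin ^ 2 := by field_simp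
  have hDg : D ≤ D / (1 - γ) := le_div_self hD0.le hg (by linarith)
  rw [e]
  -- For d = 1 and d = 2 the direct constants 8 and 81/2 suffice, since D is then at least 1 and 5.
  rcases hd.eq_or_lt with h1 | h1
  · subst h1
    refine Δ.kernelBound_one.mono le_rfl ?_
    norm_num at hle ⊢
    gcongr
    linarith
  rcases (show 2 ≤ d from h1).eq_or_lt with h2 | h2
  · subst h2
    refine Δ.kernelBound_two.mono (by norm_num) ?_
    norm_num at hle ⊢
    gcongr
    linarith
  have hd3 : (3 : ℝ) ≤ d := by exact_mod_cast h2
  have hn := Δ.one_le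
  rcases hn.eq_or_lt with h3 | h3
  · refine kernelBound_of_eq_one h3.symm hd ?_
    rw [Δ.meshMin_eq_one h3.symm]
    have : (d : ℝ) * (d + 1) ≤ 2 * (D / (1 - γ)) := by nlinarith
    have h4 := mul_le_mul_of_nonneg_left this (by positivity : 0 ≤ 2 * ((d : ℝ) + 1) ^ 2)
    norm_num
    linarith
  -- The loss in passing between degrees has to stay below the condition number; for d = 3 this
  -- rests on 32/3 < 35/3.
  · have hD2 : 2 * ((d : ℝ) + 1) ^ 2 / d < D := by
      refine lt_of_lt_of_le ?_ hle
      rw [div_lt_iff₀ (by linarith)]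
      rcases (show 3 ≤ d from h2).eq_or_lt with h | h
      · rw [← h]; norm_num
      · have : (4 : ℝ) ≤ d := by exact_mod_cast h
        nlinarith [mul_nonneg (sub_nonneg.2 this) (sq_nonneg (d : ℝ))]
    refine KnotSeq.HasSupersolution.kernelBound_of_two_le ?_ h3 hd
    rcases hE with hE | hE
    · exact Δ.hasSupersolution_of_eigenBound_succ hd hγ hγ1 hD2 hE
    · exact Δ.hasSupersolution_of_eigenBound h1 hγ hγ1 hD2 hE

/-! ### Increments of splines -/

section Abel

variable {E : Type*} [AddCommGroup E] [Module ℝ E]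

/-- The partial sums `∑_{i ≥ j} N_{i,d}`. -/
noncomputable def KnotSeq.tail (d : ℕ) (j : ℤ) (t : ℝ) : ℝ :=
  Δ.spline d (fun i => if j ≤ i then (1 : ℝ) else 0) t

theorem KnotSeq.monotoneOn_tail (d : ℕ) (j : ℤ) : MonotoneOn (Δ.tail d j) (Set.Icc 0 1) := by
  refine Δ.monotoneOn_spline fun i _ l _ hil => ?_
  split_ifs <;> first | omega | norm_num

theorem KnotSeq.tail_mem (d : ℕ) (j : ℤ) {t : ℝ} (ht : t ∈ Set.Icc (0 : ℝ) 1) :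
    Δ.tail d j t ∈ Set.Icc (0 : ℝ) 1 := by
  constructor
  · rw [← Δ.spline_const d (0 : ℝ) ht]
    exact Δ.spline_mono fun i _ _ => by split_ifs <;> norm_num
  · rw [← Δ.spline_const d (1 : ℝ) ht]
    exact Δ.spline_mono fun i _ _ => by split_ifs <;> norm_num

/-- Abel summation. The tails are monotone, so an increment of the spline combines the increments of
its coefficients with nonnegative weights. -/
theorem KnotSeq.spline_eq_tail (d : ℕ) (a : ℤ → E) {t : ℝ} (ht : t ∈ Set.Icc (0 : ℝ) 1) :
    Δ.spline d a t = a (-(d : ℤ))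
      + ∑ j ∈ Finset.Ico (-(d : ℤ) + 1) n, Δ.tail d j t • (a j - a (j - 1)) := by
  have e : ∀ i ∈ Finset.Ico (-(d : ℤ)) n, bspline Δ.x d i t ≠ 0 → a i = a (-(d : ℤ))
      + ∑ j ∈ Finset.Ico (-(d : ℤ) + 1) n, (if j ≤ i then (1 : ℝ) else 0) • (a j - a (j - 1)) := by
    intro i hi _
    simp only [Finset.mem_Ico] at hi
    simp only [ite_smul, one_smul, zero_smul]
    rw [← Finset.sum_filter]
    have : (Finset.Ico (-(d : ℤ) + 1) (n : ℤ)).filter (fun j => j ≤ i)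
        = Finset.Ico (-(d : ℤ) + 1) (i + 1) := by
      ext j; simp only [Finset.mem_filter, Finset.mem_Ico]; omega
    rw [this, sum_Ico_sub_pred _ (by omega), add_sub_cancel_right, add_sub_cancel_right]
    abel
  rw [Δ.spline_congr e, Δ.spline_add, Δ.spline_const d _ ht]
  congr 1
  simp only [KnotSeq.spline, KnotSeq.tail, Finset.smul_sum, Finset.sum_smul, smul_smul, smul_eq_mul]
  exact Finset.sum_comm

/-- Linear precision after Abel summation. This is why row bounds proportional to the cell widths
add up to a multiple of y - x. -/
theorem KnotSeq.sum_width_mul_tail (hd : 1 ≤ d) {t : ℝ} (ht : t ∈ Set.Icc (0 : ℝ) 1) :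
    ∑ j ∈ Finset.Ico (-(d : ℤ) + 1) n, Δ.width d j * Δ.tail d j t = t := by
  have h := Δ.spline_eq_tail d (Δ.greville d) ht
  rw [Δ.spline_greville hd ht, Δ.greville_left d le_rfl, zero_add] at h
  conv_rhs => rw [h]
  exact Finset.sum_congr rfl fun j _ => mul_comm _ _

end Abel

/-- The mean value of a function over a Greville cell. -/
noncomputable def KnotSeq.mean (d : ℕ) (e : ℝ → ℂ) (j : ℤ) : ℂ :=
  (Δ.width d j)⁻¹ • ∫ t in Δ.greville d (j - 1)..Δ.greville d j, e t

theorem KnotSeq.sum_integral_cell {e : ℝ → ℂ} (he : IntegrableOn e (Set.Icc 0 1)) {j : ℤ}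
    (hj : -(d : ℤ) - 1 ≤ j) :
    ∑ i ∈ Finset.Ico (-(d : ℤ)) (j + 1), ∫ t in Δ.greville (d + 1) (i - 1)..Δ.greville (d + 1) i, e t
      = ∫ t in (0 : ℝ)..Δ.greville (d + 1) j, e t := by
  have hi : ∀ s ∈ Set.Icc (0 : ℝ) 1, ∀ t ∈ Set.Icc (0 : ℝ) 1, IntervalIntegrable e volume s t :=
    fun s hs t ht => (he.mono_set (Set.uIcc_subset_Icc hs ht)).intervalIntegrable
  have h0 : (0 : ℝ) ∈ Set.Icc (0 : ℝ) 1 := by simp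
  have h1 := sum_Ico_sub_pred (fun i => ∫ t in (0 : ℝ)..Δ.greville (d + 1) i, e t)
    (a := -(d : ℤ)) (b := j + 1) (by omega)
  rw [Δ.greville_left (d + 1) (j := -(d : ℤ) - 1) (by push_cast; omega), add_sub_cancel_right,
    intervalIntegral.integral_same, sub_zero] at h1
  rw [← h1]
  refine Finset.sum_congr rfl fun i _ => ?_
  rw [intervalIntegral.integral_interval_sub_left (hi _ h0 _ (Δ.greville_mem _ _))
    (hi _ h0 _ (Δ.greville_mem _ _))]

theorem KnotSeq.integrableOn_spline (hd : 1 ≤ d) (a : ℤ → ℂ) :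
    IntegrableOn (Δ.spline d a) (Set.Icc 0 1) :=
  (Δ.continuousOn_spline hd a).integrableOn_Icc

/-- The increments of the coefficients of `V f` in terms of the cell means of `f - V f`. -/
theorem KnotSeq.KernelBound.exists_repr {C : ℝ} (hC : Δ.KernelBound d C) (hd : 1 ≤ d) :
    ∃ J : ℤ → ℤ → ℝ,
      (∀ j ∈ Finset.Ico (-(d : ℤ) + 1) n,
        ∑ i ∈ Finset.Ico (-(d : ℤ)) n, |J j i| ≤ C * Δ.width d j) ∧
      (∀ i ∈ Finset.Ico (-(d : ℤ)) n,
        ∑ j ∈ Finset.Ico (-(d : ℤ) + 1) n, |J j i| ≤ C * Δ.width (d + 1) i) ∧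
      ∀ (e : ℝ → ℂ) (a : ℤ → ℂ), IntegrableOn e (Set.Icc 0 1) →
        (∀ j ∈ Finset.Ico (-(d : ℤ)) n, a j = Δ.mean (d + 1) (fun t => Δ.spline d a t + e t) j) →
        ∀ j ∈ Finset.Ico (-(d : ℤ) + 1) n,
          a j - a (j - 1) = ∑ i ∈ Finset.Ico (-(d : ℤ)) n, J j i • Δ.mean (d + 1) e i := by
  obtain ⟨G, hG, h1, h2⟩ := hC
  refine ⟨fun j i => Δ.jump (d + 1) (G i) j, h1, h2, fun e a he ha j hj => ?_⟩
  have hn := Δ.one_le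
  have hf : IntegrableOn (fun t => Δ.spline d a t + e t) (Set.Icc 0 1) :=
    (Δ.integrableOn_spline hd a).add he
  have hw : ∀ i ∈ Finset.Ico (-(d : ℤ)) n, Δ.width (d + 1) i ≠ 0 := fun i hi => by
    simp only [Finset.mem_Ico] at hi
    exact (Δ.width_pos (by omega) (by push_cast; omega) hi.2).ne'
  have hmean : ∀ g : ℝ → ℂ, IntegrableOn g (Set.Icc 0 1) → ∀ j : ℤ, -(d : ℤ) - 1 ≤ j → j < n →
      ∑ i ∈ Finset.Ico (-(d : ℤ)) (j + 1), Δ.width (d + 1) i • Δ.mean (d + 1) g i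
        = ∫ t in (0 : ℝ)..Δ.greville (d + 1) j, g t := by
    intro g hg j hj hj'
    rw [← Δ.sum_integral_cell hg hj]
    refine Finset.sum_congr rfl fun i hi => ?_
    simp only [Finset.mem_Ico] at hi
    rw [KnotSeq.mean, smul_inv_smul₀ (hw i (by simp only [Finset.mem_Ico]; omega))]
  -- F_j is the integral of f = Vf + e up to ξ_j. Its slopes are the coefficients a, so the spline
  -- with coefficients F is a primitive of Vf and the increments of a are jumps of F.
  set F : ℤ → ℂ := fun j => ∑ i ∈ Finset.Ico (-(d : ℤ)) (j + 1), Δ.width (d + 1) i • a i with hF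
  have hF0 : F (-((d + 1 : ℕ) : ℤ)) = 0 := by
    simp only [hF]
    rw [Finset.Ico_eq_empty (by push_cast; omega), Finset.sum_empty]
  have hFs : ∀ i ∈ Finset.Ico (-(d : ℤ)) n, Δ.slope (d + 1) F i = a i := by
    intro i hi
    have hi' := Finset.mem_Ico.1 hi
    have : Finset.Ico (-(d : ℤ)) (i + 1) = insert i (Finset.Ico (-(d : ℤ)) i) := by
      ext l; simp only [Finset.mem_Ico, Finset.mem_insert]; omega
    rw [KnotSeq.slope]
    simp only [hF]
    rw [this, Finset.sum_insert (by simp), sub_add_cancel, add_sub_cancel_right,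
      inv_smul_smul₀ (hw i hi)]
  have hFint : ∀ j : ℤ, -(d : ℤ) - 1 ≤ j → j < n →
      F j = ∫ t in (0 : ℝ)..Δ.greville (d + 1) j, (Δ.spline d a t + e t) := by
    intro j hj hj'
    rw [← hmean _ hf j hj hj']
    refine Finset.sum_congr rfl fun i hi => ?_
    simp only [Finset.mem_Ico] at hi
    rw [ha i (by simp only [Finset.mem_Ico]; omega)]
  have h0 : (0 : ℝ) ∈ Set.Icc (0 : ℝ) 1 := by simp
  have hint : ∀ j : ℤ, ∫ t in (0 : ℝ)..Δ.greville (d + 1) j, Δ.spline d a t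
      = Δ.spline (d + 1) F (Δ.greville (d + 1) j) := by
    intro j
    have := Δ.integral_spline hd F h0 (Δ.greville_mem (d + 1) j)
    rw [Δ.spline_at_zero (by omega), hF0, sub_zero] at this
    rw [← this]
    exact intervalIntegral.integral_congr fun t _ => Δ.spline_congr fun i hi _ => (hFs i hi).symm
  have heq : ∀ j : ℤ, -(d : ℤ) - 1 ≤ j → j < n →
      F j - Δ.spline (d + 1) F (Δ.greville (d + 1) j)
        = ∑ i ∈ Finset.Ico (-(d : ℤ)) (j + 1), Δ.width (d + 1) i • Δ.mean (d + 1) e i := by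
    intro j hj hj'
    have hs := Set.uIcc_subset_Icc h0 (Δ.greville_mem (d + 1) j)
    rw [hmean e he j hj hj', hFint j hj hj', intervalIntegral.integral_add
      ((Δ.integrableOn_spline hd a).mono_set hs).intervalIntegrable
      (he.mono_set hs).intervalIntegrable, hint j, add_sub_cancel_left]
  -- The spline interpolates F at the right end, so e has integral 0 over [0, 1].
  have hb : ∑ i ∈ Finset.Ico (-(d : ℤ)) n, Δ.width (d + 1) i • Δ.mean (d + 1) e i = 0 := by
    have := heq (n - 1) (by omega) (by omega)
    rw [Δ.greville_right (by omega) le_rfl, Δ.spline_at_one (by omega), sub_self,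
      sub_add_cancel] at this
    exact this.symm
  -- Subtracting the linear sequence with the same end values makes c vanish at both ends and
  -- changes neither the defects nor the jumps.
  set c : ℤ → ℂ := fun j => F j - Δ.greville (d + 1) j • F (n - 1) with hc
  have key := hG.jump_eq hd (c := c) hb
    (by simp only [hc]; rw [hF0, Δ.greville_left _ le_rfl, zero_smul, sub_zero])
    (by simp only [hc]; rw [Δ.greville_right (by omega) le_rfl, one_smul, sub_self])
    (fun j hj => by
      simp only [Finset.mem_Ioo] at hj
      push_cast at hj
      rw [← heq j (by omega) (by omega), hc, Δ.spline_sub, Δ.spline_smul_const,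
        Δ.spline_greville (by omega) (Δ.greville_mem _ _)]
      ring) hj
  rw [← key]
  have hcs : ∀ i ∈ Finset.Ico (-(d : ℤ)) n, Δ.slope (d + 1) c i = a i - F (n - 1) := by
    intro i hi
    rw [← hFs i hi, KnotSeq.slope, KnotSeq.slope]
    have e1 : c i - c (i - 1) = (F i - F (i - 1)) - Δ.width (d + 1) i • F (n - 1) := by
      simp only [hc, KnotSeq.width]; module
    rw [e1, smul_sub, inv_smul_smul₀ (hw i hi)]
  simp only [Finset.mem_Ico] at hj
  rw [KnotSeq.jump, hcs j (by simp only [Finset.mem_Ico]; omega),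
    hcs (j - 1) (by simp only [Finset.mem_Ico]; omega)]
  ring

end SplineLower

namespace SplineLower

variable {n : ℕ} (Δ : KnotSeq n) {d : ℕ}

/-! ### The `L^p` estimate of the increments -/

theorem KnotSeq.measurable_tail (d : ℕ) (j : ℤ) : Measurable (Δ.tail d j) := by
  unfold KnotSeq.tail KnotSeq.spline
  exact Finset.measurable_sum _ fun i _ => (measurable_bspline Δ.x d i).mul_const _

theorem KnotSeq.intervalIntegrable_tail (d : ℕ) (j : ℤ) {s t : ℝ} (hs : s ∈ Set.Icc (0 : ℝ) 1)
    (ht : t ∈ Set.Icc (0 : ℝ) 1) : IntervalIntegrable (Δ.tail d j) volume s t :=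
  ((Δ.monotoneOn_tail d j).mono (Set.uIcc_subset_Icc hs ht)).intervalIntegrable

/-- The integral telescopes to that of the tail over [1-h, 1] minus that over [0, h], and the tail
has values in [0, 1]. -/
theorem KnotSeq.integral_tail_sub_le (d : ℕ) (j : ℤ) {h : ℝ} (h0 : 0 ≤ h) (h1 : h ≤ 1) :
    ∫ t in (0 : ℝ)..1 - h, (Δ.tail d j (t + h) - Δ.tail d j t) ≤ h := by
  have z0 : (0 : ℝ) ∈ Set.Icc (0 : ℝ) 1 := by simp
  have z1 : (1 : ℝ) ∈ Set.Icc (0 : ℝ) 1 := by simp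
  have zh : h ∈ Set.Icc (0 : ℝ) 1 := ⟨h0, h1⟩
  have zh' : 1 - h ∈ Set.Icc (0 : ℝ) 1 := ⟨by linarith, by linarith⟩
  have hi : ∀ {s t : ℝ}, s ∈ Set.Icc (0 : ℝ) 1 → t ∈ Set.Icc (0 : ℝ) 1 →
    IntervalIntegrable (Δ.tail d j) volume s t := fun hs ht => Δ.intervalIntegrable_tail d j hs ht
  have hsh : IntervalIntegrable (fun t => Δ.tail d j (t + h)) volume 0 (1 - h) := by
    have := (hi zh z1).comp_add_right h
    simpa using this
  have e : ∫ t in (0 : ℝ)..1 - h, Δ.tail d j (t + h) = ∫ t in h..1, Δ.tail d j t := by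
    rw [intervalIntegral.integral_comp_add_right, zero_add, sub_add_cancel]
  rw [intervalIntegral.integral_sub hsh (hi z0 zh'), e]
  have e1 := intervalIntegral.integral_add_adjacent_intervals (hi z0 zh) (hi zh z1)
  have e2 := intervalIntegral.integral_add_adjacent_intervals (hi z0 zh') (hi zh' z1)
  have b1 : 0 ≤ ∫ t in (0 : ℝ)..h, Δ.tail d j t :=
    intervalIntegral.integral_nonneg h0 fun t ht => (Δ.tail_mem d j ⟨ht.1, ht.2.trans h1⟩).1
  have b2 : ∫ t in (1 - h)..1, Δ.tail d j t ≤ ∫ t in (1 - h)..1, (1 : ℝ) :=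
    intervalIntegral.integral_mono_on (by linarith) (hi zh' z1) (by simp)
      fun t ht => (Δ.tail_mem d j ⟨by linarith [ht.1], ht.2⟩).2
  rw [intervalIntegral.integral_const, smul_eq_mul, mul_one] at b2
  linarith

/-- Nonnegative weights that control the increments of `V f` by the cell means of `f - V f`. -/
theorem KnotSeq.KernelBound.exists_weights {C : ℝ} (hC : Δ.KernelBound d C) (hd : 1 ≤ d) :
    ∃ κ : ℤ → ℝ → ℝ → ℝ,
      (∀ i, ∀ x ∈ Set.Icc (0 : ℝ) 1, ∀ y ∈ Set.Icc (0 : ℝ) 1, x ≤ y → 0 ≤ κ i x y) ∧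
      (∀ i h, Measurable fun x => κ i x (x + h)) ∧
      (∀ x ∈ Set.Icc (0 : ℝ) 1, ∀ y ∈ Set.Icc (0 : ℝ) 1, x ≤ y →
        ∑ i ∈ Finset.Ico (-(d : ℤ)) n, κ i x y ≤ C * (y - x)) ∧
      (∀ i ∈ Finset.Ico (-(d : ℤ)) n, ∀ h ∈ Set.Icc (0 : ℝ) 1,
        ∫⁻ x in Set.Icc (0 : ℝ) (1 - h), ENNReal.ofReal (κ i x (x + h))
          ≤ ENNReal.ofReal (C * h * Δ.width (d + 1) i)) ∧
      ∀ (e : ℝ → ℂ) (a : ℤ → ℂ), IntegrableOn e (Set.Icc 0 1) →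
        (∀ j ∈ Finset.Ico (-(d : ℤ)) n, a j = Δ.mean (d + 1) (fun t => Δ.spline d a t + e t) j) →
        ∀ x ∈ Set.Icc (0 : ℝ) 1, ∀ y ∈ Set.Icc (0 : ℝ) 1, x ≤ y →
          ‖Δ.spline d a y - Δ.spline d a x‖
            ≤ ∑ i ∈ Finset.Ico (-(d : ℤ)) n, κ i x y * ‖Δ.mean (d + 1) e i‖ := by
  obtain ⟨J, hrow, hcol, hrep⟩ := hC.exists_repr Δ hd
  have hmono : ∀ j, ∀ x ∈ Set.Icc (0 : ℝ) 1, ∀ y ∈ Set.Icc (0 : ℝ) 1, x ≤ y →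
      0 ≤ Δ.tail d j y - Δ.tail d j x := fun j x hx y hy hxy =>
    sub_nonneg.2 (Δ.monotoneOn_tail d j hx hy hxy)
  refine ⟨fun i x y => ∑ j ∈ Finset.Ico (-(d : ℤ) + 1) n, |J j i| * (Δ.tail d j y - Δ.tail d j x),
    fun i x hx y hy hxy => Finset.sum_nonneg fun j _ => mul_nonneg (abs_nonneg _)
      (hmono j x hx y hy hxy), fun i h => ?_, fun x hx y hy hxy => ?_, fun i hi h hh => ?_,
    fun e a he ha x hx y hy hxy => ?_⟩
  · exact Finset.measurable_sum _ fun j _ => measurable_const.mul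
      (((Δ.measurable_tail d j).comp (measurable_id.add_const h)).sub (Δ.measurable_tail d j))
  · rw [Finset.sum_comm]
    calc _ = ∑ j ∈ Finset.Ico (-(d : ℤ) + 1) n, (∑ i ∈ Finset.Ico (-(d : ℤ)) n, |J j i|)
          * (Δ.tail d j y - Δ.tail d j x) :=
          Finset.sum_congr rfl fun j _ => (Finset.sum_mul _ _ _).symm
      _ ≤ ∑ j ∈ Finset.Ico (-(d : ℤ) + 1) n, C * Δ.width d j
          * (Δ.tail d j y - Δ.tail d j x) :=
          Finset.sum_le_sum fun j hj => mul_le_mul_of_nonneg_right (hrow j hj)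
            (hmono j x hx y hy hxy)
      _ = C * (∑ j ∈ Finset.Ico (-(d : ℤ) + 1) n, Δ.width d j * Δ.tail d j y
          - ∑ j ∈ Finset.Ico (-(d : ℤ) + 1) n, Δ.width d j * Δ.tail d j x) := by
          rw [← Finset.sum_sub_distrib, Finset.mul_sum]
          exact Finset.sum_congr rfl fun j _ => by ring
      _ = _ := by rw [Δ.sum_width_mul_tail hd hy, Δ.sum_width_mul_tail hd hx]
  · have z0 : (0 : ℝ) ∈ Set.Icc (0 : ℝ) 1 := by simp
    have z1 : (1 : ℝ) ∈ Set.Icc (0 : ℝ) 1 := by simp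
    have zh' : 1 - h ∈ Set.Icc (0 : ℝ) 1 := ⟨by linarith [hh.2], by linarith [hh.1]⟩
    have hint : ∀ j, IntervalIntegrable (fun t => Δ.tail d j (t + h) - Δ.tail d j t) volume 0 (1 - h) := by
      intro j
      have := (Δ.intervalIntegrable_tail d j hh z1).comp_add_right h
      rw [sub_self] at this
      exact this.sub (Δ.intervalIntegrable_tail d j z0 zh')
    have hint2 : IntervalIntegrable (fun t => ∑ j ∈ Finset.Ico (-(d : ℤ) + 1) n,
        |J j i| * (Δ.tail d j (t + h) - Δ.tail d j t)) volume 0 (1 - h) := by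
      have := IntervalIntegrable.sum (Finset.Ico (-(d : ℤ) + 1) (n : ℤ))
        fun j _ => (hint j).const_mul |J j i|
      rw [Finset.sum_fn] at this
      exact this
    rw [← restrict_Ioc_eq_restrict_Icc, ← ofReal_integral_eq_lintegral_ofReal]
    · refine ENNReal.ofReal_le_ofReal ?_
      rw [← intervalIntegral.integral_of_le zh'.1,
        intervalIntegral.integral_finsetSum fun j _ => (hint j).const_mul _]
      calc _ ≤ ∑ j ∈ Finset.Ico (-(d : ℤ) + 1) n, |J j i| * h := by
            refine Finset.sum_le_sum fun j _ => ?_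
            rw [intervalIntegral.integral_const_mul]
            exact mul_le_mul_of_nonneg_left (Δ.integral_tail_sub_le d j hh.1 hh.2) (abs_nonneg _)
        _ ≤ C * Δ.width (d + 1) i * h := by
            rw [← Finset.sum_mul]
            exact mul_le_mul_of_nonneg_right (hcol i hi) hh.1
        _ = _ := by ring
    · exact (intervalIntegrable_iff_integrableOn_Ioc_of_le zh'.1).1 hint2
    · refine (ae_restrict_iff' measurableSet_Ioc).2 (ae_of_all _ fun x hx => ?_)
      exact Finset.sum_nonneg fun j _ => mul_nonneg (abs_nonneg _) (hmono j x
        ⟨hx.1.le, by linarith [hx.2, hh.1]⟩ (x + h) ⟨by linarith [hx.1, hh.1], by linarith [hx.2]⟩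
        (by linarith [hh.1]))
  · rw [Δ.spline_eq_tail d a hx, Δ.spline_eq_tail d a hy, add_sub_add_left_eq_sub,
      ← Finset.sum_sub_distrib]
    calc _ = ‖∑ j ∈ Finset.Ico (-(d : ℤ) + 1) n, (Δ.tail d j y - Δ.tail d j x) •
          ∑ i ∈ Finset.Ico (-(d : ℤ)) n, J j i • Δ.mean (d + 1) e i‖ := by
          congr 1
          exact Finset.sum_congr rfl fun j hj => by rw [← sub_smul, hrep e a he ha j hj]
      _ ≤ ∑ j ∈ Finset.Ico (-(d : ℤ) + 1) n, (Δ.tail d j y - Δ.tail d j x) *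
          ∑ i ∈ Finset.Ico (-(d : ℤ)) n, |J j i| * ‖Δ.mean (d + 1) e i‖ := by
          refine (norm_sum_le _ _).trans (Finset.sum_le_sum fun j _ => ?_)
          rw [norm_smul, Real.norm_of_nonneg (hmono j x hx y hy hxy)]
          refine mul_le_mul_of_nonneg_left ((norm_sum_le _ _).trans (le_of_eq ?_))
            (hmono j x hx y hy hxy)
          exact Finset.sum_congr rfl fun i _ => by rw [norm_smul, Real.norm_eq_abs]
      _ = _ := by
          simp only [Finset.mul_sum, Finset.sum_mul]
          rw [Finset.sum_comm]
          exact Finset.sum_congr rfl fun i _ => Finset.sum_congr rfl fun j _ => by ring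

/-- Jensen's inequality on a Greville cell. -/
theorem KnotSeq.width_mul_mean_le {e : ℝ → ℂ} (he : IntegrableOn e (Set.Icc 0 1)) {q : ℝ}
    (hq : 1 ≤ q) {i : ℤ} (hd : 1 ≤ d) (h1 : -(d : ℤ) < i) (h2 : i < n) :
    ENNReal.ofReal (Δ.width d i) * ‖Δ.mean d e i‖ₑ ^ q
      ≤ ∫⁻ t in Set.Ioc (Δ.greville d (i - 1)) (Δ.greville d i), ‖e t‖ₑ ^ q := by
  have hw := Δ.width_pos hd h1 h2
  set s := Set.Ioc (Δ.greville d (i - 1)) (Δ.greville d i) with hs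
  have hle : Δ.greville d (i - 1) ≤ Δ.greville d i := Δ.greville_mono d (by omega)
  have hsub : s ⊆ Set.Icc 0 1 := fun t ht =>
    ⟨(Δ.greville_mem d _).1.trans ht.1.le, ht.2.trans (Δ.greville_mem d _).2⟩
  have hes : AEStronglyMeasurable e (volume.restrict s) := (he.mono_set hsub).aestronglyMeasurable
  have hvol : volume.restrict s Set.univ = ENNReal.ofReal (Δ.width d i) := by
    rw [Measure.restrict_apply_univ, hs, Real.volume_Ioc, KnotSeq.width]
  have hol := eLpNorm'_le_eLpNorm'_mul_rpow_measure_univ (p := 1) (q := q) zero_lt_one hq hes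
  rw [hvol] at hol
  set w := ENNReal.ofReal (Δ.width d i) with hwdef
  have hw0 : w ≠ 0 := by rw [hwdef]; simpa using hw
  have hwt : w ≠ ∞ := ENNReal.ofReal_ne_top
  have hq0 : 0 < q := by linarith
  simp only [eLpNorm'] at hol
  rw [div_one, ENNReal.rpow_one] at hol
  simp only [ENNReal.rpow_one] at hol
  have hm : w * ‖Δ.mean d e i‖ₑ ≤ ∫⁻ t in s, ‖e t‖ₑ := by
    rw [KnotSeq.mean, intervalIntegral.integral_of_le hle, enorm_smul, Real.enorm_eq_ofReal
      (inv_nonneg.2 hw.le), ENNReal.ofReal_inv_of_pos hw, ← mul_assoc, ENNReal.mul_inv_cancel hw0 hwt,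
      one_mul]
    exact enorm_integral_le_lintegral_enorm _
  have h3 : (w * ‖Δ.mean d e i‖ₑ) ^ q ≤ (∫⁻ t in s, ‖e t‖ₑ ^ q) * w ^ (q - 1) := by
    refine (ENNReal.rpow_le_rpow (hm.trans hol) hq0.le).trans (le_of_eq ?_)
    rw [ENNReal.mul_rpow_of_nonneg _ _ hq0.le, ← ENNReal.rpow_mul, ← ENNReal.rpow_mul,
      one_div_mul_cancel hq0.ne', ENNReal.rpow_one]
    congr 2
    field_simp
  rw [ENNReal.mul_rpow_of_nonneg _ _ hq0.le, show q = (q - 1) + 1 by ring,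
    ENNReal.rpow_add _ _ hw0 hwt, ENNReal.rpow_one, mul_assoc, mul_comm (w ^ (q - 1)),
    show (q - 1) + 1 = q by ring] at h3
  refine (ENNReal.mul_le_mul_iff_left ?_ ?_).1 h3
  · exact (ENNReal.rpow_pos (pos_iff_ne_zero.2 hw0) hwt).ne'
  · exact ENNReal.rpow_ne_top_of_nonneg (by linarith) hwt

theorem KnotSeq.sum_lintegral_cell_le (d : ℕ) (φ : ℝ → ℝ≥0∞) (s : Finset ℤ) :
    ∑ i ∈ s, ∫⁻ t in Set.Ioc (Δ.greville d (i - 1)) (Δ.greville d i), φ t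
      ≤ ∫⁻ t in Set.Icc (0 : ℝ) 1, φ t := by
  rw [← lintegral_biUnion_finset]
  · refine lintegral_mono_set ?_
    refine Set.iUnion₂_subset fun i _ t ht => ?_
    exact ⟨(Δ.greville_mem d _).1.trans ht.1.le, ht.2.trans (Δ.greville_mem d _).2⟩
  · exact fun i _ j _ hij => (Δ.greville_mono d).pairwise_disjoint_on_Ioc_pred hij
  · exact fun i _ => measurableSet_Ioc

/-- The increments of `V f` in `L^q`. -/
theorem KnotSeq.KernelBound.lintegral_le {C : ℝ} (hC : Δ.KernelBound d C) (hC0 : 0 ≤ C) (hd : 1 ≤ d)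
    {e : ℝ → ℂ} {a : ℤ → ℂ} (he : IntegrableOn e (Set.Icc 0 1))
    (ha : ∀ j ∈ Finset.Ico (-(d : ℤ)) n, a j = Δ.mean (d + 1) (fun t => Δ.spline d a t + e t) j)
    {q : ℝ} (hq : 1 ≤ q) {h : ℝ} (hh : h ∈ Set.Icc (0 : ℝ) 1) :
    ∫⁻ x in Set.Icc (0 : ℝ) (1 - h), ‖Δ.spline d a (x + h) - Δ.spline d a x‖ₑ ^ q
      ≤ ENNReal.ofReal (C * h) ^ q * ∫⁻ t in Set.Icc (0 : ℝ) 1, ‖e t‖ₑ ^ q := by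
  obtain ⟨κ, h0, hmeas, hrow, hcol, hrep⟩ := hC.exists_weights Δ hd
  have hq0 : 0 < q := by linarith
  have hq1 : 0 ≤ q - 1 := by linarith
  set B : ℤ → ℝ≥0∞ := fun i => ‖Δ.mean (d + 1) e i‖ₑ with hB
  set k : ℤ → ℝ → ℝ≥0∞ := fun i x => ENNReal.ofReal (κ i x (x + h)) with hk
  have hkm : ∀ i, Measurable (k i) := fun i => (hmeas i h).ennreal_ofReal
  set S := Finset.Ico (-(d : ℤ)) (n : ℤ) with hS
  have point : ∀ x ∈ Set.Icc (0 : ℝ) (1 - h),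
      ‖Δ.spline d a (x + h) - Δ.spline d a x‖ₑ ^ q
        ≤ ENNReal.ofReal (C * h) ^ (q - 1) * ∑ i ∈ S, k i x * B i ^ q := by
    intro x hx
    have hx' : x ∈ Set.Icc (0 : ℝ) 1 := ⟨hx.1, by linarith [hx.2, hh.1]⟩
    have hy : x + h ∈ Set.Icc (0 : ℝ) 1 := ⟨by linarith [hx.1, hh.1], by linarith [hx.2]⟩
    have hxy : x ≤ x + h := by linarith [hh.1]
    have a1 : ‖Δ.spline d a (x + h) - Δ.spline d a x‖ₑ ≤ ∑ i ∈ S, k i x * B i := by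
      rw [← ofReal_norm]
      refine (ENNReal.ofReal_le_ofReal (hrep e a he ha x hx' _ hy hxy)).trans (le_of_eq ?_)
      rw [ENNReal.ofReal_sum_of_nonneg fun i _ => mul_nonneg (h0 i x hx' _ hy hxy) (norm_nonneg _)]
      refine Finset.sum_congr rfl fun i _ => ?_
      rw [ENNReal.ofReal_mul (h0 i x hx' _ hy hxy), ofReal_norm]
    have a2 : ∑ i ∈ S, k i x ≤ ENNReal.ofReal (C * h) := by
      rw [hk, ← ENNReal.ofReal_sum_of_nonneg fun i _ => h0 i x hx' _ hy hxy]
      refine ENNReal.ofReal_le_ofReal ((hrow x hx' _ hy hxy).trans (le_of_eq ?_))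
      ring
    -- Hölder with respect to the weights: (∑ kB)^q ≤ (∑ k)^{q-1} ∑ k B^q. The row bound controls
    -- the first factor and the column bound the integral of the second, which is Schur's test.
    have a3 := a1.trans (ENNReal.inner_le_weight_mul_Lp_of_nonneg S hq (fun i => k i x) B)
    refine (ENNReal.rpow_le_rpow a3 hq0.le).trans ?_
    rw [ENNReal.mul_rpow_of_nonneg _ _ hq0.le, ← ENNReal.rpow_mul, ← ENNReal.rpow_mul,
      inv_mul_cancel₀ hq0.ne', ENNReal.rpow_one, sub_mul, one_mul, inv_mul_cancel₀ hq0.ne']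
    exact mul_le_mul_left (ENNReal.rpow_le_rpow a2 hq1) _
  have hCh : 0 ≤ C * h := mul_nonneg hC0 hh.1
  calc _ ≤ ∫⁻ x in Set.Icc (0 : ℝ) (1 - h),
        ENNReal.ofReal (C * h) ^ (q - 1) * ∑ i ∈ S, k i x * B i ^ q :=
        setLIntegral_mono' measurableSet_Icc point
    _ = ENNReal.ofReal (C * h) ^ (q - 1) * ∑ i ∈ S,
        (∫⁻ x in Set.Icc (0 : ℝ) (1 - h), k i x) * B i ^ q := by
        rw [lintegral_const_mul _ (Finset.measurable_sum _ fun i _ => (hkm i).mul_const _),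
          lintegral_finsetSum _ fun i _ => (hkm i).mul_const _]
        congr 1
        exact Finset.sum_congr rfl fun i _ => lintegral_mul_const _ (hkm i)
    _ ≤ ENNReal.ofReal (C * h) ^ (q - 1) * ∑ i ∈ S, ENNReal.ofReal (C * h) *
        ∫⁻ t in Set.Ioc (Δ.greville (d + 1) (i - 1)) (Δ.greville (d + 1) i), ‖e t‖ₑ ^ q := by
        refine mul_le_mul_right (Finset.sum_le_sum fun i hi => ?_) _
        have hi' := Finset.mem_Ico.1 hi
        refine (mul_le_mul_left (hcol i hi h hh) _).trans ?_
        rw [ENNReal.ofReal_mul hCh, mul_assoc]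
        exact mul_le_mul_right (Δ.width_mul_mean_le he hq (by omega) (by push_cast; omega) hi'.2) _
    _ ≤ ENNReal.ofReal (C * h) ^ (q - 1) * (ENNReal.ofReal (C * h) *
        ∫⁻ t in Set.Icc (0 : ℝ) 1, ‖e t‖ₑ ^ q) := by
        rw [← Finset.mul_sum]
        exact mul_le_mul_right (mul_le_mul_right (Δ.sum_lintegral_cell_le _ _ _) _) _
    _ = _ := by
        rw [← mul_assoc]
        congr 1
        conv_lhs => rw [← ENNReal.rpow_one (ENNReal.ofReal (C * h)), ← ENNReal.rpow_mul, one_mul]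
        rw [← ENNReal.rpow_add_of_nonneg _ _ hq1 zero_le_one, sub_add_cancel]

/-- The increments of `V f` in the sup norm. -/
theorem KnotSeq.KernelBound.norm_sub_le {C : ℝ} (hC : Δ.KernelBound d C) (hd : 1 ≤ d)
    {e : ℝ → ℂ} {a : ℤ → ℂ} (he : IntegrableOn e (Set.Icc 0 1))
    (ha : ∀ j ∈ Finset.Ico (-(d : ℤ)) n, a j = Δ.mean (d + 1) (fun t => Δ.spline d a t + e t) j)
    {M : ℝ} (hM : ∀ t ∈ Set.Icc (0 : ℝ) 1, ‖e t‖ ≤ M) {x y : ℝ} (hx : x ∈ Set.Icc (0 : ℝ) 1)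
    (hy : y ∈ Set.Icc (0 : ℝ) 1) (hxy : x ≤ y) :
    ‖Δ.spline d a y - Δ.spline d a x‖ ≤ C * (y - x) * M := by
  obtain ⟨κ, h0, -, hrow, -, hrep⟩ := hC.exists_weights Δ hd
  have hM0 : 0 ≤ M := (norm_nonneg _).trans (hM 0 (by simp))
  refine (hrep e a he ha x hx y hy hxy).trans ?_
  refine le_trans ?_ (mul_le_mul_of_nonneg_right (hrow x hx y hy hxy) hM0)
  rw [Finset.sum_mul]
  refine Finset.sum_le_sum fun i hi => mul_le_mul_of_nonneg_left ?_ (h0 i x hx y hy hxy)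
  have hi' := Finset.mem_Ico.1 hi
  have hw := Δ.width_pos (d := d + 1) (j := i) (by omega) (by push_cast; omega) hi'.2
  rw [KnotSeq.mean, norm_smul, norm_inv, Real.norm_of_nonneg hw.le, inv_mul_le_iff₀ hw]
  have := intervalIntegral.norm_integral_le_of_norm_le_const (a := Δ.greville (d + 1) (i - 1))
    (b := Δ.greville (d + 1) i) (C := M) (f := e) fun t ht => hM t
      (Set.uIcc_subset_Icc (Δ.greville_mem _ _) (Δ.greville_mem _ _) (Set.uIoc_subset_uIcc ht))
  rwa [← KnotSeq.width, abs_of_nonneg hw.le, mul_comm] at this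

end SplineLower

namespace SplineLower

/-! ### Spectra -/

/-- Only eigenvalues are ever compared with γ. Completeness gives the boundedness of the spectrum
that the real supremum needs. -/
theorem norm_le_spectralSup {E : Type*} [NormedAddCommGroup E] [NormedSpace ℂ E] [CompleteSpace E]
    (T : E →L[ℂ] E) {z : ℂ} {f : E} (hf : f ≠ 0) (h : T f = z • f) (hz : z ≠ 1) :
    ‖z‖ ≤ spectralSup T := by
  refine le_csSup ⟨‖T‖ * ‖(1 : E →L[ℂ] E)‖, ?_⟩ ⟨z, ?_, hz, rfl⟩
  · rintro _ ⟨w, hw, -, rfl⟩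
    exact spectrum.norm_le_norm_mul_of_mem hw
  · rw [spectrum.mem_iff]
    rintro ⟨u, hu⟩
    apply hf
    have h1 : (u : E →L[ℂ] E) f = 0 := by
      rw [hu]
      simp [Algebra.algebraMap_eq_smul_one, h]
    calc f = ((↑u⁻¹ * ↑u : E →L[ℂ] E)) f := by rw [Units.inv_mul]; rfl
      _ = (↑u⁻¹ : E →L[ℂ] E) ((u : E →L[ℂ] E) f) := rfl
      _ = 0 := by rw [h1, map_zero]

theorem spectralSup_nonneg {E : Type*} [NormedAddCommGroup E] [NormedSpace ℂ E]
    (T : E →L[ℂ] E) : 0 ≤ spectralSup T :=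
  Real.sSup_nonneg (by rintro _ ⟨z, -, -, rfl⟩; exact norm_nonneg z)

variable {n : ℕ} (Δ : KnotSeq n) {k : ℕ}

/-- A spline as an element of `C([0, 1])`. -/
noncomputable def splineC (hk : 1 ≤ k) (c : ℤ → ℂ) : C(Set.Icc (0 : ℝ) 1, ℂ) :=
  ∑ j ∈ Finset.Ico (-(k : ℤ)) n, c j • bsplineC Δ k hk j

theorem splineC_apply (hk : 1 ≤ k) (c : ℤ → ℂ) (t : Set.Icc (0 : ℝ) 1) :
    splineC Δ hk c t = Δ.spline k c t := by
  simp only [splineC, KnotSeq.spline, ContinuousMap.coe_sum, Finset.sum_apply,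
    ContinuousMap.coe_smul, Pi.smul_apply]
  refine Finset.sum_congr rfl fun j _ => ?_
  simp [bsplineC, mul_comm]

theorem schoenberg_apply (hk : 1 ≤ k) (f : C(Set.Icc (0 : ℝ) 1, ℂ)) :
    schoenberg Δ k hk f = splineC Δ hk fun j => f ⟨Δ.greville k j, Δ.greville_mem k j⟩ := by
  simp [schoenberg, splineC]

theorem intSchoenbergC_apply (hk : 1 ≤ k) (f : C(Set.Icc (0 : ℝ) 1, ℂ)) :
    intSchoenbergC Δ k hk f
      = splineC Δ hk (Δ.mean (k + 1) (Set.IccExtend zero_le_one f)) := by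
  simp only [intSchoenbergC, splineC, sum_apply,
    ContinuousLinearMap.smulRight_apply]
  refine Finset.sum_congr rfl fun j _ => ?_
  rw [smul_smul, KnotSeq.mean, KnotSeq.width]
  congr 1
  simp [integralC, mul_comm]

/-- A spline as an element of `L^p([0, 1])`. -/
noncomputable def splineLp (hk : 1 ≤ k) (p : ℝ≥0∞) (c : ℤ → ℂ) : Lp ℂ p unitMeasure :=
  ∑ j ∈ Finset.Ico (-(k : ℤ)) n, c j • bsplineLp Δ k hk p j

theorem coeFn_splineLp (hk : 1 ≤ k) (p : ℝ≥0∞) (c : ℤ → ℂ) :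
    splineLp Δ hk p c =ᵐ[unitMeasure] Δ.spline k c := by
  have h1 := Lp.coeFn_finsetSum (μ := unitMeasure) (p := p) (Finset.Ico (-(k : ℤ)) (n : ℤ))
    fun j => c j • bsplineLp Δ k hk p j
  have h2 : ∀ᵐ t ∂unitMeasure, ∀ j : ℤ, (c j • bsplineLp Δ k hk p j : Lp ℂ p unitMeasure) t
      = c j * (bspline Δ.x k j t : ℂ) := by
    rw [ae_all_iff]
    intro j
    filter_upwards [Lp.coeFn_smul (c j) (bsplineLp Δ k hk p j),
      (bspline_memLp Δ hk j p).coeFn_toLp] with t h3 h4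
    rw [h3, Pi.smul_apply, smul_eq_mul]
    congr 1
  filter_upwards [h1, h2] with t h3 h4
  rw [splineLp, h3, Finset.sum_apply]
  refine Finset.sum_congr rfl fun j _ => ?_
  rw [h4, Complex.real_smul, mul_comm]

theorem KnotSeq.integral_cell_unitMeasure (d : ℕ) (f : ℝ → ℂ) (j : ℤ) :
    ∫ t in Δ.greville d (j - 1)..Δ.greville d j, f t ∂unitMeasure
      = ∫ t in Δ.greville d (j - 1)..Δ.greville d j, f t := by
  have hle : Δ.greville d (j - 1) ≤ Δ.greville d j := Δ.greville_mono d (by omega)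
  rw [intervalIntegral.integral_of_le hle, intervalIntegral.integral_of_le hle,
    Measure.restrict_restrict measurableSet_Ioc, Set.inter_eq_left.2]
  exact fun t ht => ⟨(Δ.greville_mem d _).1.trans ht.1.le, ht.2.trans (Δ.greville_mem d _).2⟩

theorem intSchoenbergLp_apply (hk : 1 ≤ k) (p : ℝ≥0∞) [Fact (1 ≤ p)] (f : Lp ℂ p unitMeasure) :
    intSchoenbergLp Δ k hk p f = splineLp Δ hk p (Δ.mean (k + 1) f) := by
  simp only [intSchoenbergLp, splineLp, sum_apply,
    ContinuousLinearMap.smulRight_apply]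
  refine Finset.sum_congr rfl fun j _ => ?_
  rw [smul_smul, KnotSeq.mean, KnotSeq.width, ← Δ.integral_cell_unitMeasure]
  congr 1
  simp [integralLp, mul_comm]

theorem KnotSeq.mean_congr_ae (d : ℕ) {f g : ℝ → ℂ} (h : f =ᵐ[unitMeasure] g) (j : ℤ) :
    Δ.mean d f j = Δ.mean d g j := by
  rw [KnotSeq.mean, KnotSeq.mean, ← Δ.integral_cell_unitMeasure, ← Δ.integral_cell_unitMeasure]
  congr 1
  exact intervalIntegral.integral_congr_ae (h.mono fun t ht _ => ht)

theorem KnotSeq.mean_congr (d : ℕ) {f g : ℝ → ℂ} (h : ∀ t ∈ Set.Icc (0 : ℝ) 1, f t = g t) (j : ℤ) :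
    Δ.mean d f j = Δ.mean d g j :=
  Δ.mean_congr_ae d ((ae_restrict_iff' measurableSet_Icc).2 (ae_of_all _ h)) j

/-- The spline with coefficients c has the node values z c, so the operator multiplies its
coefficients by z. -/
theorem KnotSeq.eigenBound_schoenberg (hk : 1 ≤ k) :
    Δ.EigenBound k (spectralSup (schoenberg Δ k hk)) := by
  rintro z c hz0 hz1 - - hc ⟨j, hj, hcj⟩
  refine norm_le_spectralSup _ (f := splineC Δ hk c) (fun h => ?_) ?_ hz1
  · have := DFunLike.congr_fun h ⟨Δ.greville k j, Δ.greville_mem k j⟩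
    rw [splineC_apply, hc j hj] at this
    exact mul_ne_zero hz0 hcj this
  · ext t
    rw [schoenberg_apply, splineC_apply, ContinuousMap.smul_apply, splineC_apply, ← Δ.spline_smul]
    refine Δ.spline_congr fun i hi _ => ?_
    rw [splineC_apply]
    exact hc i hi

/-- The derivative of an eigenspline of degree `k + 1` is an eigenfunction of `V`. -/
theorem KnotSeq.mean_eigenspline (hk : 1 ≤ k) {z : ℂ} {c : ℤ → ℂ} (hz0 : z ≠ 0)
    (c0 : c (-((k + 1 : ℕ) : ℤ)) = 0)
    (hc : ∀ j ∈ Finset.Ico (-((k + 1 : ℕ) : ℤ)) n,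
      Δ.spline (k + 1) c (Δ.greville (k + 1) j) = z * c j)
    (hne : ∃ j ∈ Finset.Ico (-((k + 1 : ℕ) : ℤ)) n, c j ≠ 0) :
    (∀ j ∈ Finset.Ico (-(k : ℤ)) n,
      Δ.mean (k + 1) (Δ.spline k (Δ.slope (k + 1) c)) j = z • Δ.slope (k + 1) c j) ∧
    ∃ j ∈ Finset.Ico (-(k : ℤ)) n, Δ.mean (k + 1) (Δ.spline k (Δ.slope (k + 1) c)) j ≠ 0 := by
  have h1 : ∀ j ∈ Finset.Ico (-(k : ℤ)) n,
      Δ.mean (k + 1) (Δ.spline k (Δ.slope (k + 1) c)) j = z • Δ.slope (k + 1) c j := by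
    intro j hj
    simp only [Finset.mem_Ico] at hj
    rw [KnotSeq.mean, Δ.integral_spline hk c (Δ.greville_mem _ _) (Δ.greville_mem _ _),
      hc j (by simp only [Finset.mem_Ico]; omega), hc (j - 1) (by simp only [Finset.mem_Ico]; omega),
      KnotSeq.slope, ← mul_sub, ← smul_eq_mul, smul_comm]
  refine ⟨h1, ?_⟩
  by_contra hcon
  push Not at hcon
  obtain ⟨j, hj, hcj⟩ := hne
  apply hcj
  -- If all means vanished, so would all slopes, and c would keep its left end value 0 throughout.
  have key : ∀ m : ℕ, -((k + 1 : ℕ) : ℤ) + m < n → c (-((k + 1 : ℕ) : ℤ) + m) = 0 := by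
    intro m
    induction m with
    | zero => intro _; simpa using c0
    | succ m ih =>
      intro hm
      push_cast at hm ih
      have hi : -((k : ℤ) + 1) + (m + 1) ∈ Finset.Ico (-(k : ℤ)) n := by
        simp only [Finset.mem_Ico]; omega
      have h2 := hcon _ hi
      rw [h1 _ hi, smul_eq_zero_iff_right hz0] at h2
      simp only [Finset.mem_Ico] at hi
      have h3 := Δ.width_smul_slope (d := k + 1) (by omega) c (j := -((k : ℤ) + 1) + (m + 1))
        (by push_cast; omega) hi.2
      rw [h2, smul_zero, show -((k : ℤ) + 1) + (m + 1) - 1 = -((k : ℤ) + 1) + m by ring,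
        ih (by omega), sub_zero] at h3
      push_cast
      exact h3.symm
  simp only [Finset.mem_Ico] at hj
  have := key (j + (k + 1 : ℕ)).toNat (by omega)
  rwa [show -((k + 1 : ℕ) : ℤ) + ((j + (k + 1 : ℕ)).toNat : ℤ) = j by omega] at this

/-- Differentiating an eigenspline of degree k+1 yields an eigenfunction of V with the same
eigenvalue. So γ(V) controls the very degree in which the discrete problem lives. -/
theorem KnotSeq.eigenBound_intSchoenbergC (hk : 1 ≤ k) :
    Δ.EigenBound (k + 1) (spectralSup (intSchoenbergC Δ k hk)) := by
  rintro z c hz0 hz1 c0 - hc hne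
  obtain ⟨h1, j, -, hj'⟩ := Δ.mean_eigenspline hk hz0 c0 hc hne
  have hm : ∀ i, Δ.mean (k + 1)
      (Set.IccExtend zero_le_one (splineC Δ hk (Δ.slope (k + 1) c))) i
      = Δ.mean (k + 1) (Δ.spline k (Δ.slope (k + 1) c)) i := fun i =>
    Δ.mean_congr _ (fun t ht => by
      rw [Set.IccExtend_of_mem _ _ ht, splineC_apply]) i
  refine norm_le_spectralSup _ (f := splineC Δ hk (Δ.slope (k + 1) c)) (fun h => ?_) ?_ hz1
  · rw [← hm, h] at hj'
    exact hj' (by simp [KnotSeq.mean, Set.IccExtend])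
  · ext t
    rw [intSchoenbergC_apply, splineC_apply, ContinuousMap.smul_apply, splineC_apply,
      ← Δ.spline_smul]
    exact Δ.spline_congr fun i hi _ => by rw [hm, h1 i hi]

theorem KnotSeq.eigenBound_intSchoenbergLp (hk : 1 ≤ k) (p : ℝ≥0∞) [Fact (1 ≤ p)] :
    Δ.EigenBound (k + 1) (spectralSup (intSchoenbergLp Δ k hk p)) := by
  rintro z c hz0 hz1 c0 - hc hne
  obtain ⟨h1, j, -, hj'⟩ := Δ.mean_eigenspline hk hz0 c0 hc hne
  have hm : ∀ i, Δ.mean (k + 1) (splineLp Δ hk p (Δ.slope (k + 1) c)) i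
      = Δ.mean (k + 1) (Δ.spline k (Δ.slope (k + 1) c)) i := fun i =>
    Δ.mean_congr_ae _ (coeFn_splineLp Δ hk p _) i
  refine norm_le_spectralSup _ (f := splineLp Δ hk p (Δ.slope (k + 1) c)) (fun h => ?_) ?_ hz1
  · rw [← hm, h, Δ.mean_congr_ae _ (Lp.coeFn_zero ℂ p unitMeasure)] at hj'
    exact hj' (by simp [KnotSeq.mean])
  · rw [intSchoenbergLp_apply, funext hm, splineLp, splineLp, Finset.smul_sum]
    exact Finset.sum_congr rfl fun i hi => by rw [h1 i hi, smul_assoc]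

end SplineLower

namespace SplineLower

variable {n : ℕ} (Δ : KnotSeq n) {k : ℕ}

/-! ### Moduli of smoothness -/

theorem shiftDomain_of_nonneg {h : ℝ} (h0 : 0 ≤ h) : shiftDomain h = Set.Icc 0 (1 - h) := by
  ext x
  constructor
  · rintro ⟨hx, hs⟩
    have := hs 1 (by simp)
    exact ⟨hx.1, by linarith [this.2]⟩
  · rintro ⟨hx0, hx1⟩
    exact ⟨⟨hx0, by linarith⟩, fun s hs => ⟨by have := mul_nonneg hs.1 h0; linarith,
      by nlinarith [hs.2]⟩⟩

theorem shiftDomain_neg_of_nonneg {h : ℝ} (h0 : 0 ≤ h) : shiftDomain (-h) = Set.Icc h 1 := by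
  ext x
  constructor
  · rintro ⟨hx, hs⟩
    have := hs 1 (by simp)
    exact ⟨by linarith [this.1], hx.2⟩
  · rintro ⟨hx0, hx1⟩
    exact ⟨⟨by linarith, hx1⟩, fun s hs => ⟨by nlinarith [hs.2],
      by have := mul_nonneg hs.1 h0; linarith⟩⟩

theorem setLIntegral_Icc_add (φ : ℝ → ℝ≥0∞) (h : ℝ) :
    ∫⁻ x in Set.Icc 0 (1 - h), φ (x + h) = ∫⁻ x in Set.Icc h 1, φ x := by
  rw [← lintegral_indicator measurableSet_Icc, ← lintegral_indicator measurableSet_Icc,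
    ← lintegral_add_right_eq_self ((Set.Icc h 1).indicator φ) h]
  refine lintegral_congr fun x => ?_
  by_cases hx : x ∈ Set.Icc 0 (1 - h)
  · rw [Set.indicator_of_mem hx, Set.indicator_of_mem]
    exact ⟨by linarith [hx.1], by linarith [hx.2]⟩
  · rw [Set.indicator_of_notMem hx, Set.indicator_of_notMem]
    exact fun hx' => hx ⟨by linarith [hx'.1], by linarith [hx'.2]⟩

theorem eLpNorm_indicator_Icc {s t : ℝ} (hs : 0 ≤ s) (ht : t ≤ 1) (φ : ℝ → ℂ) (p : ℝ≥0∞) :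
    eLpNorm ((Set.Icc s t).indicator φ) p unitMeasure
      = eLpNorm φ p (volume.restrict (Set.Icc s t)) := by
  rw [eLpNorm_indicator_eq_eLpNorm_restrict measurableSet_Icc,
    Measure.restrict_restrict measurableSet_Icc, Set.inter_eq_left.2 (Set.Icc_subset_Icc hs ht)]

/-- A translation of the variable; it reduces negative steps in the modulus to positive ones. -/
theorem eLpNorm_fwdDiff_neg {p : ℝ≥0∞} (hp0 : p ≠ 0) (hpt : p ≠ ∞) (f : ℝ → ℂ) (h : ℝ) :
    eLpNorm (fwdDiff (-h) f) p (volume.restrict (Set.Icc h 1))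
      = eLpNorm (fwdDiff h f) p (volume.restrict (Set.Icc 0 (1 - h))) := by
  rw [eLpNorm_eq_lintegral_rpow_enorm_toReal hp0 hpt, eLpNorm_eq_lintegral_rpow_enorm_toReal hp0 hpt,
    ← setLIntegral_Icc_add]
  congr 1
  refine lintegral_congr fun x => ?_
  congr 1
  rw [fwdDiff, fwdDiff, add_neg_cancel_right, ← enorm_neg, neg_sub]

theorem KnotSeq.measurable_spline (c : ℤ → ℂ) : Measurable (Δ.spline k c) := by
  unfold KnotSeq.spline
  exact Finset.measurable_sum _ fun j _ => (measurable_bspline Δ.x k j).smul_const _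

/-- The constant is 6 = 4 + 1 + 1: the increment of the spline costs C h ≤ 4, the two translates of
e cost 1 each. For h > 1 the domain is empty. -/
theorem KnotSeq.KernelBound.eLpNorm_le {C : ℝ} (hC : Δ.KernelBound k C) (hC0 : 0 ≤ C) (hk : 1 ≤ k)
    {e : ℝ → ℂ} {a : ℤ → ℂ} (hem : Measurable e) (he : IntegrableOn e (Set.Icc 0 1))
    (ha : ∀ j ∈ Finset.Ico (-(k : ℤ)) n, a j = Δ.mean (k + 1) (fun t => Δ.spline k a t + e t) j)
    {p : ℝ≥0∞} (hp : 1 ≤ p) (hpt : p ≠ ∞) {h : ℝ} (h0 : 0 ≤ h) (hCh : C * h ≤ 4) :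
    eLpNorm (fwdDiff h fun t => Δ.spline k a t + e t) p (volume.restrict (Set.Icc 0 (1 - h)))
      ≤ 6 * eLpNorm e p unitMeasure := by
  rcases lt_or_ge 1 h with h1 | h1
  · rw [Set.Icc_eq_empty (by linarith), Measure.restrict_empty, eLpNorm_measure_zero]
    exact zero_le
  have hp0 : p ≠ 0 := (zero_lt_one.trans_le hp).ne'
  have hq : 1 ≤ p.toReal := by
    rw [← ENNReal.toReal_one]; exact ENNReal.toReal_mono hpt hp
  have hq0 : 0 < p.toReal := by linarith
  set ν := volume.restrict (Set.Icc 0 (1 - h)) with hν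
  have hle : ν ≤ unitMeasure := Measure.restrict_mono (Set.Icc_subset_Icc_right (by linarith)) le_rfl
  have n1 : eLpNorm e p ν ≤ eLpNorm e p unitMeasure := eLpNorm_mono_measure _ hle
  have n2 : eLpNorm (fun x => e (x + h)) p ν ≤ eLpNorm e p unitMeasure := by
    rw [eLpNorm_eq_lintegral_rpow_enorm_toReal hp0 hpt, eLpNorm_eq_lintegral_rpow_enorm_toReal hp0 hpt,
      hν, setLIntegral_Icc_add fun x => ‖e x‖ₑ ^ p.toReal]
    exact ENNReal.rpow_le_rpow (lintegral_mono_set (Set.Icc_subset_Icc_left h0)) (by positivity)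
  have n3 : eLpNorm (fun x => Δ.spline k a (x + h) - Δ.spline k a x) p ν
      ≤ 4 * eLpNorm e p unitMeasure := by
    rw [eLpNorm_eq_lintegral_rpow_enorm_toReal hp0 hpt, eLpNorm_eq_lintegral_rpow_enorm_toReal hp0 hpt]
    refine (ENNReal.rpow_le_rpow (hC.lintegral_le Δ hC0 hk he ha hq ⟨h0, h1⟩)
      (by positivity)).trans ?_
    rw [ENNReal.mul_rpow_of_nonneg _ _ (by positivity), ← ENNReal.rpow_mul,
      mul_one_div_cancel hq0.ne', ENNReal.rpow_one]
    refine mul_le_mul_left ?_ _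
    calc ENNReal.ofReal (C * h) ≤ ENNReal.ofReal 4 := ENNReal.ofReal_le_ofReal hCh
      _ = 4 := by norm_num
  have hs := Δ.measurable_spline (k := k) a
  have e1 : (fwdDiff h fun t => Δ.spline k a t + e t)
      = (fun x => Δ.spline k a (x + h) - Δ.spline k a x) + ((fun x => e (x + h)) - e) := by
    funext x
    simp only [fwdDiff, Pi.add_apply, Pi.sub_apply]
    ring
  have m1 : AEStronglyMeasurable (fun x => Δ.spline k a (x + h) - Δ.spline k a x) ν :=
    ((hs.comp (measurable_id.add_const h)).sub hs).aestronglyMeasurable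
  have m2 : AEStronglyMeasurable (fun x => e (x + h)) ν :=
    (hem.comp (measurable_id.add_const h)).aestronglyMeasurable
  rw [e1]
  calc _ ≤ _ := eLpNorm_add_le m1 (m2.sub hem.aestronglyMeasurable) hp
    _ ≤ 4 * eLpNorm e p unitMeasure + (eLpNorm e p unitMeasure + eLpNorm e p unitMeasure) :=
        add_le_add n3 ((eLpNorm_sub_le m2 hem.aestronglyMeasurable hp).trans (add_le_add n2 n1))
    _ = _ := by ring

/-- The step size is chosen so that the constant of the kernel bound becomes `4`. -/
theorem KnotSeq.exists_kernelBound (hk : 1 ≤ k) {γ : ℝ} (hγ : 0 ≤ γ)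
    (hE : Δ.EigenBound (k + 1) γ ∨ Δ.EigenBound k γ) {h : ℝ} (h0 : 0 < h)
    (h1 : h ≤ stepSize Δ k γ) : ∃ C, Δ.KernelBound k C ∧ 0 ≤ C ∧ C * h ≤ 4 := by
  have hmp := Δ.meshMin_pos
  have hpos : 0 < stepSize Δ k γ := h0.trans_le h1
  -- A positive admissible step excludes the degenerate cases: a condition number 0 would make the
  -- step size 0 through division by zero, and γ ≥ 1 would make it nonpositive.
  have hD : bsplineCond (k + 1) ≠ 0 := by
    intro h
    simp [stepSize, h] at hpos
  have hle := le_bsplineCond (K := k + 1) (by omega) hD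
  have hk1 : (1 : ℝ) ≤ k := by exact_mod_cast hk
  push_cast at hle
  have hD0 : 0 < bsplineCond (k + 1) := by nlinarith
  have hγ1 : γ < 1 := by
    by_contra hcon
    have : stepSize Δ k γ ≤ 0 :=
      mul_nonpos_of_nonneg_of_nonpos (by positivity)
        (div_nonpos_of_nonpos_of_nonneg (by linarith) hD0.le)
    linarith
  have hg : 0 < 1 - γ := by linarith
  refine ⟨_, Δ.kernelBound_bsplineCond hk hγ hγ1 hD hE, by positivity, ?_⟩
  refine (mul_le_mul_of_nonneg_left h1 (by positivity)).trans (le_of_eq ?_)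
  rw [stepSize]
  field_simp

theorem modulusLp_le (hk : 1 ≤ k) {p : ℝ≥0∞} [hp : Fact (1 ≤ p)] (hpt : p ≠ ∞) {γ : ℝ} (hγ : 0 ≤ γ)
    (hE : Δ.EigenBound (k + 1) γ ∨ Δ.EigenBound k γ) (f : Lp ℂ p unitMeasure) :
    1 / 6 * modulusLp 1 p f (stepSize Δ k γ) ≤ ‖intSchoenbergLp Δ k hk p f - f‖ₑ := by
  set a : ℤ → ℂ := Δ.mean (k + 1) f with ha
  set e : ℝ → ℂ := fun t => f t - Δ.spline k a t with he
  have hfe : (fun t => Δ.spline k a t + e t) = f := by funext t; simp [he]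
  have hsm := Δ.measurable_spline (k := k) a
  have hem : Measurable e := (Lp.stronglyMeasurable f).measurable.sub hsm
  have hei : IntegrableOn e (Set.Icc 0 1) :=
    ((Lp.memLp f).integrable hp.out).sub (Δ.integrableOn_spline hk a)
  have hnorm : ‖intSchoenbergLp Δ k hk p f - f‖ₑ = eLpNorm e p unitMeasure := by
    rw [Lp.enorm_def, ← eLpNorm_neg]
    refine eLpNorm_congr_ae ?_
    rw [intSchoenbergLp_apply]
    filter_upwards [Lp.coeFn_sub (splineLp Δ hk p (Δ.mean (k + 1) f)) f,
      coeFn_splineLp Δ hk p (Δ.mean (k + 1) f)] with t h1 h2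
    rw [Pi.neg_apply, h1, Pi.sub_apply, h2, neg_sub]
  rw [hnorm]
  have key : modulusLp 1 p f (stepSize Δ k γ) ≤ 6 * eLpNorm e p unitMeasure := by
    refine iSup₂_le fun h hh => ?_
    obtain ⟨C, hC, hC0, hCh⟩ := Δ.exists_kernelBound hk hγ hE hh.1 hh.2
    have main := hC.eLpNorm_le Δ hC0 hk hem hei (fun j _ => by rw [hfe]) hp.out hpt
      (abs_nonneg h) hCh
    rw [hfe] at main
    rw [Nat.cast_one, one_mul, Function.iterate_one]
    rcases le_total 0 h with h0 | h0
    · rw [abs_of_nonneg h0] at main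
      rwa [shiftDomain_of_nonneg h0, eLpNorm_indicator_Icc le_rfl (by linarith)]
    · rw [abs_of_nonpos h0, ← eLpNorm_fwdDiff_neg (zero_lt_one.trans_le hp.out).ne' hpt,
        neg_neg] at main
      have := shiftDomain_neg_of_nonneg (h := -h) (by linarith)
      rw [neg_neg] at this
      rwa [this, eLpNorm_indicator_Icc (by linarith) le_rfl]
  calc 1 / 6 * modulusLp 1 p f (stepSize Δ k γ) ≤ 1 / 6 * (6 * eLpNorm e p unitMeasure) :=
        mul_le_mul_right key _
    _ = _ := by
      rw [← mul_assoc, one_div, ENNReal.inv_mul_cancel (by norm_num) (by norm_num), one_mul]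

theorem modulusSup_le (hk : 1 ≤ k) {γ : ℝ} (hγ : 0 ≤ γ)
    (hE : Δ.EigenBound (k + 1) γ ∨ Δ.EigenBound k γ) (f : C(Set.Icc (0 : ℝ) 1, ℂ)) :
    1 / 6 * modulusSup 1 (Set.IccExtend zero_le_one f) (stepSize Δ k γ)
      ≤ ‖intSchoenbergC Δ k hk f - f‖ₑ := by
  set φ : ℝ → ℂ := Set.IccExtend zero_le_one f with hφ
  set a : ℤ → ℂ := Δ.mean (k + 1) φ with ha
  set e : ℝ → ℂ := fun t => φ t - Δ.spline k a t with he
  have hfe : (fun t => Δ.spline k a t + e t) = φ := by funext t; simp [he]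
  have hei : IntegrableOn e (Set.Icc 0 1) :=
    (f.continuous.Icc_extend'.continuousOn.integrableOn_Icc).sub (Δ.integrableOn_spline hk a)
  set M := ‖intSchoenbergC Δ k hk f - f‖ with hM
  have heM : ∀ t ∈ Set.Icc (0 : ℝ) 1, ‖e t‖ ≤ M := by
    intro t ht
    have := (intSchoenbergC Δ k hk f - f).norm_coe_le_norm ⟨t, ht⟩
    rw [← hM, ContinuousMap.sub_apply, intSchoenbergC_apply, splineC_apply, norm_sub_rev] at this
    rw [he]
    beta_reduce
    rwa [hφ, Set.IccExtend_of_mem _ _ ht]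
  have key : modulusSup 1 φ (stepSize Δ k γ) ≤ ENNReal.ofReal (6 * M) := by
    refine iSup₂_le fun h hh => iSup₂_le fun x hx => ?_
    obtain ⟨C, hC, hC0, hCh⟩ := Δ.exists_kernelBound hk hγ hE hh.1 hh.2
    rw [Nat.cast_one, one_mul] at hx
    rw [Function.iterate_one, ← ofReal_norm]
    refine ENNReal.ofReal_le_ofReal ?_
    have hx0 := hx.1
    have hx1 := hx.2 1 (by simp)
    rw [one_mul] at hx1
    have hM0 : 0 ≤ M := norm_nonneg _
    have hs : ‖Δ.spline k a (x + h) - Δ.spline k a x‖ ≤ 4 * M := by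
      refine le_trans ?_ (mul_le_mul_of_nonneg_right hCh hM0)
      have hrep : ∀ j ∈ Finset.Ico (-(k : ℤ)) n,
          a j = Δ.mean (k + 1) (fun t => Δ.spline k a t + e t) j := fun j _ => by rw [hfe]
      rcases le_total 0 h with h0 | h0
      · have := hC.norm_sub_le Δ hk hei hrep heM hx0 hx1 (by linarith)
        rw [add_sub_cancel_left] at this
        rwa [abs_of_nonneg h0]
      · have := hC.norm_sub_le Δ hk hei hrep heM hx1 hx0 (by linarith)
        rw [norm_sub_rev, sub_add_cancel_left] at this
        rwa [abs_of_nonpos h0]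
    have e1 : fwdDiff h φ x
        = (Δ.spline k a (x + h) - Δ.spline k a x) + (e (x + h) - e x) := by
      simp only [fwdDiff, he]; ring
    rw [e1]
    have h2 := norm_add_le (Δ.spline k a (x + h) - Δ.spline k a x) (e (x + h) - e x)
    have h3 := norm_sub_le (e (x + h)) (e x)
    linarith [heM _ hx0, heM _ hx1]
  calc 1 / 6 * modulusSup 1 φ (stepSize Δ k γ) ≤ 1 / 6 * ENNReal.ofReal (6 * M) :=
        mul_le_mul_right key _
    _ = _ := by
      rw [ENNReal.ofReal_mul (by norm_num), show ENNReal.ofReal 6 = 6 by norm_num, ← mul_assoc,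
        one_div, ENNReal.inv_mul_cancel (by norm_num) (by norm_num), one_mul, hM, ofReal_norm]

end SplineLower

/-! ### The lower estimate for both choices of γ -/

theorem mainTheorem9 (n k : ℕ) (hk : 1 ≤ k) (Δ : SplineLower.KnotSeq n) :
    (∀ (p : ℝ≥0∞) [Fact (1 ≤ p)], p ≠ ∞ →
      ∀ γ : ℝ, (γ = SplineLower.spectralSup (SplineLower.intSchoenbergLp Δ k hk p) ∨
          γ = SplineLower.spectralSup (SplineLower.schoenberg Δ k hk)) →
      ∀ f : Lp ℂ p SplineLower.unitMeasure,
        1 / 6 * SplineLower.modulusLp 1 p f (SplineLower.stepSize Δ k γ)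
          ≤ ‖SplineLower.intSchoenbergLp Δ k hk p f - f‖ₑ) ∧
    (∀ γ : ℝ, (γ = SplineLower.spectralSup (SplineLower.intSchoenbergC Δ k hk) ∨
          γ = SplineLower.spectralSup (SplineLower.schoenberg Δ k hk)) →
      ∀ f : C(Set.Icc (0 : ℝ) 1, ℂ),
        1 / 6 * SplineLower.modulusSup 1 (Set.IccExtend zero_le_one f)
            (SplineLower.stepSize Δ k γ)
          ≤ ‖SplineLower.intSchoenbergC Δ k hk f - f‖ₑ) := by
  refine ⟨fun p hp hpt γ hγ f => ?_, fun γ hγ f => ?_⟩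
  · refine SplineLower.modulusLp_le Δ hk hpt ?_ ?_ f
    · rcases hγ with rfl | rfl <;> exact SplineLower.spectralSup_nonneg _
    · rcases hγ with rfl | rfl
      · exact Or.inl (Δ.eigenBound_intSchoenbergLp hk p)
      · exact Or.inr (Δ.eigenBound_schoenberg hk)
  · refine SplineLower.modulusSup_le Δ hk ?_ ?_ f
    · rcases hγ with rfl | rfl <;> exact SplineLower.spectralSup_nonneg _
    · rcases hγ with rfl | rfl
      · exact Or.inl (Δ.eigenBound_intSchoenbergC hk)
      · exact Or.inr (Δ.eigenBound_schoenberg hk)
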